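/- Let $d\ge 0$ be an integer, $\beta>0$, and let $\mathcal P$ be the set of probability densities on $\mathbb R^d$ with finite second moment. Let $\rho_0\in\mathcal P$ be of the form $\rho_0=e^{-V_0}$ with $V_0\in C^2$, $D^2V_0$ bounded and $\liminf_{|x|\to\infty}\nabla V_0(x)\cdot\frac{x}{|x|}=\infty$. Let $h:\mathbb R^d\to\mathbb R$ be $C^2$ with $\int h^2\rho_0\,dx<\infty$, $D^2h$ bounded and $\liminf_{|x|\to\infty}\nabla h(x)\cdot\frac{x}{|x|}>-\infty$. Assume that $h$ has a unique minimizer $\bar x$ and that, for some compact set $D$ and some $r>0$, $h(x)>h(\bar x)+r$ for all $x\notin D$. For $\rho\in\mathcal P$ write $\hat h=\int h\rho\,dx$. For a vector field $u$ on $\mathbb R^d$ write $\frac1\rho\nabla\cdot(\rho u)=g$ if $\rho u$ and $g\rho$ are locally integrable and $\int\varphi\,g\rho\,dx=-\int\nabla\varphi\cdot u\,\rho\,dx$ for all $\varphi\in C^1_c(\mathbb R^d)$. Let $$L(\rho,u)=\frac12\int\Big|\frac1\rho\nabla\cdot(\rho u)\Big|^2\rho\,dx+\frac{\beta^2}{2}\int|h-\hat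 h|^2\rho\,dx\in[0,\infty],$$ the first term being $\infty$ if no such $g$ exists. A controlled path from $\rho_0$ is a pair $(\rho_t,u_t)_{t\ge0}$, jointly measurable in $(t,x)$, with the given initial density $\rho_0$ at $t=0$, with $\rho_t\in\mathcal P$ for all $t\ge0$ and $\int|u_t|^2\rho_t\,dx<\infty$ for almost every $t>0$, that solves the continuity equation $\partial_t\rho_t+\nabla\cdot(\rho_tu_t)=0$ weakly: for every $\varphi\in C^1_c(\mathbb R^d)$ and $t\ge0$, the function $s\mapsto\int\nabla\varphi\cdot u_s\,\rho_s\,dx$ is integrable on $[0,t]$ and $\int\varphi\rho_t\,dx=\int\varphi\rho_0\,dx+\int_0^t\int\nabla\varphi\cdot u_s\,\rho_s\,dx\,ds$. It is admissible if moreover $\lim_{t\to\infty}\int h\rho_t\,dx=h(\bar x)$. Let $J(u)=\int_0^\infty L(\rho_t,u_t)\,dt$, and let $V(\rho_0)$ be the infimum of $J(u)$ over all admissible controlled paths from $\rho_0$. An admissible path is optimal if $J(u)=V(\rho_0)$. Then $$V(\rho_0)=\beta\int_{\mathbb R^d}h\,\rho_0\,dx-\beta h(\bar x),$$ an optimal control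 exists, and a controlled path from $\rho_0$ is admissible and optimal if and only if, for almost every $t>0$, $$\frac{1}{\rho_t}\nabla\cdot(\rho_tu_t)=\beta(h-\hat h_t),\qquad \hat h_t=\int h\rho_t\,dx .$$ -/

import Mathlib

open MeasureTheory Filter Set
open scoped ENNReal Topology

namespace MeanFieldControl

noncomputable section

/-- Euclidean space `ℝᵈ`. -/
abbrev Space (d : ℕ) : Type := EuclideanSpace ℝ (Fin d)

/-- Probability densities on `ℝᵈ` (with respect to Lebesgue measure) with finite second moment. -/
structure IsDensity {d : ℕ} (ρ : Space d → ℝ) : Prop where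
  measurable : Measurable ρ
  nonneg : ∀ x, 0 ≤ ρ x
  integrable : Integrable ρ
  integral_eq_one : ∫ x, ρ x = 1
  second_moment : Integrable (fun x => ‖x‖ ^ 2 * ρ x)

/-- The prior is a density of the form `exp (-V₀)` with `V₀ ∈ C²`, `D²V₀` bounded and
`∇V₀(x) · x / |x| → ∞` as `|x| → ∞`. -/
structure PriorAssumption {d : ℕ} (ρ₀ : Space d → ℝ) : Prop where
  density : IsDensity ρ₀
  potential : ∃ V : Space d → ℝ, (∀ x, ρ₀ x = Real.exp (-V x)) ∧ ContDiff ℝ 2 V ∧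
    (∃ C : ℝ, ∀ x, ‖iteratedFDeriv ℝ 2 V x‖ ≤ C) ∧
    Tendsto (fun x => fderiv ℝ V x (‖x‖⁻¹ • x)) (Bornology.cobounded (Space d)) atTop

/-- The objective is `C²`, lies in `L²(ρ₀)`, has bounded Hessian, and
`liminf ∇h(x) · x / |x| > -∞` as `|x| → ∞`. -/
structure ObjectiveAssumption {d : ℕ} (ρ₀ h : Space d → ℝ) : Prop where
  contDiff : ContDiff ℝ 2 h
  sq_integrable : Integrable (fun x => h x ^ 2 * ρ₀ x)
  hessian_bounded : ∃ C : ℝ, ∀ x, ‖iteratedFDeriv ℝ 2 h x‖ ≤ C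
  radial : ∃ c : ℝ, ∀ᶠ x in Bornology.cobounded (Space d), c ≤ fderiv ℝ h x (‖x‖⁻¹ • x)

/-- `xbar` is the unique minimizer of `h`, and outside some compact set `h` exceeds its minimum
by at least a fixed positive amount. -/
structure MinimizerAssumption {d : ℕ} (h : Space d → ℝ) (xbar : Space d) : Prop where
  unique_min : ∀ x, x ≠ xbar → h xbar < h x
  gap : ∃ D : Set (Space d), IsCompact D ∧ ∃ r : ℝ, 0 < r ∧ ∀ x ∉ D, h xbar + r < h x

/-- Test functions: compactly supported and continuously differentiable. -/
def IsTest {d : ℕ} (φ : Space d → ℝ) : Prop :=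
  ContDiff ℝ 1 φ ∧ HasCompactSupport φ

/-- `mean ρ f = ∫ f ρ dx`, written `f̂`. -/
def mean {d : ℕ} (ρ f : Space d → ℝ) : ℝ := ∫ x, f x * ρ x

/-- `(1/ρ) ∇ · (ρ u) = g` in the weak sense: the distribution `∇ · (ρ u)` is the locally integrable
function `g ρ`. Such a `g` is unique `ρ`-almost everywhere. -/
structure IsWeakDiv {d : ℕ} (ρ : Space d → ℝ) (u : Space d → Space d) (g : Space d → ℝ) :
    Prop where
  flux : LocallyIntegrable (fun x => ρ x • u x)
  locallyIntegrable : LocallyIntegrable (fun x => g x * ρ x)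
  weak : ∀ φ : Space d → ℝ, IsTest φ →
    ∫ x, φ x * (g x * ρ x) = -∫ x, fderiv ℝ φ x (u x) * ρ x

/-- The control cost `½ ∫ |(1/ρ) ∇ · (ρ u)|² ρ dx`, with the value `∞` when the integral diverges or
`∇ · (ρ u)` is not of the form `g ρ`. The infimum is over the versions of one function. -/
def controlCost {d : ℕ} (ρ : Space d → ℝ) (u : Space d → Space d) : ℝ≥0∞ :=
  ⨅ (g : Space d → ℝ) (_ : IsWeakDiv ρ u g),
    ENNReal.ofReal (1 / 2) * ∫⁻ x, ENNReal.ofReal (g x ^ 2 * ρ x)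

/-- The Lagrangian
`L(ρ,u) = ½ ∫ |(1/ρ) ∇ · (ρ u)|² ρ dx + (β²/2) ∫ |h - ĥ|² ρ dx`, with values in `[0,∞]`. -/
def lagrangian {d : ℕ} (β : ℝ) (h ρ : Space d → ℝ) (u : Space d → Space d) : ℝ≥0∞ :=
  controlCost ρ u +
    ENNReal.ofReal (β ^ 2 / 2) * ∫⁻ x, ENNReal.ofReal ((h x - mean ρ h) ^ 2 * ρ x)

/-- `ρ` is a path of densities issued from `ρ₀` and driven by the control `u`:
`u_t ∈ L²(ρ_t)`, and the continuity equation `∂ρ/∂t + ∇ · (ρ u) = 0` holds for `t ≥ 0` in the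
weak sense (integrated in time, tested in space). Only times `t ≥ 0` matter. -/
structure IsControlledPath {d : ℕ} (ρ₀ : Space d → ℝ) (ρ : ℝ → Space d → ℝ)
    (u : ℝ → Space d → Space d) : Prop where
  measurable_density : Measurable (Function.uncurry ρ)
  measurable_control : Measurable (Function.uncurry u)
  density : ∀ t, 0 ≤ t → IsDensity (ρ t)
  initial : ρ 0 = ρ₀
  control_sq_integrable : ∀ᵐ t ∂(volume.restrict (Ioi (0 : ℝ))),
    Integrable (fun x => ‖u t x‖ ^ 2 * ρ t x)
  continuity : ∀ φ : Space d → ℝ, IsTest φ → ∀ t, 0 ≤ t →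
    IntervalIntegrable (fun s => ∫ x, fderiv ℝ φ x (u s x) * ρ s x) volume 0 t ∧
    ∫ x, φ x * ρ t x =
      (∫ x, φ x * ρ₀ x) + ∫ s in (0 : ℝ)..t, ∫ x, fderiv ℝ φ x (u s x) * ρ s x

/-- Admissible for the infinite-horizon problem: a controlled path that moreover satisfies the
terminal constraint `∫ h ρ_t dx → h(xbar)` as `t → ∞`. -/
structure IsAdmissible {d : ℕ} (h : Space d → ℝ) (xbar : Space d) (ρ₀ : Space d → ℝ)
    (ρ : ℝ → Space d → ℝ) (u : ℝ → Space d → Space d) : Prop where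
  path : IsControlledPath ρ₀ ρ u
  terminal : Tendsto (fun t => mean (ρ t) h) atTop (𝓝 (h xbar))

/-- The cost `J(u) = ∫₀^∞ L(ρ_t, u_t) dt`. -/
def cost {d : ℕ} (β : ℝ) (h : Space d → ℝ) (ρ : ℝ → Space d → ℝ)
    (u : ℝ → Space d → Space d) : ℝ≥0∞ :=
  ∫⁻ t in Ioi (0 : ℝ), lagrangian β h (ρ t) (u t)

/-- The value function: the infimum of the cost over all admissible controls started at `ρ₀`. -/
def valueFunction {d : ℕ} (β : ℝ) (h : Space d → ℝ) (xbar : Space d) (ρ₀ : Space d → ℝ) : ℝ≥0∞ :=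
  ⨅ (ρ : ℝ → Space d → ℝ) (u : ℝ → Space d → Space d) (_ : IsAdmissible h xbar ρ₀ ρ u),
    cost β h ρ u

/-- An optimal control together with its path: admissible, with cost equal to the value. -/
def IsOptimal {d : ℕ} (β : ℝ) (h : Space d → ℝ) (xbar : Space d) (ρ₀ : Space d → ℝ)
    (ρ : ℝ → Space d → ℝ) (u : ℝ → Space d → Space d) : Prop :=
  IsAdmissible h xbar ρ₀ ρ u ∧ cost β h ρ u = valueFunction β h xbar ρ₀

/-- `u` obeys the law `(1/ρ_t) ∇ · (ρ_t u_t) = β (h - ĥ_t)` at almost every time `t > 0`. -/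
def SolvesControlLaw {d : ℕ} (β : ℝ) (h : Space d → ℝ)
    (ρ : ℝ → Space d → ℝ) (u : ℝ → Space d → Space d) : Prop :=
  ∀ᵐ t ∂(volume.restrict (Ioi (0 : ℝ))),
    IsWeakDiv (ρ t) (u t) (fun x => β * (h x - mean (ρ t) h))

end

end MeanFieldControl

/-! The core is a completion of squares. If `g` is the weak divergence of the control, the mean `ĥ`
of `h` satisfies `dĥ/dt = -∫ (h - ĥ) g ρ`, so the Lagrangian equals `½ ∫ (g - β (h - ĥ))² ρ - β
dĥ/dt`. Integrating over all times and using the terminal constraint, the cost is at least `β (∫ h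
ρ₀ - h xbar)`, and equality forces the square to vanish at almost every time, which is the control
law. This is `exists_energy_identity` and `le_cost`. Since `h` is not a test function, the equation
for `ĥ` (`mean_eq`) is reached by cutoffs and bounded truncations of `h`. The cost, an infimum over
`g`, becomes measurable in time once it is rewritten as a countable dual supremum
(`dualCost_eq_controlCost`).

Conversely, the control law turns the continuity equation into `∂ρ/∂t = -β (h - ĥ) ρ`, a scalar
linear equation at almost every point. Its solution is a Gibbs reweighting of the prior,
proportional to `ρ₀ exp (-β t (h - h xbar))` (`exists_ae_eq_gibbs`). Laplace's principle then yields
the terminal constraint (`tendsto_mean_of_law`), and the dissipation of `ĥ` bounds the cost from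
above by the same value (`lintegral_variance_le`, `cost_le_of_law`).

It remains to find a square integrable, jointly measurable control that drives the Gibbs path. The
Gibbs densities are multiples of `e^{-U}` with `U = V₀ + β t (h - h xbar)`. The radial growth of
`V₀` beats the lower bound on the radial slope of `h`, uniformly for bounded `t`, so a Lyapunov
estimate combined with the Poincaré inequality on a ball gives a Poincaré inequality with one
constant on each bounded time interval (`exists_poincare_gibbsPath`). One application of Riesz
representation in space-time then solves the weak Poisson equations at almost all times together
(`exists_control_of_poincare`). -/

namespace MeanFieldControl

/-! ### Functional-analytic tools: Riesz, a Volterra equation, cutoffs, dense test functions -/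

/-- **Riesz representation** of a functional dominated by a quadratic form. -/
theorem riesz_of_quadratic_bound {E H : Type*} [AddCommGroup E] [Module ℝ E]
    [NormedAddCommGroup H] [InnerProductSpace ℝ H] [CompleteSpace H]
    (A : E →ₗ[ℝ] H) (ℓ : E →ₗ[ℝ] ℝ) (C : ℝ) (hb : ∀ e, ℓ e ≤ C + ‖A e‖ ^ 2 / 2) :
    ∃ v : H, ‖v‖ ^ 2 ≤ 2 * C ∧ ∀ e, inner ℝ v (A e) = ℓ e := by
  have hC : 0 ≤ C := by simpa using hb 0
  have hsq : ∀ e, |ℓ e| ≤ √(2 * C) * ‖A e‖ := by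
    intro e
    -- Applying the bound to every multiple `s • e` gives a quadratic in `s` that is never negative;
    -- its discriminant yields `ℓ(e)² ≤ 2 C ‖A e‖²`.
    have hd : discrim (‖A e‖ ^ 2 / 2) (-ℓ e) C ≤ 0 := by
      refine discrim_le_zero fun s => ?_
      have h1 := hb (s • e)
      rw [map_smul, map_smul, norm_smul, smul_eq_mul, mul_pow, Real.norm_eq_abs, sq_abs] at h1
      nlinarith
    rw [discrim] at hd
    rw [← abs_of_nonneg (norm_nonneg (A e)), ← Real.sqrt_sq_eq_abs, ← Real.sqrt_sq_eq_abs,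
      ← Real.sqrt_mul (by positivity)]
    exact Real.sqrt_le_sqrt (by nlinarith)
  have hker : LinearMap.ker A ≤ LinearMap.ker ℓ := by
    intro e he
    rw [LinearMap.mem_ker] at he ⊢
    have := hsq e
    rw [he, norm_zero, mul_zero] at this
    exact abs_nonpos_iff.1 this
  let f₀ : LinearMap.range A →ₗ[ℝ] ℝ :=
    ((LinearMap.ker A).liftQ ℓ hker) ∘ₗ A.quotKerEquivRange.symm.toLinearMap
  have hf₀ : ∀ e, f₀ ⟨A e, LinearMap.mem_range_self A e⟩ = ℓ e := by
    intro e
    have : A.quotKerEquivRange.symm ⟨A e, LinearMap.mem_range_self A e⟩ =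
        (LinearMap.ker A).mkQ e := by
      rw [LinearEquiv.symm_apply_eq]
      exact Subtype.ext rfl
    simp only [f₀, LinearMap.comp_apply, LinearEquiv.coe_coe, this]
    simp
  let f : StrongDual ℝ (LinearMap.range A) := f₀.mkContinuous (√(2 * C)) (by
    rintro ⟨_, e, rfl⟩
    rw [hf₀ e, Real.norm_eq_abs]
    exact hsq e)
  -- The functional descends to the range of `A`, which need not be closed; the norm-preserving
  -- extension to all of `H` is then represented by a vector, and the norm bound survives.
  obtain ⟨g, hg, hgn⟩ := _root_.exists_extension_norm_eq (LinearMap.range A) f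
  refine ⟨(InnerProductSpace.toDual ℝ H).symm g, ?_, fun e => ?_⟩
  · rw [LinearIsometryEquiv.norm_map, hgn]
    calc ‖f‖ ^ 2 ≤ √(2 * C) ^ 2 := by
          gcongr
          exact LinearMap.mkContinuous_norm_le _ (Real.sqrt_nonneg _) _
      _ = 2 * C := Real.sq_sqrt (by positivity)
  · rw [InnerProductSpace.toDual_symm_apply]
    have := hg ⟨A e, LinearMap.mem_range_self A e⟩
    rw [this, ← hf₀ e]
    rfl

/-- An absolutely continuous function is bounded on the interval, and the exponential is Lipschitz
on bounded sets. -/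
theorem _root_.AbsolutelyContinuousOnInterval.exp {f : ℝ → ℝ} {a b : ℝ}
    (hf : AbsolutelyContinuousOnInterval f a b) :
    AbsolutelyContinuousOnInterval (fun t => Real.exp (f t)) a b := by
  obtain ⟨M, hM⟩ := hf.exists_bound
  have hlip : ∀ x ∈ uIcc a b, ∀ y ∈ uIcc a b,
      dist (Real.exp (f x)) (Real.exp (f y)) ≤ Real.exp M * dist (f x) (f y) := by
    intro x hx y hy
    have hb : ∀ z ∈ Icc (-M) M, ‖deriv Real.exp z‖ ≤ Real.exp M := by
      intro z hz
      rw [Real.deriv_exp, Real.norm_eq_abs, Real.abs_exp]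
      exact Real.exp_le_exp.2 hz.2
    have hm : ∀ z ∈ uIcc a b, f z ∈ Icc (-M) M := fun z hz => abs_le.1 (hM z hz)
    rw [dist_eq_norm, dist_eq_norm]
    exact (convex_Icc (-M) M).norm_image_sub_le_of_norm_deriv_le
      (fun z _ => Real.differentiableAt_exp) hb (hm y hy) (hm x hx)
  have h0 := Tendsto.const_mul (Real.exp M) hf
  rw [mul_zero] at h0
  refine squeeze_zero' (Eventually.of_forall fun E => Finset.sum_nonneg fun _ _ => dist_nonneg)
    ?_ h0
  refine eventually_inf_principal.mpr (Eventually.of_forall fun E hE => ?_)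
  rw [Finset.mul_sum]
  exact Finset.sum_le_sum fun i hi => hlip _ (hE.1 i hi).1 _ (hE.1 i hi).2

/-- The scalar Volterra equation `y = y₀ - ∫ k y` with integrable coefficient. -/
theorem eq_mul_exp_of_volterra {k y : ℝ → ℝ} {T y₀ : ℝ} (hT : 0 ≤ T)
    (hk : IntervalIntegrable k volume 0 T)
    (hky : IntervalIntegrable (fun s => k s * y s) volume 0 T)
    (hy : ∀ t ∈ Icc 0 T, y t = y₀ - ∫ s in (0 : ℝ)..t, k s * y s) :
    ∀ t ∈ Icc 0 T, y t = y₀ * Real.exp (-∫ s in (0 : ℝ)..t, k s) := by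
  have hu : uIcc 0 T = Icc 0 T := uIcc_of_le hT
  have h0 : (0 : ℝ) ∈ uIcc 0 T := left_mem_uIcc
  set Y : ℝ → ℝ := fun t => y₀ - ∫ s in (0 : ℝ)..t, k s * y s with hY
  set K : ℝ → ℝ := fun t => ∫ s in (0 : ℝ)..t, k s with hK
  have hconst : AbsolutelyContinuousOnInterval (fun _ : ℝ => y₀) 0 T :=
    (contDiff_const.contDiffOn (n := 1)).absolutelyContinuousOnInterval
  have hYac : AbsolutelyContinuousOnInterval Y 0 T :=
    hconst.fun_sub (hky.absolutelyContinuousOnInterval_intervalIntegral h0)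
  have hKac : AbsolutelyContinuousOnInterval K 0 T :=
    hk.absolutelyContinuousOnInterval_intervalIntegral h0
  -- The integrating factor `exp K` works although `k` is merely integrable: the product `Y exp K`
  -- is absolutely continuous and its derivative vanishes almost everywhere, hence it is constant.
  obtain ⟨c, hc⟩ := (hYac.fun_mul hKac.exp).const_of_ae_hasDerivAt_zero (by
    filter_upwards [hk.ae_hasDerivAt_integral, hky.ae_hasDerivAt_integral] with t h1 h2 ht
    have h3 := (h2 ht 0 h0).const_sub y₀
    have h4 := h3.mul (h1 ht 0 h0).exp
    have h5 : y t = Y t := hy t (hu ▸ ht)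
    have h6 : -(k t * y t) * Real.exp (K t) + Y t * (Real.exp (K t) * k t) = 0 := by
      rw [h5]
      ring
    rw [← h6]
    exact h4)
  have hc0 : c = y₀ := by
    rw [← hc 0 h0]
    simp [hY, hK]
  intro t ht
  have h1 := hc t (hu.symm ▸ ht)
  rw [hy t ht, Real.exp_neg, ← div_eq_mul_inv, eq_div_iff (Real.exp_pos _).ne']
  exact h1.trans hc0

/-- Smooth cutoffs `χ n ↑ 1` whose gradients tend to zero uniformly. -/
theorem exists_cutoff (d : ℕ) : ∃ (χ : ℕ → Space d → ℝ) (C : ℝ), 0 ≤ C ∧ (∀ n, IsTest (χ n)) ∧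
    (∀ n x, 0 ≤ χ n x ∧ χ n x ≤ 1) ∧ (∀ (n : ℕ) x, ‖x‖ ≤ n + 1 → χ n x = 1) ∧
    (∀ (n : ℕ) x, ‖fderiv ℝ (χ n) x‖ ≤ C / (n + 1)) := by
  let b : ContDiffBump (0 : Space d) := ⟨1, 2, one_pos, one_lt_two⟩
  have hb1 : ContDiff ℝ 1 (b : Space d → ℝ) := b.contDiff
  have hbc : HasCompactSupport (b : Space d → ℝ) := b.hasCompactSupport
  obtain ⟨C, hC⟩ := (hbc.fderiv (𝕜 := ℝ)).exists_bound_of_continuous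
    (hb1.continuous_fderiv one_ne_zero)
  have hpos : ∀ n : ℕ, (0 : ℝ) < n + 1 := fun n => by positivity
  have hC0 : 0 ≤ C := (norm_nonneg _).trans (hC 0)
  -- Dilating one bump, equal to `1` on the unit ball, by the factor `n + 1` divides its gradient by
  -- `n + 1`.
  refine ⟨fun n x => b (((n : ℝ) + 1)⁻¹ • x), C, hC0, fun n => ⟨?_, ?_⟩, fun n x => ⟨b.nonneg, b.le_one⟩,
    fun n x hx => ?_, fun n x => ?_⟩
  · exact hb1.comp (contDiff_const_smul _)
  · exact hbc.comp_homeomorph (Homeomorph.smulOfNeZero (((n : ℝ) + 1)⁻¹) (inv_ne_zero (hpos n).ne'))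
  · refine b.one_of_mem_closedBall ?_
    rw [mem_closedBall_zero_iff, norm_smul, norm_inv, Real.norm_of_nonneg (hpos n).le]
    exact inv_mul_le_one_of_le₀ hx (hpos n).le
  · have h1 : HasFDerivAt (fun x : Space d => ((n : ℝ) + 1)⁻¹ • x)
        (((n : ℝ) + 1)⁻¹ • ContinuousLinearMap.id ℝ (Space d)) x :=
      (hasFDerivAt_id x).const_smul (((n : ℝ) + 1)⁻¹)
    have h2 := ((hb1.differentiable one_ne_zero) (((n : ℝ) + 1)⁻¹ • x)).hasFDerivAt.comp x h1
    have h3 : fderiv ℝ (fun x : Space d => b (((n : ℝ) + 1)⁻¹ • x)) x = _ := h2.fderiv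
    rw [h3, ContinuousLinearMap.comp_smul, ContinuousLinearMap.comp_id, norm_smul, norm_inv,
      Real.norm_of_nonneg (hpos n).le, div_eq_inv_mul]
    gcongr
    exact hC _

theorem IsTest.continuous {d : ℕ} {φ : Space d → ℝ} (h : IsTest φ) : Continuous φ :=
  h.1.continuous

theorem IsTest.continuous_fderiv {d : ℕ} {φ : Space d → ℝ} (h : IsTest φ) :
    Continuous (fderiv ℝ φ) := h.1.continuous_fderiv one_ne_zero

theorem IsTest.bound {d : ℕ} {φ : Space d → ℝ} (h : IsTest φ) : ∃ C, 0 ≤ C ∧ ∀ x, |φ x| ≤ C := by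
  obtain ⟨C, hC⟩ := h.2.exists_bound_of_continuous h.continuous
  exact ⟨C, (norm_nonneg _).trans (hC 0), hC⟩

theorem IsTest.bound_fderiv {d : ℕ} {φ : Space d → ℝ} (h : IsTest φ) :
    ∃ C, 0 ≤ C ∧ ∀ x, ‖fderiv ℝ φ x‖ ≤ C := by
  obtain ⟨C, hC⟩ := (h.2.fderiv (𝕜 := ℝ)).exists_bound_of_continuous h.continuous_fderiv
  exact ⟨C, (norm_nonneg _).trans (hC 0), hC⟩

theorem IsTest.mul_left {d : ℕ} {f φ : Space d → ℝ} (hφ : IsTest φ) (hf : ContDiff ℝ 1 f) :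
    IsTest (fun x => f x * φ x) := ⟨hf.mul hφ.1, hφ.2.mul_left⟩

/-- A countable family of test functions which is dense in the `C¹` norm. -/
theorem exists_dense_tests (d : ℕ) : ∃ Φ : ℕ → Space d → ℝ, (∀ n, IsTest (Φ n)) ∧
    ∀ φ, IsTest φ → ∀ ε > 0, ∃ n, (∀ x, |Φ n x - φ x| ≤ ε) ∧
      ∀ x, ‖fderiv ℝ (Φ n) x - fderiv ℝ φ x‖ ≤ ε := by
  -- `S N` collects the tests living in the ball of radius `N`. The map sending `φ` to the pair of
  -- `φ` and its derivative embeds it in a second countable space of continuous maps, and second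
  -- countability, unlike separability, passes to the induced topology. Convergence there is uniform
  -- on the ball, and everything vanishes outside.
  let S : ℕ → Type := fun N => {φ : Space d → ℝ // IsTest φ ∧ ∀ x, (N : ℝ) < ‖x‖ →
    φ x = 0 ∧ fderiv ℝ φ x = 0}
  let J : ∀ N, S N → C(Space d, ℝ × (Space d →L[ℝ] ℝ)) := fun N φ =>
    ⟨fun x => (φ.1 x, fderiv ℝ φ.1 x), φ.2.1.continuous.prodMk φ.2.1.continuous_fderiv⟩
  have hzero : ∀ N : ℕ, IsTest (fun _ : Space d => (0 : ℝ)) ∧ ∀ x : Space d, (N : ℝ) < ‖x‖ →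
      (fun _ : Space d => (0 : ℝ)) x = 0 ∧ fderiv ℝ (fun _ : Space d => (0 : ℝ)) x = 0 := fun N =>
    ⟨⟨contDiff_const, HasCompactSupport.zero⟩, fun x _ => ⟨rfl, by simp⟩⟩
  have hex : ∀ N, ∃ s : ℕ → S N, ∀ φ : S N, ∀ ε > 0, ∃ n, (∀ x, |(s n).1 x - φ.1 x| ≤ ε) ∧
      ∀ x, ‖fderiv ℝ (s n).1 x - fderiv ℝ φ.1 x‖ ≤ ε := by
    intro N
    let _ : TopologicalSpace (S N) := TopologicalSpace.induced (J N) inferInstance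
    have : SecondCountableTopology (S N) := TopologicalSpace.secondCountableTopology_induced _ _ _
    have : Nonempty (S N) := ⟨⟨_, hzero N⟩⟩
    obtain ⟨s, hs⟩ := TopologicalSpace.exists_dense_seq (S N)
    refine ⟨s, fun φ ε hε => ?_⟩
    have hcont : Continuous (J N) := continuous_induced_dom
    have hK : IsCompact (Metric.closedBall (0 : Space d) N) := isCompact_closedBall _ _
    have hnhds : {f : C(Space d, ℝ × (Space d →L[ℝ] ℝ)) |
        ∀ x ∈ Metric.closedBall (0 : Space d) N, dist (J N φ x) (f x) < ε} ∈ 𝓝 (J N φ) := by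
      have := (ContinuousMap.tendsto_iff_forall_isCompact_tendstoUniformlyOn (F := fun f => f)
        (f := J N φ) (p := 𝓝 (J N φ))).1 tendsto_id _ hK
      exact Metric.tendstoUniformlyOn_iff.1 this ε hε
    obtain ⟨n, hn⟩ := hs.exists_mem_open (s := interior (J N ⁻¹' {f |
        ∀ x ∈ Metric.closedBall (0 : Space d) N, dist (J N φ x) (f x) < ε})) isOpen_interior
      ⟨φ, mem_interior_iff_mem_nhds.2 (hcont.continuousAt.preimage_mem_nhds hnhds)⟩
    have hn' : ∀ x ∈ Metric.closedBall (0 : Space d) N, dist (J N φ x) (J N (s n) x) < ε :=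
      interior_subset hn
    have key : ∀ x, |(s n).1 x - φ.1 x| ≤ ε ∧ ‖fderiv ℝ (s n).1 x - fderiv ℝ φ.1 x‖ ≤ ε := by
      intro x
      by_cases hx : ‖x‖ ≤ N
      · have h1 := hn' x (mem_closedBall_zero_iff.2 hx)
        rw [Prod.dist_eq, max_lt_iff] at h1
        refine ⟨?_, ?_⟩
        · have := h1.1.le
          rwa [dist_comm, Real.dist_eq] at this
        · have := h1.2.le
          rwa [dist_comm, dist_eq_norm] at this
      · obtain ⟨h1, h2⟩ := (s n).2.2 x (not_le.1 hx)
        obtain ⟨h3, h4⟩ := φ.2.2 x (not_le.1 hx)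
        rw [h1, h2, h3, h4]
        simp [hε.le]
    exact ⟨n, fun x => (key x).1, fun x => (key x).2⟩
  choose s hs using hex
  refine ⟨fun k => (s k.unpair.1 k.unpair.2).1, fun k => (s _ _).2.1, fun φ hφ ε hε => ?_⟩
  obtain ⟨R, hR⟩ := hφ.2.isCompact.isBounded.exists_norm_le
  obtain ⟨N, hN⟩ := exists_nat_ge R
  have hmem : ∀ x, (N : ℝ) < ‖x‖ → φ x = 0 ∧ fderiv ℝ φ x = 0 := by
    intro x hx
    have hx' : x ∉ tsupport φ := fun h => absurd (hR x h) (not_le.2 (hN.trans_lt hx))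
    refine ⟨image_eq_zero_of_notMem_tsupport hx', ?_⟩
    by_contra hne
    exact hx' (support_fderiv_subset ℝ hne)
  obtain ⟨n, h1, h2⟩ := hs N ⟨φ, hφ, hmem⟩ ε hε
  exact ⟨Nat.pair N n, by beta_reduce; rw [Nat.unpair_pair]; exact ⟨h1, h2⟩⟩

/-- A `C²` function with bounded Hessian grows at most quadratically. -/
theorem exists_quadratic_bound {d : ℕ} {h : Space d → ℝ} (hc : ContDiff ℝ 2 h)
    (hb : ∃ C : ℝ, ∀ x, ‖iteratedFDeriv ℝ 2 h x‖ ≤ C) :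
    ∃ C, 0 ≤ C ∧ ∀ x, |h x| ≤ C * (1 + ‖x‖ ^ 2) := by
  obtain ⟨C, hC⟩ := hb
  have hC0 : 0 ≤ C := (norm_nonneg _).trans (hC 0)
  have hd1 : ContDiff ℝ 1 (fderiv ℝ h) := hc.fderiv_right (by norm_num)
  have hD2 : ∀ x, ‖fderiv ℝ (fderiv ℝ h) x‖ ≤ C := by
    intro x
    have : ‖iteratedFDeriv ℝ 2 h x‖ = ‖fderiv ℝ (fderiv ℝ h) x‖ := by
      rw [← norm_iteratedFDeriv_fderiv (n := 1), ← norm_iteratedFDeriv_fderiv (n := 0),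
        norm_iteratedFDeriv_zero]
    exact this ▸ hC x
  have hD : ∀ x, ‖fderiv ℝ h x‖ ≤ ‖fderiv ℝ h 0‖ + C * ‖x‖ := by
    intro x
    have h1 := Convex.norm_image_sub_le_of_norm_fderiv_le (𝕜 := ℝ)
      (fun y _ => hd1.differentiable one_ne_zero y) (fun y _ => hD2 y) convex_univ
      (mem_univ 0) (mem_univ x)
    rw [sub_zero] at h1
    calc ‖fderiv ℝ h x‖ = ‖fderiv ℝ h 0 + (fderiv ℝ h x - fderiv ℝ h 0)‖ := by congr 1; abel
      _ ≤ _ := (norm_add_le _ _).trans (by gcongr)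
  set A := ‖fderiv ℝ h 0‖
  have hA : 0 ≤ A := norm_nonneg _
  refine ⟨|h 0| + A + C, by positivity, fun x => ?_⟩
  have h2 : ‖h x - h 0‖ ≤ (A + C * ‖x‖) * ‖x - 0‖ :=
    Convex.norm_image_sub_le_of_norm_fderiv_le (𝕜 := ℝ) (s := Metric.closedBall 0 ‖x‖)
      (fun y _ => hc.differentiable two_ne_zero y)
      (fun y hy => (hD y).trans (by gcongr; exact mem_closedBall_zero_iff.1 hy))
      (convex_closedBall _ _) (by simp) (by simp)
  rw [sub_zero, Real.norm_eq_abs] at h2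
  have h3 : |h x| ≤ |h 0| + |h x - h 0| := by
    have := abs_add_le (h 0) (h x - h 0)
    rwa [add_sub_cancel] at this
  nlinarith [abs_nonneg (h 0), norm_nonneg x, sq_nonneg (‖x‖ - 1), mul_nonneg hA (sq_nonneg (‖x‖ - 1)), mul_nonneg (abs_nonneg (h 0)) (sq_nonneg ‖x‖), mul_nonneg hA (sq_nonneg ‖x‖)]

end MeanFieldControl

/-! ### Weak divergences and the control cost at a fixed time -/

namespace MeanFieldControl

/-- The measure with real density `ρ` with respect to `μ`. -/
noncomputable def densMeasure {α : Type*} [MeasurableSpace α] (μ : Measure α) (ρ : α → ℝ) :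
    Measure α := μ.withDensity fun x => ENNReal.ofReal (ρ x)

section DensMeasure

variable {α : Type*} [MeasurableSpace α] {μ : Measure α} {ρ : α → ℝ}

theorem integral_densMeasure (hm : Measurable ρ) (h0 : ∀ x, 0 ≤ ρ x) (f : α → ℝ) :
    ∫ x, f x ∂densMeasure μ ρ = ∫ x, f x * ρ x ∂μ := by
  rw [densMeasure, integral_withDensity_eq_integral_toReal_smul hm.ennreal_ofReal (by simp)]
  refine integral_congr_ae (Eventually.of_forall fun x => ?_)
  simp [ENNReal.toReal_ofReal (h0 x), mul_comm]

theorem integrable_densMeasure (hm : Measurable ρ) (h0 : ∀ x, 0 ≤ ρ x) {f : α → ℝ} :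
    Integrable f (densMeasure μ ρ) ↔ Integrable (fun x => f x * ρ x) μ := by
  rw [densMeasure, integrable_withDensity_iff_integrable_smul' hm.ennreal_ofReal (by simp)]
  refine integrable_congr (Eventually.of_forall fun x => ?_)
  simp [ENNReal.toReal_ofReal (h0 x), mul_comm]

theorem isFiniteMeasure_densMeasure (h0 : ∀ x, 0 ≤ ρ x) (hi : Integrable ρ μ) :
    IsFiniteMeasure (densMeasure μ ρ) := by
  refine ⟨?_⟩
  rw [densMeasure, withDensity_apply _ MeasurableSet.univ, Measure.restrict_univ,
    ← ofReal_integral_eq_lintegral_ofReal hi (Eventually.of_forall h0)]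
  exact ENNReal.ofReal_lt_top

/-- Products of square integrable functions, with an explicit weight. -/
theorem integrable_mul_mul_of_sq {f g : α → ℝ} (h0 : ∀ x, 0 ≤ ρ x)
    (hm : AEStronglyMeasurable (fun x => f x * g x * ρ x) μ)
    (hf : Integrable (fun x => f x ^ 2 * ρ x) μ) (hg : Integrable (fun x => g x ^ 2 * ρ x) μ) :
    Integrable (fun x => f x * g x * ρ x) μ := by
  refine (hf.add hg).mono' hm (Eventually.of_forall fun x => ?_)
  rw [Real.norm_eq_abs, abs_mul, abs_of_nonneg (h0 x), Pi.add_apply, ← add_mul]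
  refine mul_le_mul_of_nonneg_right ?_ (h0 x)
  rw [abs_le]
  constructor <;> nlinarith [sq_nonneg (f x + g x), sq_nonneg (f x - g x), sq_nonneg (f x), sq_nonneg (g x)]

theorem integrable_mul_of_sq {f : α → ℝ} (h0 : ∀ x, 0 ≤ ρ x) (hρ : Integrable ρ μ)
    (hm : AEStronglyMeasurable (fun x => f x * ρ x) μ)
    (hf : Integrable (fun x => f x ^ 2 * ρ x) μ) :
    Integrable (fun x => f x * ρ x) μ := by
  have h1 : Integrable (fun x => (1 : ℝ) ^ 2 * ρ x) μ := by simpa using hρ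
  simpa using integrable_mul_mul_of_sq (g := fun _ => (1 : ℝ)) h0 (by simpa using hm) hf h1

end DensMeasure

theorem measurable_fderiv_apply {α : Type*} [MeasurableSpace α] {d : ℕ} {φ : Space d → ℝ}
    (hφ : ContDiff ℝ 1 φ) {f g : α → Space d} (hf : Measurable f) (hg : Measurable g) :
    Measurable fun a => fderiv ℝ φ (f a) (g a) :=
  isBoundedBilinearMap_apply.continuous.measurable.comp
    (((hφ.continuous_fderiv one_ne_zero).measurable.comp hf).prodMk hg)

section FixedTime

variable {d : ℕ} {ρ : Space d → ℝ} {u : Space d → Space d}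

theorem IsDensity.integrable_bdd_mul (hρ : IsDensity ρ) {f : Space d → ℝ} {C : ℝ}
    (hf : AEStronglyMeasurable f) (hC : ∀ x, |f x| ≤ C) : Integrable fun x => f x * ρ x :=
  hρ.integrable.bdd_mul hf (Eventually.of_forall hC)

theorem IsDensity.integrable_control (hρ : IsDensity ρ) (hu : Measurable u)
    (hu2 : Integrable fun x => ‖u x‖ ^ 2 * ρ x) : Integrable fun x => ‖u x‖ * ρ x :=
  integrable_mul_of_sq hρ.nonneg hρ.integrable
    (hu.norm.mul hρ.measurable).aestronglyMeasurable hu2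

theorem IsDensity.integrable_pairing (hρ : IsDensity ρ) (hu : Measurable u)
    (hu2 : Integrable fun x => ‖u x‖ ^ 2 * ρ x) {φ : Space d → ℝ} (hφ : IsTest φ) :
    Integrable fun x => fderiv ℝ φ x (u x) * ρ x := by
  obtain ⟨C, hC0, hC⟩ := hφ.bound_fderiv
  refine ((hρ.integrable_control hu hu2).const_mul C).mono'
    ((measurable_fderiv_apply hφ.1 measurable_id hu).mul hρ.measurable).aestronglyMeasurable
    (Eventually.of_forall fun x => ?_)
  rw [norm_mul, Real.norm_of_nonneg (hρ.nonneg x), ← mul_assoc]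
  refine mul_le_mul_of_nonneg_right ?_ (hρ.nonneg x)
  exact (ContinuousLinearMap.le_opNorm _ _).trans (by gcongr; exact hC x)

theorem IsDensity.locallyIntegrable_flux (hρ : IsDensity ρ) (hu : Measurable u)
    (hu2 : Integrable fun x => ‖u x‖ ^ 2 * ρ x) : LocallyIntegrable fun x => ρ x • u x := by
  refine Integrable.locallyIntegrable ((hρ.integrable_control hu hu2).mono'
    (hρ.measurable.smul hu).aestronglyMeasurable (Eventually.of_forall fun x => ?_))
  rw [norm_smul, Real.norm_of_nonneg (hρ.nonneg x), mul_comm]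

/-- The space of test functions. -/
def testSubmodule (d : ℕ) : Submodule ℝ (Space d → ℝ) where
  carrier := {φ | IsTest φ}
  add_mem' h1 h2 := ⟨h1.1.add h2.1, h1.2.add h2.2⟩
  zero_mem' := ⟨contDiff_const, HasCompactSupport.zero⟩
  smul_mem' _ _ h := ⟨contDiff_const.smul h.1, h.2.smul_left⟩

/-- The weak divergence exists in `L²(ρ)` as soon as its dual energy is bounded. -/
theorem exists_weakDiv_of_dual_bound (hρ : IsDensity ρ) (hu : Measurable u)
    (hu2 : Integrable fun x => ‖u x‖ ^ 2 * ρ x) {N : ℝ}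
    (hN : ∀ φ, IsTest φ →
      -(∫ x, fderiv ℝ φ x (u x) * ρ x) - (∫ x, φ x ^ 2 * ρ x) / 2 ≤ N) :
    ∃ g, Measurable g ∧ IsWeakDiv ρ u g ∧ Integrable (fun x => g x ^ 2 * ρ x) ∧
      ∫ x, g x ^ 2 * ρ x ≤ 2 * N := by
  set μ := densMeasure volume ρ with hμ
  have hfin : IsFiniteMeasure μ := isFiniteMeasure_densMeasure hρ.nonneg hρ.integrable
  have hmem : ∀ φ : testSubmodule d, MemLp φ.1 2 μ := fun φ => by
    obtain ⟨C, -, hC⟩ := IsTest.bound φ.2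
    exact MemLp.of_bound (IsTest.continuous φ.2).aestronglyMeasurable C (Eventually.of_forall hC)
  let A : testSubmodule d →ₗ[ℝ] Lp ℝ 2 μ :=
    { toFun := fun φ => (hmem φ).toLp φ.1
      map_add' := fun _ _ => rfl
      map_smul' := fun _ _ => rfl }
  let ℓ : testSubmodule d →ₗ[ℝ] ℝ :=
    { toFun := fun φ => -∫ x, fderiv ℝ φ.1 x (u x) * ρ x
      map_add' := fun φ ψ => by
        rw [← neg_add, ← integral_add (hρ.integrable_pairing hu hu2 φ.2)
          (hρ.integrable_pairing hu hu2 ψ.2)]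
        congr 2
        ext x
        have : fderiv ℝ (φ + ψ).1 x = fderiv ℝ φ.1 x + fderiv ℝ ψ.1 x :=
          fderiv_add (φ.2.1.differentiable one_ne_zero x) (ψ.2.1.differentiable one_ne_zero x)
        rw [this, add_apply, add_mul]
      map_smul' := fun c φ => by
        rw [RingHom.id_apply, smul_eq_mul, mul_neg, ← integral_const_mul]
        congr 2
        ext x
        have : fderiv ℝ (c • φ).1 x = c • fderiv ℝ φ.1 x :=
          fderiv_const_smul (φ.2.1.differentiable one_ne_zero x) c
        rw [this, smul_apply, smul_eq_mul, mul_assoc] }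
  have hinner : ∀ (v : Lp ℝ 2 μ) (φ : testSubmodule d),
      inner ℝ v (A φ) = ∫ x, φ.1 x * (v x * ρ x) := by
    intro v φ
    rw [L2.inner_def]
    have : (fun x => inner ℝ (v x) (A φ x)) =ᵐ[μ] fun x => φ.1 x * v x := by
      filter_upwards [(hmem φ).coeFn_toLp] with x hx
      have : A φ x = φ.1 x := hx
      rw [this]
      simp
    rw [integral_congr_ae this, integral_densMeasure hρ.measurable hρ.nonneg]
    simp only [mul_assoc]
  have hnorm : ∀ v : Lp ℝ 2 μ, ‖v‖ ^ 2 = ∫ x, v x ^ 2 * ρ x := by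
    intro v
    rw [← real_inner_self_eq_norm_sq, L2.inner_def,
      ← integral_densMeasure hρ.measurable hρ.nonneg (fun x => v x ^ 2)]
    refine integral_congr_ae (Eventually.of_forall fun x => ?_)
    simp [pow_two]
  have hA : ∀ φ : testSubmodule d, ‖A φ‖ ^ 2 = ∫ x, φ.1 x ^ 2 * ρ x := by
    intro φ
    rw [← integral_densMeasure hρ.measurable hρ.nonneg (fun x => φ.1 x ^ 2), hnorm,
      ← integral_densMeasure hρ.measurable hρ.nonneg (fun x => A φ x ^ 2)]
    refine integral_congr_ae ?_
    filter_upwards [(hmem φ).coeFn_toLp] with x hx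
    have : A φ x = φ.1 x := hx
    rw [this]
  -- Here `A` is the map from tests to their classes in `L²(ρ)` and `ℓ` is minus the pairing with
  -- the flux, so the assumed dual bound is exactly the quadratic bound and the representing vector
  -- is the weak divergence.
  obtain ⟨v, hv, hvℓ⟩ := riesz_of_quadratic_bound A ℓ N (fun φ => by
    rw [hA]
    have := hN φ.1 φ.2
    change -(∫ x, fderiv ℝ φ.1 x (u x) * ρ x) ≤ _
    linarith)
  have hvm : Measurable (v : Space d → ℝ) := (Lp.stronglyMeasurable v).measurable
  have hv1 : Integrable (fun x => v x * ρ x) :=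
    (integrable_densMeasure hρ.measurable hρ.nonneg).1 ((Lp.memLp v).integrable one_le_two)
  refine ⟨v, hvm, ⟨hρ.locallyIntegrable_flux hu hu2, hv1.locallyIntegrable, fun φ hφ => ?_⟩,
    (integrable_densMeasure hρ.measurable hρ.nonneg).1 (Lp.memLp v).integrable_sq, ?_⟩
  · rw [← hinner v ⟨φ, hφ⟩, hvℓ]
    rfl
  · rw [← hnorm]
    exact hv

theorem IsWeakDiv.integrable_sq {g : Space d → ℝ} (hρ : IsDensity ρ) (hg : IsWeakDiv ρ u g)
    (hfin : ∫⁻ x, ENNReal.ofReal (g x ^ 2 * ρ x) ≠ ∞) : Integrable fun x => g x ^ 2 * ρ x := by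
  have h1 := hg.locallyIntegrable.aestronglyMeasurable
  have h2 : AEStronglyMeasurable fun x => g x ^ 2 * ρ x := by
    -- Only `g ρ` is known to be measurable. Where `ρ` vanishes, the identity holds because the
    -- inverse of zero is zero.
    have h3 : (fun x => g x ^ 2 * ρ x) = fun x => (g x * ρ x) ^ 2 * (ρ x)⁻¹ := by
      ext x
      by_cases hx : ρ x = 0
      · simp [hx]
      · field_simp
    rw [h3]
    exact (h1.pow 2).mul hρ.measurable.inv.aestronglyMeasurable
  refine ⟨h2, ?_⟩
  rw [hasFiniteIntegral_iff_ofReal (Eventually.of_forall fun x =>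
    mul_nonneg (sq_nonneg _) (hρ.nonneg x))]
  exact lt_top_iff_ne_top.2 hfin

theorem IsWeakDiv.aestronglyMeasurable_mul {g f : Space d → ℝ} (hg : IsWeakDiv ρ u g)
    (hf : Measurable f) : AEStronglyMeasurable fun x => f x * g x * ρ x := by
  simp only [mul_assoc]
  exact hf.aestronglyMeasurable.mul hg.locallyIntegrable.aestronglyMeasurable

theorem IsWeakDiv.integrable_mul {g : Space d → ℝ} (hρ : IsDensity ρ) (hg : IsWeakDiv ρ u g)
    (hg2 : Integrable fun x => g x ^ 2 * ρ x) : Integrable fun x => g x * ρ x :=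
  integrable_mul_of_sq hρ.nonneg hρ.integrable hg.locallyIntegrable.aestronglyMeasurable hg2

/-- The dual expression of the control cost along a sequence of test functions. -/
noncomputable def dualCost (Φ : ℕ → Space d → ℝ) (ρ : Space d → ℝ) (u : Space d → Space d) :
    ℝ≥0∞ :=
  ⨆ n, ENNReal.ofReal (-(∫ x, fderiv ℝ (Φ n) x (u x) * ρ x) - (∫ x, Φ n x ^ 2 * ρ x) / 2)

/-- Weak duality: testing the divergence `g` against `Φ n` and applying `Φ g ≤ g²/2 + Φ²/2` leaves
exactly half the energy of `g`. -/
theorem dualCost_le_controlCost {Φ : ℕ → Space d → ℝ} (hΦ : ∀ n, IsTest (Φ n))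
    (hρ : IsDensity ρ) : dualCost Φ ρ u ≤ controlCost ρ u := by
  refine iSup_le fun n => le_iInf₂ fun g hg => ?_
  by_cases hfin : ∫⁻ x, ENNReal.ofReal (g x ^ 2 * ρ x) = ∞
  · rw [hfin, ENNReal.mul_top (by simp)]
    exact le_top
  have hg2 := hg.integrable_sq hρ hfin
  rw [← ofReal_integral_eq_lintegral_ofReal hg2 (Eventually.of_forall fun x =>
    mul_nonneg (sq_nonneg _) (hρ.nonneg x)), ← ENNReal.ofReal_mul (by norm_num)]
  refine ENNReal.ofReal_le_ofReal ?_
  obtain ⟨C, -, hC⟩ := (hΦ n).bound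
  have hΦ2 : Integrable fun x => Φ n x ^ 2 * ρ x :=
    hρ.integrable_bdd_mul (C := C ^ 2) ((hΦ n).continuous.pow 2).aestronglyMeasurable fun x => by
      rw [abs_pow]
      exact pow_le_pow_left₀ (abs_nonneg _) (hC x) 2
  have hΦg : Integrable fun x => Φ n x * g x * ρ x :=
    integrable_mul_mul_of_sq hρ.nonneg (hg.aestronglyMeasurable_mul (hΦ n).continuous.measurable)
      hΦ2 hg2
  have h1 := hg.weak (Φ n) (hΦ n)
  simp only [← mul_assoc] at h1
  have h2 : ∫ x, Φ n x * g x * ρ x ≤ ∫ x, (g x ^ 2 * ρ x / 2 + Φ n x ^ 2 * ρ x / 2) :=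
    integral_mono hΦg ((hg2.div_const 2).add (hΦ2.div_const 2)) fun x => by
      have := mul_nonneg (sq_nonneg (g x - Φ n x)) (hρ.nonneg x)
      dsimp only
      nlinarith
  rw [integral_add (hg2.div_const 2) (hΦ2.div_const 2), integral_div, integral_div] at h2
  linarith

/-- Uniform `C¹` convergence at rate `1 / (j + 1)` and the integrability of `ρ`, `‖u‖ ρ` and `f`
permit dominated convergence. This is how an identity or a bound known for countably many tests
reaches all of them. -/
theorem dual_bound_of_dense {Φ : ℕ → Space d → ℝ} (hΦ : ∀ n, IsTest (Φ n))
    (hdense : ∀ φ, IsTest φ → ∀ ε > 0, ∃ n, (∀ x, |Φ n x - φ x| ≤ ε) ∧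
      ∀ x, ‖fderiv ℝ (Φ n) x - fderiv ℝ φ x‖ ≤ ε)
    {φ : Space d → ℝ} (hφ : IsTest φ) :
    ∃ k : ℕ → ℕ, ∀ {ρ : Space d → ℝ}, IsDensity ρ → ∀ {u : Space d → Space d}, Measurable u →
      Integrable (fun x => ‖u x‖ ^ 2 * ρ x) →
      Tendsto (fun j => ∫ x, fderiv ℝ (Φ (k j)) x (u x) * ρ x) atTop
        (𝓝 (∫ x, fderiv ℝ φ x (u x) * ρ x)) ∧
      ∀ {f : Space d → ℝ}, Integrable f → Tendsto (fun j => ∫ x, Φ (k j) x * f x) atTop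
        (𝓝 (∫ x, φ x * f x)) ∧
       Tendsto (fun j => ∫ x, Φ (k j) x ^ 2 * f x) atTop (𝓝 (∫ x, φ x ^ 2 * f x)) := by
  have hε : ∀ j : ℕ, (0 : ℝ) < 1 / ((j : ℝ) + 1) := fun j => by positivity
  choose k hk1 hk2 using fun j : ℕ => hdense φ hφ (1 / ((j : ℝ) + 1)) (hε j)
  have hε1 : ∀ j : ℕ, 1 / ((j : ℝ) + 1) ≤ 1 := fun j => by
    rw [div_le_one (by positivity)]
    linarith [(Nat.cast_nonneg j : (0 : ℝ) ≤ j)]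
  have hlim : Tendsto (fun j : ℕ => 1 / ((j : ℝ) + 1)) atTop (𝓝 0) :=
    tendsto_one_div_add_atTop_nhds_zero_nat
  have hptw : ∀ x, Tendsto (fun j => Φ (k j) x) atTop (𝓝 (φ x)) := fun x =>
    tendsto_iff_norm_sub_tendsto_zero.2
      (squeeze_zero (fun _ => norm_nonneg _) (fun j => hk1 j x) hlim)
  have hptw' : ∀ x, Tendsto (fun j => fderiv ℝ (Φ (k j)) x) atTop (𝓝 (fderiv ℝ φ x)) := fun x =>
    tendsto_iff_norm_sub_tendsto_zero.2
      (squeeze_zero (fun _ => norm_nonneg _) (fun j => hk2 j x) hlim)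
  obtain ⟨C, hC0, hC⟩ := hφ.bound
  obtain ⟨D, hD0, hD⟩ := hφ.bound_fderiv
  have hCb : ∀ j x, |Φ (k j) x| ≤ C + 1 := fun j x => by
    have := (abs_sub_abs_le_abs_sub (Φ (k j) x) (φ x)).trans ((hk1 j x).trans (hε1 j))
    linarith [hC x]
  have hDb : ∀ j x, ‖fderiv ℝ (Φ (k j)) x‖ ≤ D + 1 := fun j x => by
    have := (norm_sub_norm_le (fderiv ℝ (Φ (k j)) x) (fderiv ℝ φ x)).trans
      ((hk2 j x).trans (hε1 j))
    linarith [hD x]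
  refine ⟨k, fun {ρ} hρ {u} hu hu2 => ⟨?_, fun {f} hf => ⟨?_, ?_⟩⟩⟩
  · refine tendsto_integral_of_dominated_convergence (fun x => (D + 1) * (‖u x‖ * ρ x))
      (fun j => (hρ.integrable_pairing hu hu2 (hΦ (k j))).aestronglyMeasurable)
      ((hρ.integrable_control hu hu2).const_mul _) (fun j => Eventually.of_forall fun x => ?_)
      (Eventually.of_forall fun x => ?_)
    · rw [norm_mul, Real.norm_of_nonneg (hρ.nonneg x), ← mul_assoc]
      refine mul_le_mul_of_nonneg_right ?_ (hρ.nonneg x)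
      exact (ContinuousLinearMap.le_opNorm _ _).trans (by gcongr; exact hDb j x)
    · exact (((ContinuousLinearMap.apply ℝ ℝ (u x)).continuous.tendsto _).comp
        (hptw' x)).mul_const _
  · refine tendsto_integral_of_dominated_convergence (fun x => (C + 1) * ‖f x‖)
      (fun j => (hΦ (k j)).continuous.aestronglyMeasurable.mul hf.aestronglyMeasurable)
      (hf.norm.const_mul _) (fun j => Eventually.of_forall fun x => ?_)
      (Eventually.of_forall fun x => (hptw x).mul_const _)
    rw [norm_mul]
    gcongr
    exact hCb j x
  · refine tendsto_integral_of_dominated_convergence (fun x => (C + 1) ^ 2 * ‖f x‖)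
      (fun j => ((hΦ (k j)).continuous.pow 2).aestronglyMeasurable.mul hf.aestronglyMeasurable)
      (hf.norm.const_mul _) (fun j => Eventually.of_forall fun x => ?_)
      (Eventually.of_forall fun x => ((hptw x).pow 2).mul_const _)
    rw [norm_mul, norm_pow]
    gcongr
    exact hCb j x

/-- A finite control cost is attained. -/
theorem exists_weakDiv_of_dualCost_ne_top {Φ : ℕ → Space d → ℝ} (hΦ : ∀ n, IsTest (Φ n))
    (hdense : ∀ φ, IsTest φ → ∀ ε > 0, ∃ n, (∀ x, |Φ n x - φ x| ≤ ε) ∧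
      ∀ x, ‖fderiv ℝ (Φ n) x - fderiv ℝ φ x‖ ≤ ε)
    (hρ : IsDensity ρ) (hu : Measurable u) (hu2 : Integrable fun x => ‖u x‖ ^ 2 * ρ x)
    (hfin : dualCost Φ ρ u ≠ ∞) :
    ∃ g, Measurable g ∧ IsWeakDiv ρ u g ∧ Integrable (fun x => g x ^ 2 * ρ x) ∧
      ∫ x, g x ^ 2 * ρ x ≤ 2 * (dualCost Φ ρ u).toReal := by
  refine exists_weakDiv_of_dual_bound hρ hu hu2 fun φ hφ => ?_
  obtain ⟨k, hk⟩ := dual_bound_of_dense hΦ hdense hφ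
  obtain ⟨h1, h2⟩ := hk hρ hu hu2
  refine le_of_tendsto (h1.neg.sub ((h2 hρ.integrable).2.div_const 2))
    (Eventually.of_forall fun j => ?_)
  exact (ENNReal.ofReal_le_iff_le_toReal hfin).1 (le_iSup (fun n => ENNReal.ofReal
    (-(∫ x, fderiv ℝ (Φ n) x (u x) * ρ x) - (∫ x, Φ n x ^ 2 * ρ x) / 2)) (k j))

theorem controlCost_le_of_weakDiv {g : Space d → ℝ} (hρ : IsDensity ρ) (hg : IsWeakDiv ρ u g)
    (hg2 : Integrable fun x => g x ^ 2 * ρ x) :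
    controlCost ρ u ≤ ENNReal.ofReal ((∫ x, g x ^ 2 * ρ x) / 2) := by
  refine (iInf₂_le g hg).trans_eq ?_
  rw [← ofReal_integral_eq_lintegral_ofReal hg2 (Eventually.of_forall fun x =>
    mul_nonneg (sq_nonneg _) (hρ.nonneg x)), ← ENNReal.ofReal_mul (by norm_num)]
  congr 1
  ring

/-- Strong duality: the Riesz representative of the flux functional is a weak divergence whose half
energy does not exceed the supremum. The point is to replace an infimum over functions by a
countable supremum of integrals. -/
theorem dualCost_eq_controlCost {Φ : ℕ → Space d → ℝ} (hΦ : ∀ n, IsTest (Φ n))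
    (hdense : ∀ φ, IsTest φ → ∀ ε > 0, ∃ n, (∀ x, |Φ n x - φ x| ≤ ε) ∧
      ∀ x, ‖fderiv ℝ (Φ n) x - fderiv ℝ φ x‖ ≤ ε)
    (hρ : IsDensity ρ) (hu : Measurable u) (hu2 : Integrable fun x => ‖u x‖ ^ 2 * ρ x) :
    dualCost Φ ρ u = controlCost ρ u := by
  refine le_antisymm (dualCost_le_controlCost hΦ hρ) ?_
  by_cases hfin : dualCost Φ ρ u = ∞
  · rw [hfin]
    exact le_top
  obtain ⟨g, -, hg, hg2, hle⟩ := exists_weakDiv_of_dualCost_ne_top hΦ hdense hρ hu hu2 hfin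
  refine (controlCost_le_of_weakDiv hρ hg hg2).trans ?_
  rw [← ENNReal.ofReal_toReal hfin]
  exact ENNReal.ofReal_le_ofReal (by linarith)

theorem exists_weakDiv_of_controlCost_ne_top (hρ : IsDensity ρ) (hu : Measurable u)
    (hu2 : Integrable fun x => ‖u x‖ ^ 2 * ρ x) (hfin : controlCost ρ u ≠ ∞) :
    ∃ g, Measurable g ∧ IsWeakDiv ρ u g ∧ Integrable (fun x => g x ^ 2 * ρ x) ∧
      controlCost ρ u = ENNReal.ofReal ((∫ x, g x ^ 2 * ρ x) / 2) := by
  obtain ⟨Φ, hΦ, hdense⟩ := exists_dense_tests d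
  have heq := dualCost_eq_controlCost hΦ hdense hρ hu hu2
  have hfin' : dualCost Φ ρ u ≠ ∞ := by rwa [heq]
  obtain ⟨g, hgm, hg, hg2, hle⟩ := exists_weakDiv_of_dualCost_ne_top hΦ hdense hρ hu hu2
    hfin'
  refine ⟨g, hgm, hg, hg2, le_antisymm (controlCost_le_of_weakDiv hρ hg hg2) ?_⟩
  rw [← heq, ← ENNReal.ofReal_toReal hfin']
  exact ENNReal.ofReal_le_ofReal (by linarith)

/-- A weak divergence has zero mean. -/
theorem IsWeakDiv.integral_eq_zero {g : Space d → ℝ} (hρ : IsDensity ρ) (hu : Measurable u)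
    (hu2 : Integrable fun x => ‖u x‖ ^ 2 * ρ x) (hg : IsWeakDiv ρ u g)
    (hg1 : Integrable fun x => g x * ρ x) : ∫ x, g x * ρ x = 0 := by
  obtain ⟨χ, C, hC0, hχ, hχ01, hχ1, hDχ⟩ := exists_cutoff d
  have hlim : Tendsto (fun n : ℕ => C / ((n : ℝ) + 1)) atTop (𝓝 0) := by
    simpa [div_eq_mul_inv] using
      (tendsto_one_div_add_atTop_nhds_zero_nat (𝕜 := ℝ)).const_mul C
  have h1 : Tendsto (fun n => ∫ x, χ n x * (g x * ρ x)) atTop (𝓝 (∫ x, g x * ρ x)) := by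
    refine tendsto_integral_of_dominated_convergence (fun x => ‖g x * ρ x‖)
      (fun n => (hχ n).continuous.aestronglyMeasurable.mul hg1.aestronglyMeasurable)
      hg1.norm (fun n => Eventually.of_forall fun x => ?_) (Eventually.of_forall fun x => ?_)
    · rw [norm_mul, Real.norm_of_nonneg (hχ01 n x).1]
      exact mul_le_of_le_one_left (norm_nonneg _) (hχ01 n x).2
    · refine tendsto_const_nhds.congr' ?_
      filter_upwards [eventually_ge_atTop ⌈‖x‖⌉₊] with n hn
      rw [hχ1 n x ((Nat.ceil_le.1 hn).trans (by linarith)), one_mul]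
  -- No flux is lost at infinity: `‖u‖ ρ` is integrable and the gradients of the cutoffs are of size
  -- `C / (n + 1)`.
  have h2 : Tendsto (fun n => ∫ x, χ n x * (g x * ρ x)) atTop (𝓝 0) := by
    have hbound : ∀ n, ‖∫ x, χ n x * (g x * ρ x)‖ ≤ C / ((n : ℝ) + 1) * ∫ x, ‖u x‖ * ρ x := by
      intro n
      rw [hg.weak (χ n) (hχ n), norm_neg, ← integral_const_mul]
      refine norm_integral_le_of_norm_le ((hρ.integrable_control hu hu2).const_mul _)
        (Eventually.of_forall fun x => ?_)
      rw [norm_mul, Real.norm_of_nonneg (hρ.nonneg x), ← mul_assoc]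
      refine mul_le_mul_of_nonneg_right ?_ (hρ.nonneg x)
      exact (ContinuousLinearMap.le_opNorm _ _).trans (by gcongr; exact hDχ n x)
    refine squeeze_zero_norm hbound ?_
    simpa using hlim.mul_const (∫ x, ‖u x‖ * ρ x)
  exact tendsto_nhds_unique h1 h2

end FixedTime

end MeanFieldControl

/-! ### Evolution of the mean of `h` along a controlled path -/

namespace MeanFieldControl

/-- The bounded increasing truncation `y ↦ y / (1 + y / (n + 1))` of `[0, ∞)`. -/
noncomputable def trunc (n : ℕ) (y : ℝ) : ℝ := y / (1 + y / (n + 1))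

theorem trunc_den_pos (n : ℕ) {y : ℝ} (hy : 0 ≤ y) : 0 < 1 + y / ((n : ℝ) + 1) := by positivity

theorem trunc_nonneg (n : ℕ) {y : ℝ} (hy : 0 ≤ y) : 0 ≤ trunc n y :=
  div_nonneg hy (trunc_den_pos n hy).le

theorem trunc_le (n : ℕ) {y : ℝ} (hy : 0 ≤ y) : trunc n y ≤ y := by
  refine div_le_self hy ?_
  have : 0 ≤ y / ((n : ℝ) + 1) := by positivity
  linarith

theorem trunc_le_nat (n : ℕ) {y : ℝ} (hy : 0 ≤ y) : trunc n y ≤ n + 1 := by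
  have hn : (0 : ℝ) < n + 1 := by positivity
  rw [trunc, div_le_iff₀ (trunc_den_pos n hy), mul_add, mul_div_cancel₀ _ hn.ne']
  linarith

/-- The increment equals `a - b` divided by the product of the two denominators, each at least one.
The truncation is therefore monotone and nonexpansive on `[0, ∞)`, and the next two inequalities
follow. -/
theorem trunc_sub (n : ℕ) {a b : ℝ} (ha : 0 ≤ a) (hb : 0 ≤ b) :
    ∃ c, 0 ≤ c ∧ c ≤ 1 ∧ trunc n a - trunc n b = c * (a - b) := by
  have h1 := trunc_den_pos n ha
  have h2 := trunc_den_pos n hb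
  refine ⟨((1 + a / ((n : ℝ) + 1)) * (1 + b / ((n : ℝ) + 1)))⁻¹, by positivity, ?_, ?_⟩
  · refine inv_le_one_of_one_le₀ ?_
    have h3 : 0 ≤ a / ((n : ℝ) + 1) := by positivity
    have h4 : 0 ≤ b / ((n : ℝ) + 1) := by positivity
    nlinarith [mul_nonneg h3 h4]
  · rw [trunc, trunc, div_sub_div _ _ h1.ne' h2.ne', eq_comm, inv_mul_eq_div]
    congr 1
    ring

theorem abs_trunc_sub_le (n : ℕ) {a b : ℝ} (ha : 0 ≤ a) (hb : 0 ≤ b) :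
    |trunc n a - trunc n b| ≤ |a - b| := by
  obtain ⟨c, h0, h1, h⟩ := trunc_sub n ha hb
  rw [h, abs_mul, abs_of_nonneg h0]
  exact mul_le_of_le_one_left (abs_nonneg _) h1

/-- Used for dissipation: the mixed term produced by testing with the truncation dominates the
truncated variance, before the variance of `h` is known to be finite. -/
theorem sq_trunc_sub_le (n : ℕ) {a b : ℝ} (ha : 0 ≤ a) (hb : 0 ≤ b) :
    (trunc n a - trunc n b) ^ 2 ≤ (trunc n a - trunc n b) * (a - b) := by
  obtain ⟨c, h0, h1, h⟩ := trunc_sub n ha hb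
  rw [h]
  nlinarith [mul_nonneg (mul_nonneg h0 (sub_nonneg.2 h1)) (sq_nonneg (a - b))]

theorem tendsto_trunc (y : ℝ) : Tendsto (fun n => trunc n y) atTop (𝓝 y) := by
  have h1 : Tendsto (fun n : ℕ => 1 + y / ((n : ℝ) + 1)) atTop (𝓝 (1 + y * 0)) := by
    simpa [div_eq_mul_inv] using
      ((tendsto_one_div_add_atTop_nhds_zero_nat (𝕜 := ℝ)).const_mul y).const_add 1
  have h2 := (tendsto_const_nhds (x := y)).div h1 (by simp)
  simpa [trunc, Pi.div_def] using h2

theorem contDiff_trunc_comp {d : ℕ} (n : ℕ) {h : Space d → ℝ} {m : ℝ} (hc : ContDiff ℝ 1 h)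
    (hm : ∀ x, m ≤ h x) : ContDiff ℝ 1 fun x => trunc n (h x - m) := by
  refine (hc.sub contDiff_const).div (contDiff_const.add ((hc.sub contDiff_const).div_const _))
    fun x => (trunc_den_pos n (sub_nonneg.2 (hm x))).ne'

theorem abs_trunc_le_nat (n : ℕ) {y : ℝ} (hy : 0 ≤ y) : |trunc n y| ≤ n + 1 := by
  rw [abs_of_nonneg (trunc_nonneg n hy)]
  exact trunc_le_nat n hy

section Path

variable {d : ℕ} {ρ₀ h : Space d → ℝ} {ρ : ℝ → Space d → ℝ} {u : ℝ → Space d → Space d}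

theorem IsDensity.integrable_of_quadratic {ρ : Space d → ℝ} (hρ : IsDensity ρ)
    (hm : Measurable h) (hq : ∃ C, 0 ≤ C ∧ ∀ x, |h x| ≤ C * (1 + ‖x‖ ^ 2)) :
    Integrable fun x => h x * ρ x := by
  obtain ⟨C, hC0, hC⟩ := hq
  refine ((hρ.integrable.add hρ.second_moment).const_mul C).mono'
    (hm.mul hρ.measurable).aestronglyMeasurable (Eventually.of_forall fun x => ?_)
  rw [norm_mul, Real.norm_of_nonneg (hρ.nonneg x), Pi.add_apply, Real.norm_eq_abs]
  nlinarith [mul_le_mul_of_nonneg_right (hC x) (hρ.nonneg x)]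

theorem IsDensity.integrable_sub_mul {ρ : Space d → ℝ} (hρ : IsDensity ρ)
    (hi : Integrable fun x => h x * ρ x) (c : ℝ) : Integrable fun x => (h x - c) * ρ x := by
  simp only [sub_mul]
  exact hi.sub (hρ.integrable.const_mul c)

theorem IsDensity.integral_sub_mul {ρ : Space d → ℝ} (hρ : IsDensity ρ)
    (hi : Integrable fun x => h x * ρ x) (c : ℝ) : ∫ x, (h x - c) * ρ x = mean ρ h - c := by
  simp only [sub_mul]
  rw [integral_sub hi (hρ.integrable.const_mul c), integral_const_mul, hρ.integral_eq_one, mul_one]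
  rfl

theorem IsDensity.le_mean {ρ : Space d → ℝ} (hρ : IsDensity ρ)
    (hi : Integrable fun x => h x * ρ x) {m : ℝ} (hm : ∀ x, m ≤ h x) : m ≤ mean ρ h := by
  rw [← sub_nonneg, ← hρ.integral_sub_mul hi m]
  exact integral_nonneg fun x => mul_nonneg (sub_nonneg.2 (hm x)) (hρ.nonneg x)

namespace IsControlledPath

theorem measurable_control_at (hp : IsControlledPath ρ₀ ρ u) (t : ℝ) : Measurable (u t) :=
  hp.measurable_control.of_uncurry_left

theorem ae_density (hp : IsControlledPath ρ₀ ρ u) :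
    ∀ᵐ t ∂(volume.restrict (Ioi (0 : ℝ))), IsDensity (ρ t) := by
  filter_upwards [ae_restrict_mem measurableSet_Ioi] with t ht
  exact hp.density t (le_of_lt ht)

theorem measurable_mean (hp : IsControlledPath ρ₀ ρ u) (hm : Measurable h) :
    Measurable fun t => mean (ρ t) h := by
  refine (StronglyMeasurable.integral_prod_right
    (f := fun t x => h x * ρ t x) ?_).measurable
  exact ((hm.comp measurable_snd).mul hp.measurable_density).stronglyMeasurable

/-- The defining infimum over `g` shows no measurability in time; its dual form is a countable
supremum of parameter integrals and agrees with it whenever `u` is square integrable. -/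
theorem aemeasurable_controlCost (hp : IsControlledPath ρ₀ ρ u) :
    AEMeasurable (fun t => controlCost (ρ t) (u t)) (volume.restrict (Ioi (0 : ℝ))) := by
  obtain ⟨Φ, hΦ, hdense⟩ := exists_dense_tests d
  refine ⟨fun t => dualCost Φ (ρ t) (u t), ?_, ?_⟩
  · refine Measurable.iSup fun n => Measurable.ennreal_ofReal ?_
    refine Measurable.sub (Measurable.neg ?_) (Measurable.div_const ?_ 2)
    · exact (StronglyMeasurable.integral_prod_right (f := fun t x => fderiv ℝ (Φ n) x (u t x) * ρ t x)
        ((measurable_fderiv_apply (hΦ n).1 measurable_snd hp.measurable_control).mul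
          hp.measurable_density).stronglyMeasurable).measurable
    · have h1 : Measurable fun p : ℝ × Space d => Φ n p.2 ^ 2 :=
        ((hΦ n).continuous.measurable.comp measurable_snd).pow_const 2
      have h2 : Measurable (Function.uncurry fun t x => Φ n x ^ 2 * ρ t x) :=
        h1.mul hp.measurable_density
      exact h2.stronglyMeasurable.integral_prod_right.measurable
  · filter_upwards [hp.ae_density, hp.control_sq_integrable] with t h1 h2
    exact (dualCost_eq_controlCost hΦ hdense h1 (hp.measurable_control_at t) h2).symm

theorem aemeasurable_lagrangian (hp : IsControlledPath ρ₀ ρ u) (hm : Measurable h) (β : ℝ) :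
    AEMeasurable (fun t => lagrangian β h (ρ t) (u t)) (volume.restrict (Ioi (0 : ℝ))) := by
  refine hp.aemeasurable_controlCost.add (Measurable.aemeasurable (Measurable.const_mul ?_ _))
  have h1 : Measurable fun p : ℝ × Space d => (h p.2 - mean (ρ p.1) h) ^ 2 :=
    ((hm.comp measurable_snd).sub ((hp.measurable_mean hm).comp measurable_fst)).pow_const 2
  exact Measurable.lintegral_prod_right
    (f := fun t x => ENNReal.ofReal ((h x - mean (ρ t) h) ^ 2 * ρ t x))
    (h1.mul hp.measurable_density).ennreal_ofReal

/-- The continuity equation tested against a bounded `C¹` function. -/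
theorem integral_bdd_eq (hp : IsControlledPath ρ₀ ρ u) {g : ℝ → Space d → ℝ} {G : ℝ → ℝ}
    {t : ℝ} (ht : 0 ≤ t) (hG : IntegrableOn G (Ioc 0 t))
    (hg : ∀ᵐ s ∂(volume.restrict (Ioi (0 : ℝ))), IsWeakDiv (ρ s) (u s) (g s) ∧
      Integrable (fun x => g s x * ρ s x) ∧ ∫ x, |g s x * ρ s x| ≤ G s)
    {f : Space d → ℝ} (hf : ContDiff ℝ 1 f) {K : ℝ} (hK : ∀ x, |f x| ≤ K) :
    IntegrableOn (fun s => ∫ x, f x * (g s x * ρ s x)) (Ioc 0 t) ∧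
    ∫ x, f x * ρ t x = (∫ x, f x * ρ₀ x) - ∫ s in Ioc 0 t, ∫ x, f x * (g s x * ρ s x) := by
  obtain ⟨χ, C, hC0, hχ, hχ01, hχ1, hDχ⟩ := exists_cutoff d
  have hK0 : 0 ≤ K := (abs_nonneg _).trans (hK 0)
  have hg' := ae_restrict_of_ae_restrict_of_subset (fun s (hs : s ∈ Ioc 0 t) => hs.1) hg
  have htest : ∀ n, IsTest (fun x => f x * χ n x) := fun n => (hχ n).mul_left hf
  have hbd : ∀ n x, |f x * χ n x| ≤ K := fun n x => by
    rw [abs_mul, abs_of_nonneg (hχ01 n x).1]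
    exact (mul_le_of_le_one_right (abs_nonneg _) (hχ01 n x).2).trans (hK x)
  have hptw : ∀ x, Tendsto (fun n => f x * χ n x) atTop (𝓝 (f x)) := fun x => by
    refine tendsto_const_nhds.congr' ?_
    filter_upwards [eventually_ge_atTop ⌈‖x‖⌉₊] with n hn
    rw [hχ1 n x ((Nat.ceil_le.1 hn).trans (by linarith)), mul_one]
  have hlim : ∀ {σ : Space d → ℝ}, Integrable σ →
      Tendsto (fun n => ∫ x, f x * χ n x * σ x) atTop (𝓝 (∫ x, f x * σ x)) := fun {σ} hσ => by
    refine tendsto_integral_of_dominated_convergence (fun x => K * ‖σ x‖)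
      (fun n => (htest n).continuous.aestronglyMeasurable.mul hσ.aestronglyMeasurable)
      (hσ.norm.const_mul _) (fun n => Eventually.of_forall fun x => ?_)
      (Eventually.of_forall fun x => (hptw x).mul_const _)
    rw [norm_mul]
    gcongr
    exact hbd n x
  -- The weak divergence takes the derivative off `f χ n`, so no bound on the gradient of `f` is
  -- needed when the cutoffs are removed; `K G` dominates.
  have hweak : ∀ n, (fun s => -∫ x, fderiv ℝ (fun x => f x * χ n x) x (u s x) * ρ s x)
      =ᵐ[volume.restrict (Ioc 0 t)] fun s => ∫ x, f x * χ n x * (g s x * ρ s x) := fun n => by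
    filter_upwards [hg'] with s hs
    exact (hs.1.weak _ (htest n)).symm
  have hint : ∀ n, IntegrableOn (fun s => ∫ x, f x * χ n x * (g s x * ρ s x)) (Ioc 0 t) := fun n =>
    (((intervalIntegrable_iff_integrableOn_Ioc_of_le ht).1
      (hp.continuity _ (htest n) t ht).1).neg).congr (hweak n)
  have hdom : ∀ {φ : Space d → ℝ}, (∀ x, |φ x| ≤ K) → ∀ᵐ s ∂(volume.restrict (Ioc 0 t)),
      ‖∫ x, φ x * (g s x * ρ s x)‖ ≤ K * G s := fun {φ} hφ => by
    filter_upwards [hg'] with s hs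
    calc ‖∫ x, φ x * (g s x * ρ s x)‖ ≤ ∫ x, K * |g s x * ρ s x| :=
          norm_integral_le_of_norm_le (hs.2.1.abs.const_mul K) (Eventually.of_forall fun x => by
            rw [norm_mul]
            exact mul_le_mul_of_nonneg_right (hφ x) (norm_nonneg _))
      _ = K * ∫ x, |g s x * ρ s x| := integral_const_mul _ _
      _ ≤ K * G s := mul_le_mul_of_nonneg_left hs.2.2 hK0
  have hae : ∀ᵐ s ∂(volume.restrict (Ioc 0 t)),
      Tendsto (fun n => ∫ x, f x * χ n x * (g s x * ρ s x)) atTop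
        (𝓝 (∫ x, f x * (g s x * ρ s x))) := by
    filter_upwards [hg'] with s hs
    exact hlim hs.2.1
  have hmeas : AEStronglyMeasurable (fun s => ∫ x, f x * (g s x * ρ s x))
      (volume.restrict (Ioc 0 t)) :=
    aestronglyMeasurable_of_tendsto_ae atTop (fun n => (hint n).aestronglyMeasurable) hae
  refine ⟨(Integrable.const_mul hG K).mono' hmeas (hdom hK), ?_⟩
  have h1 := hlim (hp.density t ht).integrable
  have h2 := hlim (hp.initial ▸ (hp.density 0 le_rfl).integrable)
  have h3 := tendsto_integral_of_dominated_convergence (fun s => K * G s)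
    (fun n => (hint n).aestronglyMeasurable) (Integrable.const_mul hG K)
    (fun n => hdom (hbd n)) hae
  refine tendsto_nhds_unique h1 ((h2.sub h3).congr fun n => ?_)
  rw [(hp.continuity _ (htest n) t ht).2, intervalIntegral.integral_of_le ht,
    ← integral_congr_ae (hweak n), integral_neg, sub_neg_eq_add]

/-- Evolution of the mean of `h` along a path with locally finite energy. -/
theorem mean_eq (hp : IsControlledPath ρ₀ ρ u) (hc : ContDiff ℝ 1 h) {m : ℝ}
    (hm : ∀ x, m ≤ h x) (hi : ∀ t, 0 ≤ t → Integrable fun x => h x * ρ t x)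
    {g : ℝ → Space d → ℝ} {E : ℝ → ℝ} {t : ℝ} (ht : 0 ≤ t) (hE : IntegrableOn E (Ioc 0 t))
    (hg : ∀ᵐ s ∂(volume.restrict (Ioi (0 : ℝ))), IsWeakDiv (ρ s) (u s) (g s) ∧
      Integrable (fun x => g s x ^ 2 * ρ s x) ∧
      Integrable (fun x => (h x - mean (ρ s) h) ^ 2 * ρ s x) ∧
      (∫ x, g s x ^ 2 * ρ s x) + ∫ x, (h x - mean (ρ s) h) ^ 2 * ρ s x ≤ E s) :
    IntegrableOn (fun s => ∫ x, (h x - mean (ρ s) h) * g s x * ρ s x) (Ioc 0 t) ∧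
    mean (ρ t) h = mean ρ₀ h - ∫ s in Ioc 0 t, ∫ x, (h x - mean (ρ s) h) * g s x * ρ s x := by
  have hhm : Measurable h := hc.continuous.measurable
  -- The extra `1` comes from `|g| ≤ g² + 1` and the unit mass of the density.
  have hG : IntegrableOn (fun s => E s + 1) (Ioc 0 t) :=
    Integrable.add hE (integrableOn_const (by simp))
  have hg1 : ∀ᵐ s ∂(volume.restrict (Ioi (0 : ℝ))), IsWeakDiv (ρ s) (u s) (g s) ∧
      Integrable (fun x => g s x * ρ s x) ∧ ∫ x, |g s x * ρ s x| ≤ E s + 1 := by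
    filter_upwards [hp.ae_density, hg] with s hρ hs
    have h1 := hs.1.integrable_mul hρ hs.2.1
    refine ⟨hs.1, h1, ?_⟩
    calc ∫ x, |g s x * ρ s x| ≤ ∫ x, (g s x ^ 2 * ρ s x + ρ s x) :=
          integral_mono h1.abs (hs.2.1.add hρ.integrable) fun x => by
            dsimp only
            rw [abs_mul, abs_of_nonneg (hρ.nonneg x)]
            have : |g s x| ≤ g s x ^ 2 + 1 := by
              nlinarith [sq_abs (g s x), sq_nonneg (|g s x| - 1)]
            nlinarith [mul_le_mul_of_nonneg_right this (hρ.nonneg x)]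
      _ = (∫ x, g s x ^ 2 * ρ s x) + 1 := by
          rw [integral_add hs.2.1 hρ.integrable, hρ.integral_eq_one]
      _ ≤ E s + 1 := by
          have : 0 ≤ ∫ x, (h x - mean (ρ s) h) ^ 2 * ρ s x :=
            integral_nonneg fun x => mul_nonneg (sq_nonneg _) (hρ.nonneg x)
          linarith [hs.2.2.2]
  have hy : ∀ x, 0 ≤ h x - m := fun x => sub_nonneg.2 (hm x)
  have happ := fun n => hp.integral_bdd_eq ht hG hg1 (contDiff_trunc_comp n hc hm)
    (K := n + 1) (fun x => abs_trunc_le_nat n (hy x))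
  have hlim : ∀ {σ : Space d → ℝ}, IsDensity σ → Integrable (fun x => h x * σ x) →
      Tendsto (fun n => ∫ x, trunc n (h x - m) * σ x) atTop (𝓝 (mean σ h - m)) := by
    intro σ hσ hσi
    rw [← hσ.integral_sub_mul hσi m]
    refine tendsto_integral_of_dominated_convergence (fun x => (h x - m) * σ x)
      (fun n => (contDiff_trunc_comp n hc hm).continuous.aestronglyMeasurable.mul
        hσ.measurable.aestronglyMeasurable)
      (hσ.integrable_sub_mul hσi m) (fun n => Eventually.of_forall fun x => ?_)
      (Eventually.of_forall fun x => (tendsto_trunc _).mul_const _)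
    rw [norm_mul, Real.norm_of_nonneg (hσ.nonneg x), Real.norm_of_nonneg (trunc_nonneg n (hy x))]
    exact mul_le_mul_of_nonneg_right (trunc_le n (hy x)) (hσ.nonneg x)
  have hkey : ∀ᵐ s ∂(volume.restrict (Ioi (0 : ℝ))),
      (∀ n, ‖∫ x, trunc n (h x - m) * (g s x * ρ s x)‖ ≤ E s) ∧
      Tendsto (fun n => ∫ x, trunc n (h x - m) * (g s x * ρ s x)) atTop
        (𝓝 (∫ x, (h x - mean (ρ s) h) * g s x * ρ s x)) := by
    filter_upwards [hp.ae_density, hg, hp.control_sq_integrable,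
      ae_restrict_mem measurableSet_Ioi] with s hρ hs hu2 hs0
    have h1 := hs.1.integrable_mul hρ hs.2.1
    have hz := hs.1.integral_eq_zero hρ (hp.measurable_control_at s) hu2 h1
    have ha : 0 ≤ mean (ρ s) h - m := sub_nonneg.2 (hρ.le_mean (hi s (le_of_lt hs0)) hm)
    have hprod : Integrable fun x => (h x - mean (ρ s) h) * g s x * ρ s x :=
      integrable_mul_mul_of_sq hρ.nonneg
        (hs.1.aestronglyMeasurable_mul (hhm.sub measurable_const)) hs.2.2.1 hs.2.1
    -- Since `g ρ` has zero integral, the constant `trunc n (ĥ - m)` may be subtracted. The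
    -- difference is bounded by `|h - ĥ|`, which gives a majorant controlled by the energy and
    -- independent of `n`.
    have hre : ∀ n, ∫ x, trunc n (h x - m) * (g s x * ρ s x) =
        ∫ x, (trunc n (h x - m) - trunc n (mean (ρ s) h - m)) * (g s x * ρ s x) := by
      intro n
      simp only [sub_mul]
      rw [integral_sub (h1.bdd_mul (contDiff_trunc_comp n hc hm).continuous.aestronglyMeasurable
        (Eventually.of_forall fun x => abs_trunc_le_nat n (hy x))) (h1.const_mul _),
        integral_const_mul, hz, mul_zero, sub_zero]
    have hbd : ∀ n x, ‖(trunc n (h x - m) - trunc n (mean (ρ s) h - m)) * (g s x * ρ s x)‖ ≤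
        ‖(h x - mean (ρ s) h) * g s x * ρ s x‖ := by
      intro n x
      rw [mul_assoc, norm_mul, norm_mul (h x - mean (ρ s) h)]
      refine mul_le_mul_of_nonneg_right ?_ (norm_nonneg _)
      have := abs_trunc_sub_le n (hy x) ha
      rwa [sub_sub_sub_cancel_right] at this
    refine ⟨fun n => ?_, ?_⟩
    · rw [hre n]
      refine (norm_integral_le_of_norm_le (hs.2.1.add hs.2.2.1)
        (Eventually.of_forall fun x => (hbd n x).trans ?_)).trans ?_
      · rw [norm_mul, Real.norm_of_nonneg (hρ.nonneg x), Pi.add_apply, ← add_mul]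
        refine mul_le_mul_of_nonneg_right ?_ (hρ.nonneg x)
        rw [Real.norm_eq_abs, abs_le]
        constructor <;> nlinarith [sq_nonneg (h x - mean (ρ s) h + g s x),
          sq_nonneg (h x - mean (ρ s) h - g s x), sq_nonneg (h x - mean (ρ s) h),
          sq_nonneg (g s x)]
      · exact (integral_add hs.2.1 hs.2.2.1).trans_le hs.2.2.2
    · simp only [hre]
      refine tendsto_integral_of_dominated_convergence _
        (fun n => AEStronglyMeasurable.mul ?_ h1.aestronglyMeasurable) hprod.norm
        (fun n => Eventually.of_forall (hbd n)) (Eventually.of_forall fun x => ?_)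
      · exact ((contDiff_trunc_comp n hc hm).continuous.sub continuous_const).aestronglyMeasurable
      · have := ((tendsto_trunc (h x - m)).sub (tendsto_trunc (mean (ρ s) h - m))).mul_const
          (g s x * ρ s x)
        rwa [sub_sub_sub_cancel_right, ← mul_assoc] at this
  have hkey' := ae_restrict_of_ae_restrict_of_subset
    (fun s (hs : s ∈ Ioc 0 t) => hs.1) hkey
  have hmeas : AEStronglyMeasurable (fun s => ∫ x, (h x - mean (ρ s) h) * g s x * ρ s x)
      (volume.restrict (Ioc 0 t)) :=
    aestronglyMeasurable_of_tendsto_ae atTop (fun n => (happ n).1.aestronglyMeasurable)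
      (hkey'.mono fun s hs => hs.2)
  refine ⟨Integrable.mono' hE hmeas (hkey'.mono fun s hs =>
    le_of_tendsto hs.2.norm (Eventually.of_forall hs.1)), ?_⟩
  have h1 := hlim (hp.density t ht) (hi t ht)
  have hρ0 : IsDensity ρ₀ := hp.initial ▸ hp.density 0 le_rfl
  have h2 := hlim hρ0 (by simpa [hp.initial] using hi 0 le_rfl)
  have h3 := tendsto_integral_of_dominated_convergence E
    (fun n => (happ n).1.aestronglyMeasurable) hE
    (fun n => hkey'.mono fun s hs => hs.1 n) (hkey'.mono fun s hs => hs.2)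
  have h4 := tendsto_nhds_unique h1 ((h2.sub h3).congr fun n => (happ n).2.symm)
  linarith

end IsControlledPath

end Path

end MeanFieldControl

/-! ### Completion of the square and the lower bound on the cost -/

namespace MeanFieldControl

variable {d : ℕ} {ρ₀ h : Space d → ℝ} {β : ℝ}

/-- A finite Lagrangian is attained at a square integrable weak divergence. -/
theorem exists_lagrangian_eq {ρ : Space d → ℝ} {u : Space d → Space d} (hβ : 0 < β)
    (hρ : IsDensity ρ) (hu : Measurable u) (hu2 : Integrable fun x => ‖u x‖ ^ 2 * ρ x)
    (hm : Measurable h) (hfin : lagrangian β h ρ u ≠ ∞) :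
    ∃ g, IsWeakDiv ρ u g ∧ Integrable (fun x => g x ^ 2 * ρ x) ∧
      Integrable (fun x => (h x - mean ρ h) ^ 2 * ρ x) ∧
      (lagrangian β h ρ u).toReal =
        (∫ x, g x ^ 2 * ρ x) / 2 + β ^ 2 / 2 * ∫ x, (h x - mean ρ h) ^ 2 * ρ x := by
  rw [lagrangian, ENNReal.add_ne_top] at hfin
  obtain ⟨g, -, hg, hg2, hgc⟩ := exists_weakDiv_of_controlCost_ne_top hρ hu hu2 hfin.1
  have h0 : ∀ x, 0 ≤ (h x - mean ρ h) ^ 2 * ρ x := fun x =>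
    mul_nonneg (sq_nonneg _) (hρ.nonneg x)
  have hβ2 : (0 : ℝ) < β ^ 2 / 2 := by positivity
  have hl : ∫⁻ x, ENNReal.ofReal ((h x - mean ρ h) ^ 2 * ρ x) ≠ ∞ := fun htop => by
    refine hfin.2 ?_
    rw [htop, ENNReal.mul_top]
    exact (ENNReal.ofReal_pos.2 hβ2).ne'
  have hvar : Integrable fun x => (h x - mean ρ h) ^ 2 * ρ x := by
    refine ⟨(((hm.sub measurable_const).pow_const 2).mul hρ.measurable).aestronglyMeasurable, ?_⟩
    rw [hasFiniteIntegral_iff_ofReal (Eventually.of_forall h0)]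
    exact lt_top_iff_ne_top.2 hl
  refine ⟨g, hg, hg2, hvar, ?_⟩
  have hg0 : 0 ≤ ∫ x, g x ^ 2 * ρ x := integral_nonneg fun x =>
    mul_nonneg (sq_nonneg _) (hρ.nonneg x)
  rw [lagrangian, hgc, ← ofReal_integral_eq_lintegral_ofReal hvar (Eventually.of_forall h0),
    ← ENNReal.ofReal_mul hβ2.le, ← ENNReal.ofReal_add (by positivity)
      (mul_nonneg hβ2.le (integral_nonneg h0)), ENNReal.toReal_ofReal]
  exact add_nonneg (by positivity) (mul_nonneg hβ2.le (integral_nonneg h0))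

/-- The cross term in this expansion is the rate of decrease of the mean of `h`, so twice the
Lagrangian is the square plus `2 β` times that rate. -/
theorem IsWeakDiv.integral_sq_sub {ρ g : Space d → ℝ} {u : Space d → Space d} (hρ : IsDensity ρ)
    (hm : Measurable h) (hg : IsWeakDiv ρ u g) (hg2 : Integrable fun x => g x ^ 2 * ρ x) {c : ℝ}
    (hvar : Integrable fun x => (h x - c) ^ 2 * ρ x) :
    Integrable (fun x => (g x - β * (h x - c)) ^ 2 * ρ x) ∧
    ∫ x, (g x - β * (h x - c)) ^ 2 * ρ x = (∫ x, g x ^ 2 * ρ x) -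
      2 * β * (∫ x, (h x - c) * g x * ρ x) + β ^ 2 * ∫ x, (h x - c) ^ 2 * ρ x := by
  have hprod : Integrable fun x => (h x - c) * g x * ρ x :=
    integrable_mul_mul_of_sq hρ.nonneg
      (hg.aestronglyMeasurable_mul (hm.sub measurable_const)) hvar hg2
  have heq : (fun x => (g x - β * (h x - c)) ^ 2 * ρ x) = fun x =>
      g x ^ 2 * ρ x - 2 * β * ((h x - c) * g x * ρ x) + β ^ 2 * ((h x - c) ^ 2 * ρ x) := by
    ext x
    ring
  have h1 := hprod.const_mul (2 * β)
  have h2 := hvar.const_mul (β ^ 2)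
  have h3 : Integrable fun x => g x ^ 2 * ρ x - 2 * β * ((h x - c) * g x * ρ x) := hg2.sub h1
  rw [heq]
  refine ⟨h3.add h2, ?_⟩
  rw [integral_add h3 h2, integral_sub hg2 h1, integral_const_mul, integral_const_mul]

variable {ρ : ℝ → Space d → ℝ} {u : ℝ → Space d → Space d}

namespace IsControlledPath

/-- Along a path of finite cost the Lagrangian is a square plus the dissipation of `β ĥ`. -/
theorem exists_energy_identity (hp : IsControlledPath ρ₀ ρ u) (hβ : 0 < β) (hc : ContDiff ℝ 1 h)
    {m : ℝ} (hm : ∀ x, m ≤ h x) (hi : ∀ t, 0 ≤ t → Integrable fun x => h x * ρ t x)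
    (hJ : cost β h ρ u ≠ ∞) :
    IntegrableOn (fun s => (lagrangian β h (ρ s) (u s)).toReal) (Ioi 0) ∧
    ∃ g q : ℝ → _,
      (∀ᵐ s ∂(volume.restrict (Ioi (0 : ℝ))), IsWeakDiv (ρ s) (u s) (g s) ∧
        Integrable (fun x => (g s x - β * (h x - mean (ρ s) h)) ^ 2 * ρ s x) ∧
        (lagrangian β h (ρ s) (u s)).toReal =
          (∫ x, (g s x - β * (h x - mean (ρ s) h)) ^ 2 * ρ s x) / 2 + β * q s) ∧
      ∀ t, 0 ≤ t → IntegrableOn q (Ioc 0 t) ∧ mean (ρ t) h = mean ρ₀ h - ∫ s in Ioc 0 t, q s := by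
  have hhm := hc.continuous.measurable
  have hL := hp.aemeasurable_lagrangian hhm β
  have hfin : ∀ᵐ s ∂(volume.restrict (Ioi (0 : ℝ))), lagrangian β h (ρ s) (u s) ≠ ∞ :=
    (ae_lt_top' hL hJ).mono fun s hs => hs.ne
  have hint := integrable_toReal_of_lintegral_ne_top hL hJ
  refine ⟨hint, ?_⟩
  -- The divergences are chosen time by time with no measurability in `s`. None is needed: the
  -- measurability of `q` comes from the continuity equation inside `mean_eq`.
  have hex : ∀ s, ∃ g, (IsDensity (ρ s) ∧ Integrable (fun x => ‖u s x‖ ^ 2 * ρ s x) ∧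
      lagrangian β h (ρ s) (u s) ≠ ∞) → IsWeakDiv (ρ s) (u s) g ∧
      Integrable (fun x => g x ^ 2 * ρ s x) ∧
      Integrable (fun x => (h x - mean (ρ s) h) ^ 2 * ρ s x) ∧
      (lagrangian β h (ρ s) (u s)).toReal = (∫ x, g x ^ 2 * ρ s x) / 2 +
        β ^ 2 / 2 * ∫ x, (h x - mean (ρ s) h) ^ 2 * ρ s x := by
    intro s
    by_cases hs : IsDensity (ρ s) ∧ Integrable (fun x => ‖u s x‖ ^ 2 * ρ s x) ∧
      lagrangian β h (ρ s) (u s) ≠ ∞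
    · obtain ⟨g, hg⟩ := exists_lagrangian_eq hβ hs.1 (hp.measurable_control_at s) hs.2.1 hhm hs.2.2
      exact ⟨g, fun _ => hg⟩
    · exact ⟨0, fun h => absurd h hs⟩
  choose g hg using hex
  have hgae : ∀ᵐ s ∂(volume.restrict (Ioi (0 : ℝ))), IsWeakDiv (ρ s) (u s) (g s) ∧
      Integrable (fun x => g s x ^ 2 * ρ s x) ∧
      Integrable (fun x => (h x - mean (ρ s) h) ^ 2 * ρ s x) ∧
      (lagrangian β h (ρ s) (u s)).toReal = (∫ x, g s x ^ 2 * ρ s x) / 2 +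
        β ^ 2 / 2 * ∫ x, (h x - mean (ρ s) h) ^ 2 * ρ s x := by
    filter_upwards [hp.ae_density, hp.control_sq_integrable, hfin] with s h1 h2 h3
    exact hg s ⟨h1, h2, h3⟩
  refine ⟨g, fun s => ∫ x, (h x - mean (ρ s) h) * g s x * ρ s x, ?_, fun t ht => ?_⟩
  · filter_upwards [hgae, hp.ae_density] with s hs hρ
    obtain ⟨h1, h2⟩ := hs.1.integral_sq_sub (β := β) hρ hhm hs.2.1 hs.2.2.1
    refine ⟨hs.1, h1, ?_⟩
    rw [hs.2.2.2, h2]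
    ring
  -- With `A` and `B` the two energies, the Lagrangian is `A / 2 + β² B / 2`; the factor `2 + 2 /
  -- β²` makes it dominate `A + B`.
  · refine hp.mean_eq hc hm hi
      (E := fun s => (2 + 2 / β ^ 2) * (lagrangian β h (ρ s) (u s)).toReal) ht
      (Integrable.const_mul (hint.mono_measure (Measure.restrict_mono
        (fun s (hs : s ∈ Ioc 0 t) => hs.1) le_rfl)) _) ?_
    filter_upwards [hgae, hp.ae_density] with s hs hρ
    refine ⟨hs.1, hs.2.1, hs.2.2.1, ?_⟩
    rw [hs.2.2.2]
    have hA : 0 ≤ ∫ x, g s x ^ 2 * ρ s x := integral_nonneg fun x =>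
      mul_nonneg (sq_nonneg _) (hρ.nonneg x)
    have hB : 0 ≤ ∫ x, (h x - mean (ρ s) h) ^ 2 * ρ s x := integral_nonneg fun x =>
      mul_nonneg (sq_nonneg _) (hρ.nonneg x)
    generalize (∫ x, g s x ^ 2 * ρ s x) = A at *
    generalize (∫ x, (h x - mean (ρ s) h) ^ 2 * ρ s x) = B at *
    have : (2 + 2 / β ^ 2) * (A / 2 + β ^ 2 / 2 * B) = A + B + (β ^ 2 * B + A / β ^ 2) := by
      field_simp
      ring
    rw [this]
    have : 0 ≤ β ^ 2 * B + A / β ^ 2 := by positivity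
    linarith

/-- The cost of a path bounds the decrease of `β ĥ`; in case of equality the path obeys the
control law. -/
theorem le_cost (hp : IsControlledPath ρ₀ ρ u) (hβ : 0 < β) (hc : ContDiff ℝ 1 h)
    {m : ℝ} (hm : ∀ x, m ≤ h x) (hi : ∀ t, 0 ≤ t → Integrable fun x => h x * ρ t x)
    {a : ℝ} (ha : Tendsto (fun t => mean (ρ t) h) atTop (𝓝 a)) :
    ENNReal.ofReal (β * (mean ρ₀ h - a)) ≤ cost β h ρ u ∧
    (cost β h ρ u = ENNReal.ofReal (β * (mean ρ₀ h - a)) → a ≤ mean ρ₀ h →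
      SolvesControlLaw β h ρ u) := by
  by_cases hJ : cost β h ρ u = ∞
  · rw [hJ]
    exact ⟨le_top, fun h => absurd h.symm ENNReal.ofReal_ne_top⟩
  obtain ⟨hLi, g, q, hgq, hq⟩ := hp.exists_energy_identity hβ hc hm hi hJ
  set L : ℝ → ℝ := fun s => (lagrangian β h (ρ s) (u s)).toReal with hLdef
  have hhm := hc.continuous.measurable
  have hcost : (cost β h ρ u).toReal = ∫ s in Ioi 0, L s :=
    (integral_toReal (hp.aemeasurable_lagrangian hhm β)
      (ae_lt_top' (hp.aemeasurable_lagrangian hhm β) hJ)).symm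
  have hsub : ∀ t : ℝ, Ioc 0 t ⊆ Ioi 0 := fun t s hs => hs.1
  have hD0 : ∀ᵐ s ∂(volume.restrict (Ioi (0 : ℝ))), 0 ≤ L s - β * q s := by
    filter_upwards [hgq, hp.ae_density] with s hs hρ
    have : 0 ≤ ∫ x, (g s x - β * (h x - mean (ρ s) h)) ^ 2 * ρ s x := integral_nonneg fun x =>
      mul_nonneg (sq_nonneg _) (hρ.nonneg x)
    have := hs.2.2
    simp only [hLdef]
    linarith
  have hL0 : ∀ s, 0 ≤ L s := fun s => ENNReal.toReal_nonneg
  have hLt : ∀ t, ∫ s in Ioc 0 t, L s ≤ ∫ s in Ioi 0, L s := fun t =>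
    setIntegral_mono_set hLi (Eventually.of_forall hL0) (hsub t).eventuallyLE
  have hDi : ∀ t, 0 ≤ t → IntegrableOn (fun s => L s - β * q s) (Ioc 0 t) := fun t ht =>
    (hLi.mono_set (hsub t)).sub ((hq t ht).1.const_mul β)
  have hDt : ∀ t, 0 ≤ t → ∫ s in Ioc 0 t, (L s - β * q s) =
      (∫ s in Ioc 0 t, L s) - β * (mean ρ₀ h - mean (ρ t) h) := fun t ht => by
    rw [integral_sub (hLi.mono_set (hsub t)) ((hq t ht).1.const_mul β), integral_const_mul,
      (hq t ht).2]
    ring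
  have hDnn : ∀ t, 0 ≤ ∫ s in Ioc 0 t, (L s - β * q s) := fun t =>
    integral_nonneg_of_ae (ae_restrict_of_ae_restrict_of_subset (hsub t) hD0)
  have hlim : Tendsto (fun t => β * (mean ρ₀ h - mean (ρ t) h)) atTop
      (𝓝 (β * (mean ρ₀ h - a))) := (ha.const_sub _).const_mul β
  have hle : β * (mean ρ₀ h - a) ≤ ∫ s in Ioi 0, L s := by
    refine le_of_tendsto hlim ?_
    filter_upwards [eventually_ge_atTop 0] with t ht
    have := hDnn t
    rw [hDt t ht] at this
    linarith [hLt t]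
  refine ⟨(ENNReal.ofReal_le_iff_le_toReal hJ).2 (hcost ▸ hle), fun heq ha0 => ?_⟩
  have heq' : ∫ s in Ioi 0, L s = β * (mean ρ₀ h - a) := by
    rw [← hcost, heq, ENNReal.toReal_ofReal (mul_nonneg hβ.le (sub_nonneg.2 ha0))]
  -- The integral of the nonnegative defect up to `t` is at most its integral up to any `T ≥ t`,
  -- which the total cost bounds by `β (mean (ρ T) h - a)`; this tends to zero.
  have hDz : ∀ t, 0 ≤ t → ∫ s in Ioc 0 t, (L s - β * q s) = 0 := by
    intro t ht
    refine le_antisymm (ge_of_tendsto (x := atTop)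
      (f := fun T => β * (mean ρ₀ h - a) - β * (mean ρ₀ h - mean (ρ T) h)) ?_ ?_) (hDnn t)
    · simpa using hlim.const_sub (β * (mean ρ₀ h - a))
    · filter_upwards [eventually_ge_atTop t] with T hT
      calc ∫ s in Ioc 0 t, (L s - β * q s) ≤ ∫ s in Ioc 0 T, (L s - β * q s) :=
            setIntegral_mono_set (hDi T (ht.trans hT))
              (ae_restrict_of_ae_restrict_of_subset (hsub T) hD0)
              (Ioc_subset_Ioc_right hT).eventuallyLE
        _ ≤ _ := by
            rw [hDt T (ht.trans hT)]
            linarith [hLt T]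
  have hzero : ∀ᵐ s ∂(volume.restrict (Ioi (0 : ℝ))), L s - β * q s = 0 := by
    have hU : Ioi (0 : ℝ) = ⋃ n : ℕ, Ioc (0 : ℝ) n := by
      ext s
      simp only [mem_Ioi, mem_iUnion, mem_Ioc]
      exact ⟨fun hs => ⟨⌈s⌉₊, hs, Nat.le_ceil s⟩, fun ⟨n, hs, _⟩ => hs⟩
    rw [hU, ae_restrict_iUnion_iff]
    intro n
    have := (setIntegral_eq_zero_iff_of_nonneg_ae
      (ae_restrict_of_ae_restrict_of_subset (hsub n) hD0) (hDi n n.cast_nonneg)).1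
      (hDz n n.cast_nonneg)
    exact this
  filter_upwards [hzero, hgq, hp.ae_density] with s h0 hs hρ
  have hz : ∫ x, (g s x - β * (h x - mean (ρ s) h)) ^ 2 * ρ s x = 0 := by
    have := hs.2.2
    simp only [hLdef] at h0
    linarith
  have hae := (integral_eq_zero_iff_of_nonneg
    (fun x => mul_nonneg (sq_nonneg _) (hρ.nonneg x)) hs.2.1).1 hz
  -- A vanishing square identifies `g` only where `ρ` is positive, which suffices because the weak
  -- divergence involves only the product `g ρ`.
  have hcongr : (fun x => g s x * ρ s x) =ᵐ[volume]
      fun x => β * (h x - mean (ρ s) h) * ρ s x := by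
    filter_upwards [hae] with x hx
    rcases mul_eq_zero.1 hx with hx | hx
    · rw [sub_eq_zero.1 (pow_eq_zero_iff two_ne_zero |>.1 hx)]
    · rw [hx, mul_zero, mul_zero]
  refine ⟨hs.1.flux, ?_, fun φ hφ => ?_⟩
  · exact (locallyIntegrable_congr hcongr).1 hs.1.locallyIntegrable
  · rw [← hs.1.weak φ hφ]
    refine integral_congr_ae ?_
    filter_upwards [hcongr] with x hx
    rw [hx]

end IsControlledPath

end MeanFieldControl

/-! ### Paths obeying the control law: Gibbs form, terminal constraint, cost -/

namespace MeanFieldControl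

variable {d : ℕ} {ρ₀ h : Space d → ℝ} {β m : ℝ}

/-- Laplace's principle: Gibbs weights concentrate on the minimum of `h`. -/
theorem exists_laplace_bound (hρ : IsDensity ρ₀) (hpos : ∀ x, 0 < ρ₀ x) (hc : Continuous h)
    (hm : ∀ x, m ≤ h x) {xbar : Space d} (hx : h xbar = m)
    (hi : Integrable fun x => h x * ρ₀ x) {ε : ℝ} (hε : 0 < ε) :
    ∃ M, ∀ s, 0 ≤ s → ∫ x, (h x - m) * (ρ₀ x * Real.exp (-(s * (h x - m)))) ≤
      (ε + M * Real.exp (-(s * (ε / 2)))) * ∫ x, ρ₀ x * Real.exp (-(s * (h x - m))) := by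
  have hy : ∀ x, 0 ≤ h x - m := fun x => sub_nonneg.2 (hm x)
  have hyi := hρ.integrable_sub_mul hi m
  -- On this open neighbourhood of the minimizer the weight is at least `exp (-s ε / 2)`, so the
  -- normalizer decays no faster than `c exp (-s ε / 2)`.
  set S : Set (Space d) := {x | h x - m < ε / 2} with hS
  have hSo : IsOpen S := isOpen_lt (hc.sub continuous_const) continuous_const
  have hcpos : 0 < ∫ x in S, ρ₀ x := by
    rw [setIntegral_pos_iff_support_of_nonneg_ae (Eventually.of_forall fun x => hρ.nonneg x)
      hρ.integrable.integrableOn]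
    have : Function.support ρ₀ ∩ S = S := inter_eq_right.2 fun x _ => (hpos x).ne'
    rw [this]
    exact hSo.measure_pos volume ⟨xbar, by simp [hS, hx, hε]⟩
  set c := ∫ x in S, ρ₀ x with hcdef
  have hI : 0 ≤ ∫ x, (h x - m) * ρ₀ x :=
    integral_nonneg fun x => mul_nonneg (hy x) (hρ.nonneg x)
  refine ⟨(∫ x, (h x - m) * ρ₀ x) / c, fun s hs => ?_⟩
  have hexp1 : ∀ x, Real.exp (-(s * (h x - m))) ≤ 1 := fun x =>
    Real.exp_le_one_iff.2 (neg_nonpos.2 (mul_nonneg hs (hy x)))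
  have hexpm : Continuous fun x => Real.exp (-(s * (h x - m))) := by fun_prop
  have hDi : Integrable fun x => ρ₀ x * Real.exp (-(s * (h x - m))) :=
    hρ.integrable.mul_bdd (c := 1) hexpm.aestronglyMeasurable (Eventually.of_forall fun x => by
      rw [Real.norm_of_nonneg (Real.exp_pos _).le]
      exact hexp1 x)
  have hNi : Integrable fun x => (h x - m) * (ρ₀ x * Real.exp (-(s * (h x - m)))) := by
    simp only [← mul_assoc]
    exact hyi.mul_bdd (c := 1) hexpm.aestronglyMeasurable (Eventually.of_forall fun x => by
      rw [Real.norm_of_nonneg (Real.exp_pos _).le]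
      exact hexp1 x)
  have hD : c * Real.exp (-(s * (ε / 2))) ≤ ∫ x, ρ₀ x * Real.exp (-(s * (h x - m))) := by
    calc c * Real.exp (-(s * (ε / 2))) = ∫ x in S, ρ₀ x * Real.exp (-(s * (ε / 2))) :=
          (integral_mul_const _ _).symm
      _ ≤ ∫ x in S, ρ₀ x * Real.exp (-(s * (h x - m))) := by
          refine setIntegral_mono_on (hρ.integrable.mul_const _).integrableOn hDi.integrableOn
            hSo.measurableSet fun x hxS => ?_
          have h1 : h x - m ≤ ε / 2 := le_of_lt hxS
          have := hρ.nonneg x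
          gcongr
      _ ≤ _ := setIntegral_le_integral hDi (Eventually.of_forall fun x =>
          mul_nonneg (hρ.nonneg x) (Real.exp_pos _).le)
  -- Split at `h - m = ε`: below it the factor `h - m` is at most `ε`, above it the weight is at
  -- most `exp (-s ε)`, half of whose rate survives division by the normalizer.
  have hN : ∫ x, (h x - m) * (ρ₀ x * Real.exp (-(s * (h x - m)))) ≤
      ε * (∫ x, ρ₀ x * Real.exp (-(s * (h x - m)))) +
        Real.exp (-(s * ε)) * ∫ x, (h x - m) * ρ₀ x := by
    rw [← integral_const_mul, ← integral_const_mul,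
      ← integral_add (hDi.const_mul _) (hyi.const_mul _)]
    refine integral_mono hNi ((hDi.const_mul _).add (hyi.const_mul _)) fun x => ?_
    have h0 := hρ.nonneg x
    have h1 := (Real.exp_pos (-(s * (h x - m)))).le
    have h2 := (Real.exp_pos (-(s * ε))).le
    dsimp only
    rcases le_total (h x - m) ε with hle | hle
    · have h3 := mul_nonneg h2 (mul_nonneg (hy x) h0)
      have h4 := mul_le_mul_of_nonneg_right hle (mul_nonneg h0 h1)
      linarith
    · have h3 : Real.exp (-(s * (h x - m))) ≤ Real.exp (-(s * ε)) := by gcongr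
      have h4 := mul_le_mul_of_nonneg_left h3 (mul_nonneg (hy x) h0)
      have h5 := mul_nonneg hε.le (mul_nonneg h0 h1)
      nlinarith
  have hsplit : Real.exp (-(s * ε)) = Real.exp (-(s * (ε / 2))) * Real.exp (-(s * (ε / 2))) := by
    rw [← Real.exp_add]
    congr 1
    ring
  refine hN.trans ?_
  rw [add_mul]
  refine add_le_add le_rfl ?_
  have h6 := mul_le_mul_of_nonneg_left hD
    (mul_nonneg (div_nonneg hI hcpos.le) (Real.exp_pos (-(s * (ε / 2)))).le)
  refine le_trans (le_of_eq ?_) h6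
  rw [hsplit]
  field_simp

variable {ρ : ℝ → Space d → ℝ} {u : ℝ → Space d → Space d}

namespace IsControlledPath

/-- No mass escapes to infinity in finite time. -/
theorem exists_test_half_le (hp : IsControlledPath ρ₀ ρ u) {T : ℝ} (hT : 0 ≤ T) :
    ∃ φ, IsTest φ ∧ (∀ x, 0 ≤ φ x) ∧ ∀ s ∈ Icc 0 T, 1 / 2 ≤ ∫ x, φ x * ρ s x := by
  obtain ⟨χ, C, hC0, hχ, hχ01, hχ1, hDχ⟩ := exists_cutoff d
  have hint : ∀ n s, 0 ≤ s → Integrable fun x => χ n x * ρ s x := fun n s hs =>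
    (hp.density s hs).integrable_bdd_mul (C := 1) (hχ n).continuous.aestronglyMeasurable fun x => by
      rw [abs_of_nonneg (hχ01 n x).1]
      exact (hχ01 n x).2
  have hcont : ∀ n, ContinuousOn (fun s => ∫ x, χ n x * ρ s x) (Icc 0 T) := fun n => by
    have h1 := intervalIntegral.continuousOn_primitive_interval
      ((intervalIntegrable_iff' (by simp)).1 (hp.continuity _ (hχ n) T hT).1)
    rw [uIcc_of_le hT] at h1
    exact (h1.const_add (∫ x, χ n x * ρ₀ x)).congr fun s hs => (hp.continuity _ (hχ n) s hs.1).2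
  have hlim : ∀ s, 0 ≤ s → Tendsto (fun n => ∫ x, χ n x * ρ s x) atTop (𝓝 1) := fun s hs => by
    have hρ := hp.density s hs
    rw [← hρ.integral_eq_one]
    refine tendsto_integral_of_dominated_convergence (ρ s)
      (fun n => (hint n s hs).aestronglyMeasurable) hρ.integrable
      (fun n => Eventually.of_forall fun x => ?_) (Eventually.of_forall fun x => ?_)
    · rw [norm_mul, Real.norm_of_nonneg (hχ01 n x).1, Real.norm_of_nonneg (hρ.nonneg x)]
      exact mul_le_of_le_one_left (hρ.nonneg x) (hχ01 n x).2
    · refine tendsto_const_nhds.congr' ?_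
      filter_upwards [eventually_ge_atTop ⌈‖x‖⌉₊] with n hn
      rw [hχ1 n x ((Nat.ceil_le.1 hn).trans (by linarith)), one_mul]
  -- A later cutoff equals one on the support of an earlier one. The lower bound on captured mass,
  -- valid near each time by continuity, thus persists for all later cutoffs, and compactness of
  -- `[0, T]` gives one index.
  have hmono : ∀ n, ∃ N, ∀ k, N ≤ k → ∀ x, χ n x ≤ χ k x := fun n => by
    obtain ⟨R, hR⟩ := (hχ n).2.isCompact.isBounded.exists_norm_le
    refine ⟨⌈R⌉₊, fun k hk x => ?_⟩
    by_cases hx : x ∈ tsupport (χ n)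
    · rw [hχ1 k x ((hR x hx).trans ((Nat.ceil_le.1 hk).trans (by linarith)))]
      exact (hχ01 n x).2
    · rw [image_eq_zero_of_notMem_tsupport hx]
      exact (hχ01 k x).1
  obtain ⟨N, hN⟩ := (isCompact_Icc (a := (0 : ℝ)) (b := T)).induction_on
    (p := fun S => ∃ N, ∀ k, N ≤ k → ∀ s ∈ S, s ∈ Icc 0 T → 1 / 2 ≤ ∫ x, χ k x * ρ s x)
    ⟨0, fun _ _ _ hs => absurd hs (notMem_empty _)⟩
    (fun S S' hSS' ⟨N, hN⟩ => ⟨N, fun k hk s hs => hN k hk s (hSS' hs)⟩)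
    (fun S S' ⟨N, hN⟩ ⟨N', hN'⟩ => ⟨max N N', fun k hk s hs hsT => hs.elim
      (fun h => hN k ((le_max_left _ _).trans hk) s h hsT)
      (fun h => hN' k ((le_max_right _ _).trans hk) s h hsT)⟩)
    (fun s hs => by
      obtain ⟨n, hn⟩ := ((hlim s hs.1).eventually (lt_mem_nhds (by norm_num : (1 / 2 : ℝ) < 1))).exists
      obtain ⟨N, hN⟩ := hmono n
      refine ⟨_, inter_mem self_mem_nhdsWithin
        ((hcont n s hs).eventually (lt_mem_nhds hn)), N, fun k hk r hr hrT => ?_⟩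
      have hlt : 1 / 2 < ∫ x, χ n x * ρ r x := hr.2
      refine hlt.le.trans (integral_mono (hint n r hrT.1) (hint k r hrT.1) fun x => ?_)
      exact mul_le_mul_of_nonneg_right (hN k hk x) ((hp.density r hrT.1).nonneg x))
  exact ⟨χ N, hχ N, fun x => (hχ01 N x).1, fun s hs => hN N le_rfl s hs hs⟩

/-- Testing the law against a fixed `φ` that captures at least half the mass gives `(ĥ - m) ∫ φ ρ =
∫ φ (h - m) ρ + F / β` with `F = ∫ ∇φ · u ρ`. The first term is bounded and `F` is integrable in
time by the definition of a controlled path. Nothing else controls `ĥ` in time beforehand. -/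
theorem integrableOn_mean (hp : IsControlledPath ρ₀ ρ u) (hβ : 0 < β) (hc : Continuous h)
    (hm : ∀ x, m ≤ h x) (hi : ∀ t, 0 ≤ t → Integrable fun x => h x * ρ t x)
    (hlaw : SolvesControlLaw β h ρ u) {T : ℝ} (hT : 0 ≤ T) :
    IntegrableOn (fun s => mean (ρ s) h - m) (Ioc 0 T) := by
  obtain ⟨φ, hφ, hφ0, hhalf⟩ := hp.exists_test_half_le hT
  have hcomp : ∃ C, ∀ x, |φ x * (h x - m)| ≤ C :=
    HasCompactSupport.exists_bound_of_continuous (f := fun x => φ x * (h x - m))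
      hφ.2.mul_right (hφ.continuous.mul (hc.sub continuous_const))
  obtain ⟨C, hC⟩ := hcomp
  obtain ⟨D, -, hD⟩ := hφ.bound
  have hF := (intervalIntegrable_iff_integrableOn_Ioc_of_le hT).1 (hp.continuity φ hφ T hT).1
  have hB : IntegrableOn (fun s => 2 * C + 2 / β * ‖∫ x, fderiv ℝ φ x (u s x) * ρ s x‖)
      (Ioc 0 T) := Integrable.add (integrableOn_const (by simp)) (hF.norm.const_mul _)
  refine hB.mono' ((hp.measurable_mean hc.measurable).sub_const m).aestronglyMeasurable ?_
  filter_upwards [ae_restrict_mem measurableSet_Ioc,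
    ae_restrict_of_ae_restrict_of_subset (fun s (hs : s ∈ Ioc 0 T) => hs.1) hlaw] with s hs hl
  have hρ := hp.density s hs.1.le
  have his := hi s hs.1.le
  have ha : 0 ≤ mean (ρ s) h - m := sub_nonneg.2 (hρ.le_mean his hm)
  have h1 : Integrable fun x => φ x * ρ s x :=
    hρ.integrable_bdd_mul hφ.continuous.aestronglyMeasurable hD
  have h2 : Integrable fun x => φ x * (h x - m) * ρ s x :=
    hρ.integrable_bdd_mul (hφ.continuous.mul (hc.sub continuous_const)).aestronglyMeasurable hC
  have h3 : ∫ x, φ x * (β * (h x - mean (ρ s) h) * ρ s x) =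
      β * ((∫ x, φ x * (h x - m) * ρ s x) - (mean (ρ s) h - m) * ∫ x, φ x * ρ s x) := by
    rw [← integral_const_mul, ← integral_sub h2 (h1.const_mul _), ← integral_const_mul]
    congr 1
    ext x
    ring
  rw [hl.weak φ hφ] at h3
  have h4 : ∫ x, φ x * (h x - m) * ρ s x ≤ C := by
    calc ∫ x, φ x * (h x - m) * ρ s x ≤ ∫ x, C * ρ s x :=
          integral_mono h2 (hρ.integrable.const_mul C) fun x =>
            mul_le_mul_of_nonneg_right ((le_abs_self _).trans (hC x)) (hρ.nonneg x)
      _ = C := by rw [integral_const_mul, hρ.integral_eq_one, mul_one]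
  have h5 := mul_le_mul_of_nonneg_left (hhalf s ⟨hs.1.le, hs.2⟩) ha
  have h6 := le_abs_self (∫ x, fderiv ℝ φ x (u s x) * ρ s x)
  rw [Real.norm_of_nonneg ha, Real.norm_eq_abs]
  generalize (∫ x, fderiv ℝ φ x (u s x) * ρ s x) = F at *
  generalize (∫ x, φ x * (h x - m) * ρ s x) = P at *
  generalize (∫ x, φ x * ρ s x) = Q at *
  have h7 : (mean (ρ s) h - m) * Q = P + F / β := by
    field_simp
    linarith
  have h8 : F / β ≤ |F| / β := by gcongr
  have h9 : 2 / β * |F| = 2 * (|F| / β) := by ring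
  rw [h9]
  linarith

/-- `∫ |h - ĥ| ρ ≤ 2 (ĥ - m)`. -/
theorem _root_.MeanFieldControl.IsDensity.integral_abs_sub_mean_le {ρ : Space d → ℝ}
    (hρ : IsDensity ρ) (hm : ∀ x, m ≤ h x) (hi : Integrable fun x => h x * ρ x) :
    ∫ x, |(h x - mean ρ h) * ρ x| ≤ 2 * (mean ρ h - m) := by
  have ha : 0 ≤ mean ρ h - m := sub_nonneg.2 (hρ.le_mean hi hm)
  have h1 := hρ.integrable_sub_mul hi m
  calc ∫ x, |(h x - mean ρ h) * ρ x| ≤ ∫ x, ((h x - m) * ρ x + (mean ρ h - m) * ρ x) := by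
        refine integral_mono (hρ.integrable_sub_mul hi _).abs
          (h1.add (hρ.integrable.const_mul _)) fun x => ?_
        dsimp only
        rw [abs_mul, abs_of_nonneg (hρ.nonneg x), ← add_mul]
        refine mul_le_mul_of_nonneg_right ?_ (hρ.nonneg x)
        have := hm x
        rw [abs_le]
        constructor <;> linarith
    _ = _ := by
        rw [integral_add h1 (hρ.integrable.const_mul _), hρ.integral_sub_mul hi,
          integral_const_mul, hρ.integral_eq_one]
        ring

/-- The control law as an integral equation for the density at almost every point. -/
theorem ae_density_eq (hp : IsControlledPath ρ₀ ρ u) (hβ : 0 < β) (hc : Continuous h)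
    (hm : ∀ x, m ≤ h x) (hi : ∀ t, 0 ≤ t → Integrable fun x => h x * ρ t x)
    (hlaw : SolvesControlLaw β h ρ u) {T : ℝ} (hT : 0 ≤ T) :
    Integrable (fun p : ℝ × Space d => (h p.2 - mean (ρ p.1) h) * ρ p.1 p.2)
      ((volume.restrict (Ioc 0 T)).prod volume) ∧
    ∀ᵐ x, ρ T x = ρ₀ x - β * ∫ s in Ioc 0 T, (h x - mean (ρ s) h) * ρ s x := by
  have hKm : Measurable fun p : ℝ × Space d => (h p.2 - mean (ρ p.1) h) * ρ p.1 p.2 :=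
    ((hc.measurable.comp measurable_snd).sub
      ((hp.measurable_mean hc.measurable).comp measurable_fst)).mul hp.measurable_density
  -- Space-time integrability, from the `L¹` bound `2 (ĥ - m)` at each time, is what allows Fubini
  -- and the passage from a distributional identity to one at almost every point.
  have hK : Integrable (fun p : ℝ × Space d => (h p.2 - mean (ρ p.1) h) * ρ p.1 p.2)
      ((volume.restrict (Ioc 0 T)).prod volume) := by
    rw [integrable_prod_iff hKm.aestronglyMeasurable]
    refine ⟨?_, ?_⟩
    · filter_upwards [ae_restrict_mem measurableSet_Ioc] with s hs
      exact (hp.density s hs.1.le).integrable_sub_mul (hi s hs.1.le) _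
    · refine ((hp.integrableOn_mean hβ hc hm hi hlaw hT).const_mul 2).mono'
        hKm.norm.stronglyMeasurable.integral_prod_right.aestronglyMeasurable ?_
      filter_upwards [ae_restrict_mem measurableSet_Ioc] with s hs
      rw [Real.norm_of_nonneg (integral_nonneg fun x => norm_nonneg _)]
      exact (hp.density s hs.1.le).integral_abs_sub_mean_le hm (hi s hs.1.le)
  refine ⟨hK, ?_⟩
  have hρ0 : IsDensity ρ₀ := hp.initial ▸ hp.density 0 le_rfl
  have hI := hK.integral_prod_right
  refine ae_eq_of_integral_contDiff_smul_eq (hp.density T hT).integrable.locallyIntegrable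
    (hρ0.integrable.sub (hI.const_mul β)).locallyIntegrable fun φ hφ hφc => ?_
  have htest : IsTest φ := ⟨hφ.of_le (by exact_mod_cast le_top), hφc⟩
  obtain ⟨C, -, hC⟩ := htest.bound
  have h1 : Integrable fun x => φ x * ρ₀ x :=
    hρ0.integrable_bdd_mul htest.continuous.aestronglyMeasurable hC
  have h2 : Integrable fun x => φ x * (β * ∫ s in Ioc 0 T, (h x - mean (ρ s) h) * ρ s x) :=
    (hI.const_mul β).bdd_mul htest.continuous.aestronglyMeasurable (Eventually.of_forall hC)
  have h3 : Integrable (fun p : ℝ × Space d => φ p.2 * ((h p.2 - mean (ρ p.1) h) * ρ p.1 p.2))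
      ((volume.restrict (Ioc 0 T)).prod volume) :=
    hK.bdd_mul (htest.continuous.comp continuous_snd).aestronglyMeasurable
      (Eventually.of_forall fun p => hC p.2)
  simp only [smul_eq_mul, mul_sub]
  rw [integral_sub h1 h2, (hp.continuity φ htest T hT).2, intervalIntegral.integral_of_le hT,
    sub_eq_add_neg]
  congr 1
  have h4 : ∫ s in Ioc 0 T, ∫ x, fderiv ℝ φ x (u s x) * ρ s x =
      ∫ s in Ioc 0 T, -β * ∫ x, φ x * ((h x - mean (ρ s) h) * ρ s x) := by
    refine integral_congr_ae ?_
    filter_upwards [ae_restrict_of_ae_restrict_of_subset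
      (fun s (hs : s ∈ Ioc 0 T) => hs.1) hlaw] with s hl
    have h5 := hl.weak φ htest
    rw [← neg_eq_iff_eq_neg] at h5
    rw [← h5, neg_mul, ← integral_const_mul]
    congr 2
    ext x
    ring
  rw [h4, integral_const_mul, integral_integral_swap h3, neg_mul, ← integral_const_mul]
  congr 2
  ext x
  rw [integral_const_mul]
  ring

/-- Paths obeying the control law are Gibbs reweightings of the initial density. -/
theorem exists_ae_eq_gibbs (hp : IsControlledPath ρ₀ ρ u) (hβ : 0 < β) (hc : Continuous h)
    (hm : ∀ x, m ≤ h x) (hi : ∀ t, 0 ≤ t → Integrable fun x => h x * ρ t x)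
    (hlaw : SolvesControlLaw β h ρ u) {T : ℝ} (hT : 0 ≤ T) :
    ∃ A, ρ T =ᵐ[volume] fun x => A * (ρ₀ x * Real.exp (-(β * T * (h x - m)))) := by
  set K : ℝ → Space d → ℝ := fun s x => (h x - mean (ρ s) h) * ρ s x with hK
  have hKm : Measurable (Function.uncurry K) :=
    ((hc.measurable.comp measurable_snd).sub
      ((hp.measurable_mean hc.measurable).comp measurable_fst)).mul hp.measurable_density
  have hρ0 : IsDensity ρ₀ := hp.initial ▸ hp.density 0 le_rfl
  -- The version `y` satisfies the integral equation with an exact equality at every time, whereas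
  -- `ρ t` agrees with it only off a null set that depends on `t`.
  set y : ℝ → Space d → ℝ := fun t x => ρ₀ x - β * ∫ s in Ioc 0 t, K s x with hy
  have hym : Measurable (Function.uncurry y) := by
    have h1 : Measurable (Function.uncurry fun (p : ℝ × Space d) (s : ℝ) =>
        (Ioc 0 p.1).indicator (fun s => K s p.2) s) := by
      have hset : MeasurableSet {q : (ℝ × Space d) × ℝ | 0 < q.2 ∧ q.2 ≤ q.1.1} :=
        (measurableSet_lt measurable_const measurable_snd).inter
          (measurableSet_le measurable_snd measurable_fst.fst)
      exact (hKm.comp (measurable_snd.prodMk measurable_fst.snd)).indicator hset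
    have h2 := h1.stronglyMeasurable.integral_prod_right (ν := volume)
    have h3 : Measurable fun p : ℝ × Space d => ∫ s in Ioc 0 p.1, K s p.2 := by
      convert h2.measurable using 2 with p
      exact (integral_indicator measurableSet_Ioc).symm
    exact (hρ0.measurable.comp measurable_snd).sub (h3.const_mul β)
  -- Exchanging the quantifiers by Fubini lets `y` replace `ρ` under the time integral at almost
  -- every fixed `x`, which closes the scalar Volterra equation.
  have hae : ∀ᵐ x, ∀ᵐ s ∂(volume.restrict (Ioc 0 T)), ρ s x = y s x := by
    rw [Measure.ae_ae_comm]
    · filter_upwards [ae_restrict_mem measurableSet_Ioc] with s hs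
      exact (hp.ae_density_eq hβ hc hm hi hlaw hs.1.le).2
    · exact measurableSet_eq_fun (hp.measurable_density.comp measurable_swap)
        (hym.comp measurable_swap)
  obtain ⟨hKi, hTeq⟩ := hp.ae_density_eq hβ hc hm hi hlaw hT
  have hmi := hp.integrableOn_mean hβ hc hm hi hlaw hT
  -- In the Volterra exponent `-∫ β (h - ĥ)`, the part independent of `x` is `β ∫ (ĥ - m)`; it plays
  -- the role of the normalizing constant.
  refine ⟨Real.exp (β * ∫ s in Ioc 0 T, (mean (ρ s) h - m)), ?_⟩
  filter_upwards [hae, hTeq, hKi.prod_left_ae] with x hx hxT hxi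
  have hIoc : IntegrableOn (fun s => K s x) (Ioc 0 T) := hxi
  have hk : IntegrableOn (fun s => β * (h x - mean (ρ s) h)) (Ioc 0 T) := by
    have : (fun s => β * (h x - mean (ρ s) h)) =
        fun s => β * ((h x - m) - (mean (ρ s) h - m)) := by
      ext s
      ring
    rw [this]
    exact Integrable.const_mul (Integrable.sub (integrable_const _) hmi) β
  have hky : (fun s => β * (h x - mean (ρ s) h) * y s x)
      =ᵐ[volume.restrict (Ioc 0 T)] fun s => β * K s x := by
    filter_upwards [hx] with s hs
    rw [← hs, hK]
    ring
  have hsol := eq_mul_exp_of_volterra (k := fun s => β * (h x - mean (ρ s) h))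
    (y := fun s => y s x) (y₀ := ρ₀ x) hT
    ((intervalIntegrable_iff_integrableOn_Ioc_of_le hT).2 hk)
    ((intervalIntegrable_iff_integrableOn_Ioc_of_le hT).2
      ((Integrable.const_mul hIoc β).congr hky.symm)) (fun t ht => by
        rw [intervalIntegral.integral_of_le ht.1, integral_congr_ae
          (ae_restrict_of_ae_restrict_of_subset (Ioc_subset_Ioc_right ht.2) hky),
          integral_const_mul]) T ⟨hT, le_rfl⟩
  have hyT : ρ T x = y T x := hxT
  rw [hyT, hsol, mul_left_comm, ← Real.exp_add, intervalIntegral.integral_of_le hT]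
  congr 2
  have : (fun s => β * (h x - mean (ρ s) h)) =
      fun s => β * (h x - m) - β * (mean (ρ s) h - m) := by
    ext s
    ring
  rw [this, integral_sub (integrable_const _) (Integrable.const_mul hmi β),
    integral_const_mul β fun s => mean (ρ s) h - m, setIntegral_const]
  simp only [Measure.real, Real.volume_Ioc, sub_zero, ENNReal.toReal_ofReal hT, smul_eq_mul]
  ring

/-- Paths obeying the control law satisfy the terminal constraint. -/
theorem tendsto_mean_of_law (hp : IsControlledPath ρ₀ ρ u) (hβ : 0 < β) (hc : Continuous h)
    (hpos : ∀ x, 0 < ρ₀ x) {xbar : Space d} (hm : ∀ x, h xbar ≤ h x)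
    (hi : ∀ t, 0 ≤ t → Integrable fun x => h x * ρ t x) (hlaw : SolvesControlLaw β h ρ u) :
    Tendsto (fun t => mean (ρ t) h) atTop (𝓝 (h xbar)) := by
  have hρ0 : IsDensity ρ₀ := hp.initial ▸ hp.density 0 le_rfl
  have hi0 : Integrable fun x => h x * ρ₀ x := by simpa [hp.initial] using hi 0 le_rfl
  rw [Metric.tendsto_atTop']
  intro ε hε
  obtain ⟨M, hM⟩ := exists_laplace_bound hρ0 hpos hc hm rfl hi0 (half_pos hε)
  have hlim : Tendsto (fun t : ℝ => ε / 2 + M * Real.exp (-(β * t * (ε / 2 / 2)))) atTop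
      (𝓝 (ε / 2 + M * 0)) := by
    refine ((Real.tendsto_exp_atBot.comp ?_).const_mul M).const_add _
    refine tendsto_neg_atTop_atBot.comp ?_
    exact (tendsto_id.const_mul_atTop hβ).atTop_mul_const (by positivity)
  rw [mul_zero, add_zero] at hlim
  obtain ⟨T, hT⟩ := eventually_atTop.1 (hlim.eventually (gt_mem_nhds (half_lt_self hε)))
  refine ⟨max T 0, fun t ht => ?_⟩
  have ht0 : 0 ≤ t := (le_max_right _ _).trans ht.le
  have hρ := hp.density t ht0
  obtain ⟨A, hA⟩ := hp.exists_ae_eq_gibbs hβ hc hm hi hlaw ht0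
  -- Unit mass identifies `A` as the inverse normalizer, so multiplying the Laplace bound by `A`
  -- bounds `ĥ - h xbar` directly.
  have hone : A * ∫ x, ρ₀ x * Real.exp (-(β * t * (h x - h xbar))) = 1 := by
    rw [← integral_const_mul, ← integral_congr_ae hA, hρ.integral_eq_one]
  have hmean : mean (ρ t) h - h xbar =
      A * ∫ x, (h x - h xbar) * (ρ₀ x * Real.exp (-(β * t * (h x - h xbar)))) := by
    rw [← hρ.integral_sub_mul (hi t ht0), ← integral_const_mul]
    refine integral_congr_ae ?_
    filter_upwards [hA] with x hx
    rw [hx]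
    ring
  have hZ : 0 ≤ ∫ x, ρ₀ x * Real.exp (-(β * t * (h x - h xbar))) :=
    integral_nonneg fun x => mul_nonneg (hρ0.nonneg x) (Real.exp_pos _).le
  have hA0 : 0 ≤ A := by
    by_contra hneg
    nlinarith [mul_nonneg (neg_nonneg.2 (not_le.1 hneg).le) hZ]
  have hbound := mul_le_mul_of_nonneg_left (hM (β * t) (mul_nonneg hβ.le ht0)) hA0
  rw [mul_left_comm, hone, mul_one, ← hmean] at hbound
  rw [Real.dist_eq, abs_of_nonneg (sub_nonneg.2 (hρ.le_mean (hi t ht0) hm))]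
  exact hbound.trans_lt (hT t ((le_max_left _ _).trans ht.le))

/-- The dissipation along a path obeying the control law. -/
theorem lintegral_variance_le (hp : IsControlledPath ρ₀ ρ u) (hβ : 0 < β) (hc : ContDiff ℝ 1 h)
    (hm : ∀ x, m ≤ h x) (hi : ∀ t, 0 ≤ t → Integrable fun x => h x * ρ t x)
    (hlaw : SolvesControlLaw β h ρ u) {T : ℝ} (hT : 0 ≤ T) :
    ENNReal.ofReal β * ∫⁻ s in Ioc 0 T, ∫⁻ x, ENNReal.ofReal ((h x - mean (ρ s) h) ^ 2 * ρ s x) ≤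
      ENNReal.ofReal (mean ρ₀ h - m) := by
  have hhm := hc.continuous.measurable
  have hρ0 : IsDensity ρ₀ := hp.initial ▸ hp.density 0 le_rfl
  have hi0 : Integrable fun x => h x * ρ₀ x := by simpa [hp.initial] using hi 0 le_rfl
  have hy : ∀ x, 0 ≤ h x - m := fun x => sub_nonneg.2 (hm x)
  have ha : ∀ s, 0 ≤ s → 0 ≤ mean (ρ s) h - m := fun s hs =>
    sub_nonneg.2 ((hp.density s hs).le_mean (hi s hs) hm)
  let f : ℕ → ℝ → Space d → ℝ≥0∞ := fun n s x =>
    ENNReal.ofReal ((trunc n (h x - m) - trunc n (mean (ρ s) h - m)) ^ 2 * ρ s x)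
  have hfm : ∀ n, Measurable (Function.uncurry (f n)) := fun n => by
    have h1 : Measurable fun p : ℝ × Space d => trunc n (h p.2 - m) :=
      (contDiff_trunc_comp n hc hm).continuous.measurable.comp measurable_snd
    have h2 : Measurable fun s => trunc n (mean (ρ s) h - m) := by
      have := (hp.measurable_mean hhm).sub_const m
      exact this.div ((this.div_const _).const_add _)
    exact (((h1.sub (h2.comp measurable_fst)).pow_const 2).mul hp.measurable_density).ennreal_ofReal
  -- Test the continuity equation against the truncated `h - m`, centre as before, and discard the
  -- nonnegative terminal term. The bound is independent of `n`, so Fatou's lemma in space and then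
  -- in time removes the truncation.
  have hn : ∀ n, ENNReal.ofReal β * ∫⁻ s in Ioc 0 T, ∫⁻ x, f n s x ≤
      ENNReal.ofReal (mean ρ₀ h - m) := by
    intro n
    have htb : ∀ x, |trunc n (h x - m)| ≤ n + 1 := fun x => abs_trunc_le_nat n (hy x)
    have htc := (contDiff_trunc_comp n hc hm).continuous
    obtain ⟨hqi, hq⟩ := hp.integral_bdd_eq (g := fun s x => β * (h x - mean (ρ s) h))
      (G := fun s => β * (2 * (mean (ρ s) h - m))) hT
      (((hp.integrableOn_mean hβ hc.continuous hm hi hlaw hT).const_mul 2).const_mul β) (by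
        filter_upwards [hlaw, ae_restrict_mem measurableSet_Ioi] with s hl hs
        have hs0 : 0 ≤ s := le_of_lt hs
        have hρ := hp.density s hs0
        refine ⟨hl, ?_, ?_⟩
        · simp only [mul_assoc]
          exact (hρ.integrable_sub_mul (hi s hs0) _).const_mul β
        · simp only [mul_assoc, abs_mul β, abs_of_pos hβ]
          rw [integral_const_mul]
          exact mul_le_mul_of_nonneg_left (hρ.integral_abs_sub_mean_le hm (hi s hs0)) hβ.le)
      (contDiff_trunc_comp n hc hm) htb
    have hle : ∀ᵐ s ∂(volume.restrict (Ioc 0 T)),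
        0 ≤ ∫ x, trunc n (h x - m) * (β * (h x - mean (ρ s) h) * ρ s x) ∧
        ENNReal.ofReal β * ∫⁻ x, f n s x ≤
          ENNReal.ofReal (∫ x, trunc n (h x - m) * (β * (h x - mean (ρ s) h) * ρ s x)) := by
      filter_upwards [ae_restrict_mem measurableSet_Ioc] with s hs
      have hs0 := hs.1.le
      have hρ := hp.density s hs0
      have his := hi s hs0
      have hK := hρ.integrable_sub_mul his (mean (ρ s) h)
      have hz : ∫ x, (h x - mean (ρ s) h) * ρ s x = 0 := by
        rw [hρ.integral_sub_mul his, sub_self]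
      have h1 : Integrable fun x => trunc n (h x - m) * ((h x - mean (ρ s) h) * ρ s x) :=
        hK.bdd_mul htc.aestronglyMeasurable (Eventually.of_forall htb)
      have h2 : Integrable fun x =>
          (trunc n (h x - m) - trunc n (mean (ρ s) h - m)) * ((h x - mean (ρ s) h) * ρ s x) := by
        simp only [sub_mul (trunc n _)]
        exact h1.sub (hK.const_mul _)
      have h3 : ∫ x, trunc n (h x - m) * (β * (h x - mean (ρ s) h) * ρ s x) = β * ∫ x,
          (trunc n (h x - m) - trunc n (mean (ρ s) h - m)) * ((h x - mean (ρ s) h) * ρ s x) := by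
        simp only [sub_mul (trunc n _)]
        rw [integral_sub h1 (hK.const_mul _), integral_const_mul (trunc n _), hz, mul_zero,
          sub_zero, ← integral_const_mul]
        congr 1
        ext x
        ring
      have hpt : ∀ x, (trunc n (h x - m) - trunc n (mean (ρ s) h - m)) ^ 2 * ρ s x ≤
          (trunc n (h x - m) - trunc n (mean (ρ s) h - m)) * ((h x - mean (ρ s) h) * ρ s x) := by
        intro x
        rw [← mul_assoc]
        have := sq_trunc_sub_le n (hy x) (ha s hs0)
        rw [sub_sub_sub_cancel_right] at this
        exact mul_le_mul_of_nonneg_right this (hρ.nonneg x)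
      have hpt0 := fun x => (mul_nonneg (sq_nonneg _) (hρ.nonneg x)).trans (hpt x)
      rw [h3, ENNReal.ofReal_mul hβ.le]
      refine ⟨mul_nonneg hβ.le (integral_nonneg hpt0), ?_⟩
      gcongr
      rw [ofReal_integral_eq_lintegral_ofReal h2 (Eventually.of_forall hpt0)]
      exact lintegral_mono fun x => ENNReal.ofReal_le_ofReal (hpt x)
    rw [← lintegral_const_mul _ (hfm n).lintegral_prod_right]
    refine (lintegral_mono_ae (hle.mono fun s hs => hs.2)).trans ?_
    rw [← ofReal_integral_eq_lintegral_ofReal hqi (hle.mono fun s hs => hs.1)]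
    refine ENNReal.ofReal_le_ofReal ?_
    have h4 : 0 ≤ ∫ x, trunc n (h x - m) * ρ T x := integral_nonneg fun x =>
      mul_nonneg (trunc_nonneg n (hy x)) ((hp.density T hT).nonneg x)
    have h5 : ∫ x, trunc n (h x - m) * ρ₀ x ≤ mean ρ₀ h - m := by
      rw [← hρ0.integral_sub_mul hi0]
      exact integral_mono (hρ0.integrable_bdd_mul htc.aestronglyMeasurable htb)
        (hρ0.integrable_sub_mul hi0 m) fun x =>
          mul_le_mul_of_nonneg_right (trunc_le n (hy x)) (hρ0.nonneg x)
    linarith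
  have hlim : ∀ s x, Tendsto (fun n => f n s x) atTop
      (𝓝 (ENNReal.ofReal ((h x - mean (ρ s) h) ^ 2 * ρ s x))) := fun s x => by
    refine ENNReal.tendsto_ofReal (Tendsto.mul_const _ (Tendsto.pow ?_ 2))
    have := (tendsto_trunc (h x - m)).sub (tendsto_trunc (mean (ρ s) h - m))
    rwa [sub_sub_sub_cancel_right] at this
  have hfat : ∫⁻ s in Ioc 0 T, ∫⁻ x, ENNReal.ofReal ((h x - mean (ρ s) h) ^ 2 * ρ s x) ≤
      liminf (fun n => ∫⁻ s in Ioc 0 T, ∫⁻ x, f n s x) atTop := by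
    refine le_trans (lintegral_mono fun s => ?_)
      (lintegral_liminf_le fun n => (hfm n).lintegral_prod_right)
    refine le_trans (lintegral_mono fun x => ((hlim s x).liminf_eq).ge)
      (lintegral_liminf_le fun n => (hfm n).of_uncurry_left)
  have hβ0 : ENNReal.ofReal β ≠ 0 := (ENNReal.ofReal_pos.2 hβ).ne'
  rw [mul_comm, ← ENNReal.le_div_iff_mul_le (Or.inl hβ0) (Or.inl ENNReal.ofReal_ne_top)]
  refine hfat.trans (liminf_le_of_le (by isBoundedDefault) fun b hb => ?_)
  obtain ⟨n, hbn⟩ := hb.exists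
  refine hbn.trans ?_
  rw [ENNReal.le_div_iff_mul_le (Or.inl hβ0) (Or.inl ENNReal.ofReal_ne_top), mul_comm]
  exact hn n

/-- Under the law the control term is at most `β² / 2` times the variance, as is the state term, so
the Lagrangian is at most `β²` times the variance; the dissipation estimate integrates it. The bound
is uniform over the intervals `(0, n]` that exhaust the half-line. -/
theorem cost_le_of_law (hp : IsControlledPath ρ₀ ρ u) (hβ : 0 < β) (hc : ContDiff ℝ 1 h)
    (hm : ∀ x, m ≤ h x) (hi : ∀ t, 0 ≤ t → Integrable fun x => h x * ρ t x)
    (hlaw : SolvesControlLaw β h ρ u) :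
    cost β h ρ u ≤ ENNReal.ofReal (β * (mean ρ₀ h - m)) := by
  have hL : ∀ᵐ s ∂(volume.restrict (Ioi (0 : ℝ))), lagrangian β h (ρ s) (u s) ≤
      ENNReal.ofReal (β ^ 2) * ∫⁻ x, ENNReal.ofReal ((h x - mean (ρ s) h) ^ 2 * ρ s x) := by
    filter_upwards [hlaw] with s hl
    have h1 : controlCost (ρ s) (u s) ≤ ENNReal.ofReal (β ^ 2 / 2) *
        ∫⁻ x, ENNReal.ofReal ((h x - mean (ρ s) h) ^ 2 * ρ s x) := by
      refine (iInf₂_le _ hl).trans_eq ?_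
      simp only [mul_pow, mul_assoc, ENNReal.ofReal_mul (sq_nonneg β)]
      rw [lintegral_const_mul' _ _ ENNReal.ofReal_ne_top, ← mul_assoc,
        ← ENNReal.ofReal_mul (by norm_num)]
      congr 2
      ring
    refine (add_le_add h1 le_rfl).trans_eq ?_
    rw [← add_mul, ← ENNReal.ofReal_add (by positivity) (by positivity)]
    congr 2
    ring
  have hU : Ioi (0 : ℝ) = ⋃ n : ℕ, Ioc (0 : ℝ) n := by
    ext s
    simp only [mem_Ioi, mem_iUnion, mem_Ioc]
    exact ⟨fun hs => ⟨⌈s⌉₊, hs, Nat.le_ceil s⟩, fun ⟨n, hs, _⟩ => hs⟩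
  have hdir : Directed (· ⊆ ·) fun n : ℕ => Ioc (0 : ℝ) n :=
    (monotone_nat_of_le_succ fun n => Ioc_subset_Ioc_right (by
      push_cast
      linarith)).directed_le
  have hdir' : cost β h ρ u = ⨆ n : ℕ, ∫⁻ s in Ioc (0 : ℝ) n, lagrangian β h (ρ s) (u s) := by
    rw [cost, hU, setLIntegral_iUnion_of_directed _ hdir]
  rw [hdir']
  refine iSup_le fun n => ?_
  calc ∫⁻ s in Ioc (0 : ℝ) n, lagrangian β h (ρ s) (u s)
      ≤ ∫⁻ s in Ioc (0 : ℝ) n, ENNReal.ofReal (β ^ 2) *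
          ∫⁻ x, ENNReal.ofReal ((h x - mean (ρ s) h) ^ 2 * ρ s x) :=
        lintegral_mono_ae (ae_restrict_of_ae_restrict_of_subset
          (fun s (hs : s ∈ Ioc (0 : ℝ) n) => hs.1) hL)
    _ = ENNReal.ofReal β * (ENNReal.ofReal β * ∫⁻ s in Ioc (0 : ℝ) n,
          ∫⁻ x, ENNReal.ofReal ((h x - mean (ρ s) h) ^ 2 * ρ s x)) := by
        rw [lintegral_const_mul' _ _ ENNReal.ofReal_ne_top, pow_two, ENNReal.ofReal_mul hβ.le,
          mul_assoc]
    _ ≤ ENNReal.ofReal β * ENNReal.ofReal (mean ρ₀ h - m) := by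
        gcongr
        exact hp.lintegral_variance_le hβ hc hm hi hlaw n.cast_nonneg
    _ = _ := (ENNReal.ofReal_mul hβ.le).symm

end IsControlledPath

end MeanFieldControl

/-! ### Poincaré inequality on a ball, Euler identity, radial weight -/

namespace MeanFieldControl

variable {d : ℕ}

/-- Contraction towards `x` by the factor `a` keeps the convex ball inside itself, and its inverse
Jacobian `a⁻ᵈ` is at most `2ᵈ` because `a ≥ 1/2`. -/
theorem lintegral_ball_comp_affine_le {R a : ℝ} (ha : 1 / 2 ≤ a) (ha1 : a ≤ 1) {x : Space d}
    (hx : x ∈ Metric.ball (0 : Space d) R) {e : Space d → ℝ≥0∞} (he : Measurable e) :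
    ∫⁻ y in Metric.ball 0 R, e (a • y + (1 - a) • x) ≤ 2 ^ d * ∫⁻ y in Metric.ball 0 R, e y := by
  have ha0 : 0 < a := by linarith
  set B := Metric.ball (0 : Space d) R with hB
  have hBm : MeasurableSet B := measurableSet_ball
  have h1 : ∀ y, B.indicator (fun y => e (a • y + (1 - a) • x)) y ≤
      B.indicator e (a • y + (1 - a) • x) := by
    intro y
    by_cases hy : y ∈ B
    · have : a • y + (1 - a) • x ∈ B :=
        convex_ball (0 : Space d) R hy hx ha0.le (sub_nonneg.2 ha1) (by ring)
      rw [indicator_of_mem hy, indicator_of_mem this]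
    · rw [indicator_of_notMem hy]
      exact zero_le
  have hem : Measurable (B.indicator e) := he.indicator hBm
  rw [← lintegral_indicator hBm, ← lintegral_indicator hBm]
  refine (lintegral_mono h1).trans ?_
  have h2 : ∫⁻ y, B.indicator e (a • y + (1 - a) • x) =
      ∫⁻ z, B.indicator e (z + (1 - a) • x) ∂(Measure.map (a • ·) volume) :=
    (lintegral_map (hem.comp (measurable_id.add_const _)) (measurable_const_smul a)).symm
  rw [h2, Measure.map_addHaar_smul _ ha0.ne', lintegral_smul_measure,
    lintegral_add_right_eq_self (B.indicator e), finrank_euclideanSpace_fin, smul_eq_mul]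
  gcongr
  rw [abs_of_nonneg (by positivity), ← inv_pow, ENNReal.ofReal_pow (by positivity)]
  gcongr
  rw [show (2 : ℝ≥0∞) = ENNReal.ofReal 2 by simp]
  refine ENNReal.ofReal_le_ofReal ?_
  rw [inv_le_comm₀ ha0 two_pos]
  linarith

/-- The fundamental theorem of calculus along the segment, then Cauchy–Schwarz on the unit interval.
-/
theorem sq_sub_le_lintegral_segment {φ : Space d → ℝ} (hφ : ContDiff ℝ 1 φ) (x v : Space d) :
    ENNReal.ofReal ((φ (x + v) - φ x) ^ 2) ≤ ENNReal.ofReal (‖v‖ ^ 2) *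
      ∫⁻ s in Ioc (0 : ℝ) 1, ENNReal.ofReal (‖fderiv ℝ φ (x + s • v)‖ ^ 2) := by
  have hγ : Continuous fun s : ℝ => x + s • v := by fun_prop
  have hD := hφ.continuous_fderiv one_ne_zero
  set f : ℝ → ℝ := fun s => fderiv ℝ φ (x + s • v) v with hf
  have hfc : Continuous f := (hD.comp hγ).clm_apply continuous_const
  have hFTC : ∫ s in (0 : ℝ)..1, f s = φ (x + v) - φ x := by
    have h1 : ∀ s ∈ uIcc (0 : ℝ) 1, HasDerivAt (fun s : ℝ => φ (x + s • v)) (f s) s := by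
      intro s _
      have h2 : HasDerivAt (fun s : ℝ => x + s • v) v s := by
        simpa using ((hasDerivAt_id s).smul_const v).const_add x
      exact ((hφ.differentiable one_ne_zero _).hasFDerivAt).comp_hasDerivAt s h2
    simpa using intervalIntegral.integral_eq_sub_of_hasDerivAt h1 (hfc.intervalIntegrable _ _)
  have hf1 : IntegrableOn f (Ioc 0 1) :=
    (intervalIntegrable_iff_integrableOn_Ioc_of_le zero_le_one).1 (hfc.intervalIntegrable _ _)
  have hf2 : IntegrableOn (fun s => f s ^ 2) (Ioc 0 1) :=
    (intervalIntegrable_iff_integrableOn_Ioc_of_le zero_le_one).1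
      ((hfc.pow 2).intervalIntegrable _ _)
  rw [intervalIntegral.integral_of_le zero_le_one] at hFTC
  have hCS : (∫ s in Ioc (0 : ℝ) 1, f s) ^ 2 ≤ ∫ s in Ioc (0 : ℝ) 1, f s ^ 2 := by
    set I := ∫ s in Ioc (0 : ℝ) 1, f s with hI
    have h1 : ∫ s in Ioc (0 : ℝ) 1, (2 * I * f s - I ^ 2) ≤ ∫ s in Ioc (0 : ℝ) 1, f s ^ 2 :=
      integral_mono (Integrable.sub (Integrable.const_mul hf1 _) (integrable_const _)) hf2
        fun s => by
          dsimp only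
          nlinarith [sq_nonneg (f s - I)]
    rw [integral_sub (Integrable.const_mul hf1 _) (integrable_const _), integral_const_mul,
      ← hI] at h1
    simp at h1
    nlinarith
  rw [hFTC] at hCS
  refine (ENNReal.ofReal_le_ofReal hCS).trans ?_
  rw [ofReal_integral_eq_lintegral_ofReal hf2 (Eventually.of_forall fun s => sq_nonneg _),
    ← lintegral_const_mul' _ _ ENNReal.ofReal_ne_top]
  refine lintegral_mono fun s => ?_
  rw [← ENNReal.ofReal_mul (sq_nonneg _), ← mul_pow, ← sq_abs (f s)]
  refine ENNReal.ofReal_le_ofReal (pow_le_pow_left₀ (abs_nonneg _) ?_ 2)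
  rw [mul_comm]
  exact (fderiv ℝ φ (x + s • v)).le_opNorm v

/-- Poincaré inequality on a ball. -/
theorem exists_poincare_ball {R : ℝ} (hR : 0 < R) {φ : Space d → ℝ} (hφ : ContDiff ℝ 1 φ) :
    ∃ c, ∫⁻ x in Metric.ball 0 R, ENNReal.ofReal ((φ x - c) ^ 2) ≤
      ENNReal.ofReal (4 * R ^ 2) * 2 ^ d *
        ∫⁻ x in Metric.ball 0 R, ENNReal.ofReal (‖fderiv ℝ φ x‖ ^ 2) := by
  set B := Metric.ball (0 : Space d) R with hB
  have hBm : MeasurableSet B := measurableSet_ball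
  have hB0 : volume B ≠ 0 := (Metric.measure_ball_pos volume _ hR).ne'
  have hBt : volume B ≠ ∞ := measure_ball_lt_top.ne
  have hφc := hφ.continuous
  set e : Space d → ℝ≥0∞ := fun x => ENNReal.ofReal (‖fderiv ℝ φ x‖ ^ 2) with he
  have hem : Measurable e := ((hφ.continuous_fderiv one_ne_zero).norm.pow 2).measurable.ennreal_ofReal
  set I := ∫⁻ x in B, e x with hI
  -- The difference `φ x - φ y` is split at the midpoint. Going only half way keeps the contraction
  -- factor `1 - s / 2` above `1/2`, so the Jacobian stays bounded.
  set g : Space d → Space d → ℝ≥0∞ := fun x y =>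
    ENNReal.ofReal ((φ (y + (1 / 2 : ℝ) • (x - y)) - φ y) ^ 2) with hg
  have hgm : Measurable (Function.uncurry g) := by
    have : Continuous fun p : Space d × Space d =>
        (φ (p.2 + (1 / 2 : ℝ) • (p.1 - p.2)) - φ p.2) ^ 2 := by fun_prop
    exact this.measurable.ennreal_ofReal
  have hseg : ∀ x ∈ B, ∫⁻ y in B, g x y ≤ ENNReal.ofReal (R ^ 2) * (2 ^ d * I) := by
    intro x hx
    have h1 : ∀ y ∈ B, g x y ≤ ENNReal.ofReal (R ^ 2) *
        ∫⁻ s in Ioc (0 : ℝ) 1, e ((1 - s / 2) • y + (1 - (1 - s / 2)) • x) := by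
      intro y hy
      refine (sq_sub_le_lintegral_segment hφ y ((1 / 2 : ℝ) • (x - y))).trans ?_
      have h2 : ‖(1 / 2 : ℝ) • (x - y)‖ ≤ R := by
        rw [norm_smul, Real.norm_of_nonneg (by norm_num)]
        have := norm_sub_le x y
        have := mem_ball_zero_iff.1 hx
        have := mem_ball_zero_iff.1 hy
        linarith
      refine mul_le_mul' (ENNReal.ofReal_le_ofReal (pow_le_pow_left₀ (norm_nonneg _) h2 2))
        (lintegral_mono fun s => le_of_eq ?_)
      simp only [he]
      congr 4
      module
    refine (setLIntegral_mono' hBm h1).trans ?_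
    rw [lintegral_const_mul' _ _ ENNReal.ofReal_ne_top, lintegral_lintegral_swap]
    · gcongr
      calc ∫⁻ s in Ioc (0 : ℝ) 1, ∫⁻ y in B, e ((1 - s / 2) • y + (1 - (1 - s / 2)) • x)
          ≤ ∫⁻ s in Ioc (0 : ℝ) 1, 2 ^ d * I :=
            setLIntegral_mono' measurableSet_Ioc fun s hs =>
              lintegral_ball_comp_affine_le (by linarith [hs.2]) (by linarith [hs.1]) hx hem
        _ = 2 ^ d * I := by simp
    · refine Measurable.aemeasurable (hem.comp (Continuous.measurable ?_))
      fun_prop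
  have hsq : ∀ a b c : ℝ, ENNReal.ofReal ((a - b) ^ 2) ≤
      2 * ENNReal.ofReal ((c - b) ^ 2) + 2 * ENNReal.ofReal ((c - a) ^ 2) := by
    intro a b c
    rw [← ENNReal.ofReal_ofNat 2, ← ENNReal.ofReal_mul (by norm_num),
      ← ENNReal.ofReal_mul (by norm_num), ← ENNReal.ofReal_add (by positivity) (by positivity)]
    refine ENNReal.ofReal_le_ofReal ?_
    nlinarith [sq_nonneg (c - b + (c - a))]
  have hpair : ∀ x y, ENNReal.ofReal ((φ x - φ y) ^ 2) ≤ 2 * g x y + 2 * g y x := by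
    intro x y
    have h1 : x + (1 / 2 : ℝ) • (y - x) = y + (1 / 2 : ℝ) • (x - y) := by module
    simp only [hg]
    rw [h1]
    exact hsq _ _ _
  set F : Space d → ℝ≥0∞ := fun y => ∫⁻ x in B, ENNReal.ofReal ((φ x - φ y) ^ 2) with hF
  have hF2 : ∫⁻ y in B, F y ≤ ENNReal.ofReal (4 * R ^ 2) * 2 ^ d * I * volume B := by
    have h1 : ∫⁻ x in B, ∫⁻ y in B, g x y ≤ ENNReal.ofReal (R ^ 2) * (2 ^ d * I) * volume B := by
      refine (setLIntegral_mono' hBm hseg).trans ?_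
      rw [setLIntegral_const]
    have h2 : ∫⁻ y in B, ∫⁻ x in B, g x y = ∫⁻ x in B, ∫⁻ y in B, g x y :=
      lintegral_lintegral_swap (hgm.comp measurable_swap).aemeasurable
    calc ∫⁻ y in B, F y ≤ ∫⁻ y in B, ∫⁻ x in B, (2 * g x y + 2 * g y x) :=
          lintegral_mono fun y => lintegral_mono fun x => hpair x y
      _ = 2 * (∫⁻ y in B, ∫⁻ x in B, g x y) + 2 * ∫⁻ y in B, ∫⁻ x in B, g y x := by
          have h3 : ∀ y, ∫⁻ x in B, (2 * g x y + 2 * g y x) =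
              2 * (∫⁻ x in B, g x y) + 2 * ∫⁻ x in B, g y x := fun y => by
            rw [lintegral_add_left (hgm.of_uncurry_right.const_mul 2),
              lintegral_const_mul _ hgm.of_uncurry_right,
              lintegral_const_mul _ hgm.of_uncurry_left]
          have hA : Measurable fun y => ∫⁻ x in B, g x y :=
            (hgm.comp measurable_swap).lintegral_prod_right'
          have hB' : Measurable fun y => ∫⁻ x in B, g y x := hgm.lintegral_prod_right'
          simp only [h3]
          rw [lintegral_add_left (hA.const_mul 2), lintegral_const_mul _ hA,
            lintegral_const_mul _ hB']
      _ ≤ 2 * (ENNReal.ofReal (R ^ 2) * (2 ^ d * I) * volume B) +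
          2 * (ENNReal.ofReal (R ^ 2) * (2 ^ d * I) * volume B) := by
          rw [h2]
          gcongr
      _ = _ := by
          rw [show (4 : ℝ) * R ^ 2 = 4 * (R ^ 2) from rfl, ENNReal.ofReal_mul (by norm_num),
            show ENNReal.ofReal 4 = 2 + 2 by norm_num]
          ring
  by_cases hItop : I = ∞
  · refine ⟨0, ?_⟩
    rw [hItop, ENNReal.mul_top]
    · exact le_top
    · exact mul_ne_zero (ENNReal.ofReal_pos.2 (by positivity)).ne' (by positivity)
  have hFm : Measurable F := by
    refine Measurable.lintegral_prod_right
      (f := fun y x => ENNReal.ofReal ((φ x - φ y) ^ 2)) ?_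
    have : Continuous fun p : Space d × Space d => (φ p.2 - φ p.1) ^ 2 := by fun_prop
    exact this.measurable.ennreal_ofReal
  -- Some `y` does no worse than the average of `F`, so `φ y` can serve as the centring constant in
  -- place of the mean of `φ`.
  obtain ⟨y, -, hy⟩ := exists_le_setLAverage hB0 hBt hFm.aemeasurable
  refine ⟨φ y, hy.trans ?_⟩
  rw [setLAverage_eq]
  exact ENNReal.div_le_of_le_mul hF2

/-- The Euler identity `∫ ∇G · x = -d ∫ G`. -/
theorem integral_fderiv_apply_self {G : Space d → ℝ} (hG : IsTest G) :
    ∫ x, fderiv ℝ G x x = -(d * ∫ x, G x) := by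
  have hGd := hG.1.differentiable one_ne_zero
  have hGi : Integrable G := hG.continuous.integrable_of_hasCompactSupport hG.2
  have hci : ∀ i : Fin d, ∫ x, x i * fderiv ℝ G x (EuclideanSpace.single i 1) = -∫ x, G x := by
    intro i
    have hp : ∀ x : Space d, HasFDerivAt (fun x : Space d => x i)
        (EuclideanSpace.proj i : Space d →L[ℝ] ℝ) x := fun x =>
      (EuclideanSpace.proj i : Space d →L[ℝ] ℝ).hasFDerivAt
    have hone : ∀ x, fderiv ℝ (fun x : Space d => x i) x (EuclideanSpace.single i 1) = 1 := by
      intro x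
      rw [(hp x).fderiv]
      simp
    have hDc : Continuous fun x => fderiv ℝ G x (EuclideanSpace.single i 1) :=
      hG.continuous_fderiv.clm_apply continuous_const
    have hxc : Continuous fun x : Space d => x i := by fun_prop
    have hDs : HasCompactSupport fun x => fderiv ℝ G x (EuclideanSpace.single i 1) :=
      hG.2.fderiv_apply ℝ _
    have key := integral_mul_fderiv_eq_neg_fderiv_mul_of_integrable (μ := volume)
      (f := fun x : Space d => x i) (g := G) (v := EuclideanSpace.single i 1)
      (by simpa only [hone, one_mul] using hGi)
      ((hxc.mul hDc).integrable_of_hasCompactSupport hDs.mul_left)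
      ((hxc.mul hG.continuous).integrable_of_hasCompactSupport hG.2.mul_left)
      (fun x _ => (hp x).differentiableAt) (fun x _ => hGd x)
    rw [key]
    simp only [hone, one_mul]
  have hsum : ∀ x, fderiv ℝ G x x =
      ∑ i : Fin d, x i * fderiv ℝ G x (EuclideanSpace.single i 1) := by
    intro x
    have hx : x = ∑ i : Fin d, x i • EuclideanSpace.single i (1 : ℝ) := by
      have := (EuclideanSpace.basisFun (Fin d) ℝ).sum_repr x
      simpa using this.symm
    refine (congrArg (fderiv ℝ G x) hx).trans ?_
    rw [map_sum]
    simp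
  simp only [hsum]
  rw [integral_finsetSum]
  · simp only [hci]
    simp
  · intro i _
    refine Continuous.integrable_of_hasCompactSupport ?_ ?_
    · exact (by fun_prop : Continuous fun x : Space d => x i).mul
        (hG.continuous_fderiv.clm_apply continuous_const)
    · exact (hG.2.fderiv_apply ℝ _).mul_left

/-- The weight `1 / √(1 + |x|²)`. -/
noncomputable def invJapanese (x : Space d) : ℝ := (√(1 + ‖x‖ ^ 2))⁻¹

theorem contDiff_invJapanese : ContDiff ℝ 1 (invJapanese (d := d)) := by
  refine ContDiff.inv (ContDiff.sqrt (contDiff_const.add (contDiff_norm_sq ℝ)) fun x => ?_)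
    fun x => ?_
  · positivity
  · positivity

theorem invJapanese_pos (x : Space d) : 0 < invJapanese x := by
  unfold invJapanese
  positivity

theorem invJapanese_le_one (x : Space d) : invJapanese x ≤ 1 := by
  refine inv_le_one_of_one_le₀ (Real.one_le_sqrt.2 ?_)
  linarith [sq_nonneg ‖x‖]

theorem invJapanese_mul_norm_le_one (x : Space d) : invJapanese x * ‖x‖ ≤ 1 := by
  refine inv_mul_le_one_of_le₀ (Real.le_sqrt_of_sq_le ?_) (Real.sqrt_nonneg _)
  linarith

theorem half_le_invJapanese_mul_norm {x : Space d} (hx : 1 ≤ ‖x‖) :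
    1 / 2 ≤ invJapanese x * ‖x‖ := by
  rw [invJapanese, inv_mul_eq_div, le_div_iff₀ (by positivity)]
  have : √(1 + ‖x‖ ^ 2) ≤ 2 * ‖x‖ := Real.sqrt_le_iff.2 ⟨by positivity, by nlinarith⟩
  linarith

/-- The weight decreases along rays: differentiate `s ↦ invJapanese (s • x)` at `s = 1`. This gives
one term of the Lyapunov estimate a favourable sign. -/
theorem fderiv_invJapanese_apply_self_nonpos (x : Space d) : fderiv ℝ invJapanese x x ≤ 0 := by
  have h1 : HasDerivAt (fun s : ℝ => s • x) x 1 := by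
    simpa using (hasDerivAt_id (1 : ℝ)).smul_const x
  have h2 : HasDerivAt (fun s : ℝ => invJapanese (s • x)) (fderiv ℝ invJapanese x x) 1 := by
    have h3 := (contDiff_invJapanese.differentiable one_ne_zero x).hasFDerivAt
    rw [← one_smul ℝ x] at h3
    have := h3.comp_hasDerivAt (1 : ℝ) h1
    rwa [one_smul] at this
  have h4 : HasDerivAt (fun s : ℝ => 1 + s ^ 2 * ‖x‖ ^ 2) (2 * ‖x‖ ^ 2) 1 := by
    simpa using ((hasDerivAt_pow 2 (1 : ℝ)).mul_const (‖x‖ ^ 2)).const_add 1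
  have h5 := (h4.sqrt (by positivity)).inv (by positivity)
  have h6 : (fun s : ℝ => invJapanese (s • x)) = (fun s : ℝ => √(1 + s ^ 2 * ‖x‖ ^ 2))⁻¹ := by
    ext s
    simp [invJapanese, norm_smul, mul_pow]
  rw [h6] at h2
  rw [h2.unique h5]
  exact div_nonpos_of_nonpos_of_nonneg (neg_nonpos.2 (by positivity)) (by positivity)

end MeanFieldControl

/-! ### Lyapunov estimate and Poincaré inequality for `e^{-U}` -/

namespace MeanFieldControl

variable {d : ℕ}

/-- Lyapunov estimate: a compactly supported function is controlled in `L²(e^{-U})` by its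
gradient and its values on a ball outside of which `U` grows radially. -/
theorem lyapunov_estimate {R K : ℝ} {U ψ : Space d → ℝ} (hU : ContDiff ℝ 1 U)
    (hout : ∀ x, R ≤ ‖x‖ → d + 1 ≤ invJapanese x * fderiv ℝ U x x)
    (hin : ∀ x, ‖x‖ < R → -K ≤ invJapanese x * fderiv ℝ U x x) (hψ : IsTest ψ) :
    ∫ x, ψ x ^ 2 * Real.exp (-U x) ≤
      2 * (K + d + 1) * (∫ x in Metric.ball 0 R, ψ x ^ 2 * Real.exp (-U x)) +
        4 * ∫ x, ‖fderiv ℝ ψ x‖ ^ 2 * Real.exp (-U x) := by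
  set σ : Space d → ℝ := fun x => Real.exp (-U x) with hσ
  set θ : Space d → ℝ := invJapanese with hθ
  have hσ0 : ∀ x, 0 < σ x := fun x => Real.exp_pos _
  have hσ1 : ContDiff ℝ 1 σ := hU.neg.exp
  have hσc := hσ1.continuous
  have hψc := hψ.continuous
  have hDψc := hψ.continuous_fderiv
  have hDUc := hU.continuous_fderiv one_ne_zero
  have hDθc := contDiff_invJapanese (d := d).continuous_fderiv one_ne_zero
  have hθc := contDiff_invJapanese (d := d).continuous
  have hψ2s : HasCompactSupport fun x => ψ x ^ 2 := by
    simp only [pow_two]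
    exact hψ.2.mul_left
  have hDψ2s : HasCompactSupport fun x => ‖fderiv ℝ ψ x‖ ^ 2 := by
    have h1 : HasCompactSupport fun x => ‖fderiv ℝ ψ x‖ := (hψ.2.fderiv (𝕜 := ℝ)).norm
    simp only [pow_two]
    exact h1.mul_left
  have hi1 : Integrable fun x => ψ x ^ 2 * σ x :=
    ((hψc.pow 2).mul hσc).integrable_of_hasCompactSupport hψ2s.mul_right
  have hi2 : Integrable fun x => ‖fderiv ℝ ψ x‖ ^ 2 * σ x :=
    ((hDψc.norm.pow 2).mul hσc).integrable_of_hasCompactSupport hDψ2s.mul_right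
  have hBc : Continuous fun x => θ x * fderiv ℝ U x x := hθc.mul (hDUc.clm_apply continuous_id)
  have hi3 : Integrable fun x => ψ x ^ 2 * (σ x * (θ x * fderiv ℝ U x x)) :=
    ((hψc.pow 2).mul (hσc.mul hBc)).integrable_of_hasCompactSupport hψ2s.mul_right
  have hi4 : Integrable fun x => ψ x ^ 2 * (θ x * σ x) :=
    ((hψc.pow 2).mul (hθc.mul hσc)).integrable_of_hasCompactSupport hψ2s.mul_right
  have hG : IsTest fun x => ψ x ^ 2 * (θ x * σ x) :=
    ⟨(hψ.1.pow 2).mul (contDiff_invJapanese.mul hσ1), hψ2s.mul_right⟩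
  have hDG : ∀ x, fderiv ℝ (fun x => ψ x ^ 2 * (θ x * σ x)) x x =
      2 * ψ x * fderiv ℝ ψ x x * (θ x * σ x) + ψ x ^ 2 * (fderiv ℝ θ x x * σ x) -
        ψ x ^ 2 * (σ x * (θ x * fderiv ℝ U x x)) := by
    intro x
    have h1 := (hψ.1.differentiable one_ne_zero x).hasFDerivAt
    have h2 := ((contDiff_invJapanese (d := d)).differentiable one_ne_zero x).hasFDerivAt
    have h3 := ((hU.differentiable one_ne_zero x).hasFDerivAt).neg.exp
    have h4 := (h1.pow 2).mul (h2.mul h3)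
    have h5 : fderiv ℝ (fun x => ψ x ^ 2 * (θ x * σ x)) x = _ := h4.fderiv
    rw [h5]
    simp [hθ, hσ]
    ring
  have hDGi : Integrable fun x => fderiv ℝ (fun x => ψ x ^ 2 * (θ x * σ x)) x x :=
    (hG.continuous_fderiv.clm_apply continuous_id).integrable_of_hasCompactSupport
      ((hG.2.fderiv (𝕜 := ℝ)).mono' fun x hx => subset_tsupport _ fun h0 => hx (by
        change fderiv ℝ (fun x => ψ x ^ 2 * (θ x * σ x)) x x = 0
        rw [h0, zero_apply]))
  have hE := integral_fderiv_apply_self hG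
  -- Euler's identity for `ψ² θ σ` trades the radial derivative of `U` for derivatives of `ψ` and
  -- `θ`. The `θ` term is nonpositive, `θ ‖x‖ ≤ 1`, and Young's inequality puts only the fraction
  -- `1/2` on `ψ²`.
  have hupper : ∫ x, ψ x ^ 2 * (σ x * (θ x * fderiv ℝ U x x)) ≤
      (1 / 2 + d) * (∫ x, ψ x ^ 2 * σ x) + 2 * ∫ x, ‖fderiv ℝ ψ x‖ ^ 2 * σ x := by
    have h1 : ∫ x, (ψ x ^ 2 * (σ x * (θ x * fderiv ℝ U x x)) +
        fderiv ℝ (fun x => ψ x ^ 2 * (θ x * σ x)) x x + d * (ψ x ^ 2 * (θ x * σ x))) ≤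
        ∫ x, ((1 / 2 + d) * (ψ x ^ 2 * σ x) + 2 * (‖fderiv ℝ ψ x‖ ^ 2 * σ x)) := by
      refine integral_mono ((hi3.add hDGi).add (hi4.const_mul _))
        ((hi1.const_mul _).add (hi2.const_mul _)) fun x => ?_
      dsimp only
      rw [hDG]
      have hθ0 := invJapanese_pos x
      have ha : fderiv ℝ ψ x x * θ x ≤ ‖fderiv ℝ ψ x‖ := by
        calc fderiv ℝ ψ x x * θ x ≤ ‖fderiv ℝ ψ x‖ * ‖x‖ * θ x := by
              gcongr
              exact (le_abs_self _).trans ((fderiv ℝ ψ x).le_opNorm x)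
          _ = ‖fderiv ℝ ψ x‖ * (θ x * ‖x‖) := by ring
          _ ≤ ‖fderiv ℝ ψ x‖ * 1 := by
              gcongr
              exact invJapanese_mul_norm_le_one x
          _ = _ := mul_one _
      have hb : -(fderiv ℝ ψ x x * θ x) ≤ ‖fderiv ℝ ψ x‖ := by
        calc -(fderiv ℝ ψ x x * θ x) = -(fderiv ℝ ψ x x) * θ x := by ring
          _ ≤ ‖fderiv ℝ ψ x‖ * ‖x‖ * θ x := by
              gcongr
              exact (neg_le_abs _).trans ((fderiv ℝ ψ x).le_opNorm x)
          _ = ‖fderiv ℝ ψ x‖ * (θ x * ‖x‖) := by ring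
          _ ≤ ‖fderiv ℝ ψ x‖ * 1 := by
              gcongr
              exact invJapanese_mul_norm_le_one x
          _ = _ := mul_one _
      have hsq : (fderiv ℝ ψ x x * θ x) ^ 2 ≤ ‖fderiv ℝ ψ x‖ ^ 2 :=
        sq_le_sq' (by linarith) ha
      have hc : 2 * ψ x * (fderiv ℝ ψ x x * θ x) ≤ ψ x ^ 2 / 2 + 2 * ‖fderiv ℝ ψ x‖ ^ 2 := by
        nlinarith [sq_nonneg (ψ x - 2 * (fderiv ℝ ψ x x * θ x))]
      have he := mul_le_mul_of_nonneg_right hc (hσ0 x).le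
      have hf : ψ x ^ 2 * (fderiv ℝ θ x x * σ x) ≤ 0 :=
        mul_nonpos_of_nonneg_of_nonpos (sq_nonneg _)
          (mul_nonpos_of_nonpos_of_nonneg (fderiv_invJapanese_apply_self_nonpos x) (hσ0 x).le)
      have hg : (d : ℝ) * (ψ x ^ 2 * (θ x * σ x)) ≤ d * (ψ x ^ 2 * σ x) := by
        gcongr
        exact mul_le_of_le_one_left (hσ0 x).le (invJapanese_le_one x)
      nlinarith
    have h34 : Integrable fun x => ψ x ^ 2 * (σ x * (θ x * fderiv ℝ U x x)) +
        fderiv ℝ (fun x => ψ x ^ 2 * (θ x * σ x)) x x := hi3.add hDGi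
    rw [integral_add h34 (hi4.const_mul _), integral_add hi3 hDGi, hE, integral_const_mul,
      integral_add (hi1.const_mul _) (hi2.const_mul _), integral_const_mul,
      integral_const_mul] at h1
    linarith
  -- The threshold `d + 1` exceeds the coefficient `1/2 + d` of the upper bound by `1/2`; absorbing
  -- and doubling gives the stated constants.
  have hlower : (d + 1) * (∫ x, ψ x ^ 2 * σ x) -
      (K + d + 1) * (∫ x in Metric.ball 0 R, ψ x ^ 2 * σ x) ≤
      ∫ x, ψ x ^ 2 * (σ x * (θ x * fderiv ℝ U x x)) := by
    rw [← integral_indicator measurableSet_ball, ← integral_const_mul, ← integral_const_mul,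
      ← integral_sub (hi1.const_mul _) ((hi1.indicator measurableSet_ball).const_mul _)]
    refine integral_mono ((hi1.const_mul _).sub ((hi1.indicator measurableSet_ball).const_mul _))
      hi3 fun x => ?_
    dsimp only
    have h0 : 0 ≤ ψ x ^ 2 * σ x := mul_nonneg (sq_nonneg _) (hσ0 x).le
    by_cases hx : ‖x‖ < R
    · rw [indicator_of_mem (mem_ball_zero_iff.2 hx)]
      have := mul_le_mul_of_nonneg_left (hin x hx) h0
      linarith
    · rw [indicator_of_notMem (fun h => hx (mem_ball_zero_iff.1 h))]
      have := mul_le_mul_of_nonneg_left (hout x (not_lt.1 hx)) h0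
      linarith
  linarith

/-- The Lyapunov estimate for test functions shifted by a constant. -/
theorem lyapunov_estimate_sub_const {R K : ℝ} {U φ : Space d → ℝ} (hU : ContDiff ℝ 1 U)
    (hUi : Integrable fun x => Real.exp (-U x))
    (hout : ∀ x, R ≤ ‖x‖ → d + 1 ≤ invJapanese x * fderiv ℝ U x x)
    (hin : ∀ x, ‖x‖ < R → -K ≤ invJapanese x * fderiv ℝ U x x) (hφ : IsTest φ) (c : ℝ) :
    ∫ x, (φ x - c) ^ 2 * Real.exp (-U x) ≤
      2 * (K + d + 1) * (∫ x in Metric.ball 0 R, (φ x - c) ^ 2 * Real.exp (-U x)) +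
        4 * ∫ x, ‖fderiv ℝ φ x‖ ^ 2 * Real.exp (-U x) := by
  obtain ⟨χ, C, hC0, hχ, hχ01, hχ1, hDχ⟩ := exists_cutoff d
  obtain ⟨A, hA0, hA⟩ := hφ.bound
  obtain ⟨D, hD0, hD⟩ := hφ.bound_fderiv
  set ψ : ℕ → Space d → ℝ := fun n x => (φ x - c) * χ n x with hψdef
  have hσc : Continuous fun x => Real.exp (-U x) := hU.continuous.neg.rexp
  have hψ : ∀ n, IsTest (ψ n) := fun n => (hχ n).mul_left (hφ.1.sub contDiff_const)
  have hb : ∀ x, |φ x - c| ≤ A + |c| := fun x =>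
    (abs_sub _ _).trans (add_le_add (hA x) le_rfl)
  have hψb : ∀ n x, |ψ n x| ≤ A + |c| := fun n x => by
    rw [hψdef, abs_mul, abs_of_nonneg (hχ01 n x).1]
    exact (mul_le_of_le_one_right (abs_nonneg _) (hχ01 n x).2).trans (hb x)
  have hev : ∀ x, ∀ᶠ n in atTop, χ n x = 1 := fun x => by
    filter_upwards [eventually_ge_atTop ⌈‖x‖⌉₊] with n hn
    exact hχ1 n x ((Nat.ceil_le.1 hn).trans (by linarith))
  have hψl : ∀ x, Tendsto (fun n => ψ n x) atTop (𝓝 (φ x - c)) := fun x =>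
    tendsto_const_nhds.congr' ((hev x).mono fun n hn => by rw [hψdef]; simp [hn])
  have hDψ : ∀ n x, fderiv ℝ (ψ n) x = (φ x - c) • fderiv ℝ (χ n) x + χ n x • fderiv ℝ φ x :=
    fun n x => (((hφ.1.differentiable one_ne_zero x).hasFDerivAt.sub_const c).mul
      ((hχ n).1.differentiable one_ne_zero x).hasFDerivAt).fderiv
  have hlimC : Tendsto (fun n : ℕ => C / ((n : ℝ) + 1)) atTop (𝓝 0) := by
    simpa [div_eq_mul_inv] using
      (tendsto_one_div_add_atTop_nhds_zero_nat (𝕜 := ℝ)).const_mul C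
  have hDχl : ∀ x, Tendsto (fun n => fderiv ℝ (χ n) x) atTop (𝓝 0) := fun x =>
    squeeze_zero_norm (fun n => hDχ n x) hlimC
  have hχl : ∀ x, Tendsto (fun n => χ n x) atTop (𝓝 1) := fun x =>
    tendsto_const_nhds.congr' ((hev x).mono fun n hn => hn.symm)
  have hDψl : ∀ x, Tendsto (fun n => fderiv ℝ (ψ n) x) atTop (𝓝 (fderiv ℝ φ x)) := fun x => by
    simp only [hDψ]
    simpa using ((hDχl x).const_smul (φ x - c)).add ((hχl x).smul_const (fderiv ℝ φ x))
  have hDψb : ∀ n x, ‖fderiv ℝ (ψ n) x‖ ≤ (A + |c|) * C + D := fun n x => by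
    rw [hDψ]
    refine (norm_add_le _ _).trans (add_le_add ?_ ?_)
    · rw [norm_smul]
      refine mul_le_mul (hb x) ((hDχ n x).trans ?_) (norm_nonneg _) (by positivity)
      exact div_le_self hC0 (by linarith [(Nat.cast_nonneg n : (0 : ℝ) ≤ n)])
    · rw [norm_smul, Real.norm_of_nonneg (hχ01 n x).1]
      exact (mul_le_of_le_one_left (norm_nonneg _) (hχ01 n x).2).trans (hD x)
  have hl1 : ∀ S : Set (Space d), Tendsto (fun n => ∫ x in S, ψ n x ^ 2 * Real.exp (-U x)) atTop
      (𝓝 (∫ x in S, (φ x - c) ^ 2 * Real.exp (-U x))) := fun S => by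
    refine tendsto_integral_of_dominated_convergence (fun x => (A + |c|) ^ 2 * Real.exp (-U x))
      (fun n => (((hψ n).continuous.pow 2).mul hσc).aestronglyMeasurable)
      (hUi.const_mul _).integrableOn (fun n => Eventually.of_forall fun x => ?_)
      (Eventually.of_forall fun x => ((hψl x).pow 2).mul_const _)
    rw [norm_mul, Real.norm_of_nonneg (Real.exp_pos _).le, norm_pow]
    gcongr
    exact hψb n x
  have hl2 : Tendsto (fun n => ∫ x, ‖fderiv ℝ (ψ n) x‖ ^ 2 * Real.exp (-U x)) atTop
      (𝓝 (∫ x, ‖fderiv ℝ φ x‖ ^ 2 * Real.exp (-U x))) := by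
    refine tendsto_integral_of_dominated_convergence
      (fun x => ((A + |c|) * C + D) ^ 2 * Real.exp (-U x))
      (fun n => (((hψ n).continuous_fderiv.norm.pow 2).mul hσc).aestronglyMeasurable)
      (hUi.const_mul _) (fun n => Eventually.of_forall fun x => ?_)
      (Eventually.of_forall fun x => ((hDψl x).norm.pow 2).mul_const _)
    rw [norm_mul, Real.norm_of_nonneg (Real.exp_pos _).le, norm_pow, norm_norm]
    gcongr
    exact hDψb n x
  have hl0 := hl1 univ
  simp only [setIntegral_univ] at hl0
  exact le_of_tendsto_of_tendsto' hl0
    (((hl1 (Metric.ball 0 R)).const_mul _).add (hl2.const_mul 4))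
    fun n => lyapunov_estimate hU hout hin (hψ n)

/-- Poincaré inequality for `e^{-U}`, with a constant depending only on the bounds. -/
theorem exists_poincare_const {R K a b : ℝ} (hR : 0 < R) (hK : 0 ≤ K) : ∃ κ, 0 < κ ∧
    ∀ U : Space d → ℝ, ContDiff ℝ 1 U → (Integrable fun x => Real.exp (-U x)) →
    (∀ x, R ≤ ‖x‖ → d + 1 ≤ invJapanese x * fderiv ℝ U x x) →
    (∀ x, ‖x‖ < R → -K ≤ invJapanese x * fderiv ℝ U x x) →
    (∀ x, ‖x‖ < R → a ≤ U x ∧ U x ≤ b) → ∀ φ, IsTest φ →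
    ∃ c, ∫ x, (φ x - c) ^ 2 * Real.exp (-U x) ≤
      κ * ∫ x, ‖fderiv ℝ φ x‖ ^ 2 * Real.exp (-U x) := by
  set C₀ : ℝ := 4 * R ^ 2 * 2 ^ d with hC₀
  have hC₀p : 0 < C₀ := by positivity
  have hKd : 0 < K + d + 1 := by positivity
  -- The Lyapunov estimate leaves only the ball, where the weight lies between `e^{-b}` and `e^{-a}`
  -- and the unweighted Poincaré constant `C₀` applies.
  refine ⟨2 * (K + d + 1) * (Real.exp (-a) * C₀ * Real.exp b) + 4, by positivity,
    fun U hU hUi hout hin hab φ hφ => ?_⟩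
  obtain ⟨c, hc⟩ := exists_poincare_ball hR hφ.1
  refine ⟨c, (lyapunov_estimate_sub_const hU hUi hout hin hφ c).trans ?_⟩
  set B := Metric.ball (0 : Space d) R with hB
  have hBm : MeasurableSet B := measurableSet_ball
  have hBK : B ⊆ Metric.closedBall 0 R := Metric.ball_subset_closedBall
  have hσc : Continuous fun x => Real.exp (-U x) := hU.continuous.neg.rexp
  have hci : ∀ {f : Space d → ℝ}, Continuous f → IntegrableOn f B := fun hf =>
    (hf.continuousOn.integrableOn_compact (isCompact_closedBall _ _)).mono_set hBK
  have hφc : Continuous fun x => (φ x - c) ^ 2 := (hφ.continuous.sub continuous_const).pow 2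
  have hDc : Continuous fun x => ‖fderiv ℝ φ x‖ ^ 2 := hφ.continuous_fderiv.norm.pow 2
  have hball : ∫ x in B, (φ x - c) ^ 2 ≤ C₀ * ∫ x in B, ‖fderiv ℝ φ x‖ ^ 2 := by
    rw [← ofReal_integral_eq_lintegral_ofReal (hci hφc) (Eventually.of_forall fun x => sq_nonneg _),
      ← ofReal_integral_eq_lintegral_ofReal (hci hDc) (Eventually.of_forall fun x => sq_nonneg _),
      show (2 : ℝ≥0∞) ^ d = ENNReal.ofReal (2 ^ d) by
        rw [ENNReal.ofReal_pow (by norm_num), ENNReal.ofReal_ofNat],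
      ← ENNReal.ofReal_mul (by positivity), ← ENNReal.ofReal_mul (by positivity)] at hc
    exact (ENNReal.ofReal_le_ofReal_iff (mul_nonneg hC₀p.le
      (integral_nonneg fun x => sq_nonneg _))).1 hc
  obtain ⟨D, hD0, hD⟩ := hφ.bound_fderiv
  have hDi : Integrable fun x => ‖fderiv ℝ φ x‖ ^ 2 * Real.exp (-U x) :=
    hUi.bdd_mul (c := D ^ 2) hDc.aestronglyMeasurable (Eventually.of_forall fun x => by
      rw [norm_pow, norm_norm]
      exact pow_le_pow_left₀ (norm_nonneg _) (hD x) 2)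
  have h1 : ∫ x in B, (φ x - c) ^ 2 * Real.exp (-U x) ≤
      Real.exp (-a) * ∫ x in B, (φ x - c) ^ 2 := by
    rw [← integral_const_mul]
    refine setIntegral_mono_on (hci (hφc.mul hσc)) (hci (continuous_const.mul hφc)) hBm
      fun x hx => ?_
    rw [mul_comm]
    have := (hab x (mem_ball_zero_iff.1 hx)).1
    gcongr
  have h2 : ∫ x in B, ‖fderiv ℝ φ x‖ ^ 2 ≤
      Real.exp b * ∫ x, ‖fderiv ℝ φ x‖ ^ 2 * Real.exp (-U x) := by
    calc ∫ x in B, ‖fderiv ℝ φ x‖ ^ 2 ≤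
        ∫ x in B, Real.exp b * (‖fderiv ℝ φ x‖ ^ 2 * Real.exp (-U x)) := by
          refine setIntegral_mono_on (hci hDc) (hci (continuous_const.mul (hDc.mul hσc))) hBm
            fun x hx => ?_
          have h3 : 1 ≤ Real.exp b * Real.exp (-U x) := by
            rw [← Real.exp_add]
            exact Real.one_le_exp (by linarith [(hab x (mem_ball_zero_iff.1 hx)).2])
          nlinarith [sq_nonneg ‖fderiv ℝ φ x‖]
      _ = Real.exp b * ∫ x in B, ‖fderiv ℝ φ x‖ ^ 2 * Real.exp (-U x) := integral_const_mul _ _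
      _ ≤ _ := by
          exact mul_le_mul_of_nonneg_left (setIntegral_le_integral hDi
            (Eventually.of_forall fun x => by positivity)) (Real.exp_pos b).le
  have h4 : ∫ x in B, (φ x - c) ^ 2 * Real.exp (-U x) ≤ Real.exp (-a) * (C₀ * (Real.exp b *
      ∫ x, ‖fderiv ℝ φ x‖ ^ 2 * Real.exp (-U x))) :=
    h1.trans (by gcongr; exact hball.trans (by gcongr))
  have h5 := mul_le_mul_of_nonneg_left h4 (by positivity : 0 ≤ 2 * (K + d + 1))
  linarith

end MeanFieldControl

/-! ### Jointly measurable solution of the weak Poisson equations -/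

namespace MeanFieldControl

variable {d : ℕ}

theorem inner_gradient_left (φ : Space d → ℝ) (x v : Space d) :
    inner ℝ (gradient φ x) v = fderiv ℝ φ x v := by
  rw [gradient, InnerProductSpace.toDual_symm_apply]

theorem norm_gradient (φ : Space d → ℝ) (x : Space d) : ‖gradient φ x‖ = ‖fderiv ℝ φ x‖ := by
  rw [gradient, LinearIsometryEquiv.norm_map]

theorem gradient_add {φ ψ : Space d → ℝ} {x : Space d} (hφ : DifferentiableAt ℝ φ x)
    (hψ : DifferentiableAt ℝ ψ x) :
    gradient (fun y => φ y + ψ y) x = gradient φ x + gradient ψ x := by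
  refine ext_inner_right ℝ fun v => ?_
  simp only [inner_add_left, inner_gradient_left]
  exact congrArg (· v) (hφ.hasFDerivAt.add hψ.hasFDerivAt).fderiv

theorem gradient_const_mul {φ : Space d → ℝ} {x : Space d} (hφ : DifferentiableAt ℝ φ x) (c : ℝ) :
    gradient (fun y => c * φ y) x = c • gradient φ x := by
  refine ext_inner_right ℝ fun v => ?_
  rw [real_inner_smul_left, inner_gradient_left, inner_gradient_left,
    (hφ.hasFDerivAt.const_mul c).fderiv, smul_apply, smul_eq_mul]

/-- Space-time test functions: bounded, measurable, with test functions as sections. -/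
def spaceTimeTests (d : ℕ) : Submodule ℝ (ℝ → Space d → ℝ) where
  carrier := {Φ | (∀ t, IsTest (Φ t)) ∧ Measurable (Function.uncurry Φ) ∧
    Measurable (fun p : ℝ × Space d => gradient (Φ p.1) p.2) ∧
    ∃ C, ∀ t x, |Φ t x| ≤ C ∧ ‖gradient (Φ t) x‖ ≤ C}
  add_mem' := by
    rintro Φ Ψ ⟨h1, h2, h3, C, h4⟩ ⟨k1, k2, k3, D, k4⟩
    have hg : ∀ t x, gradient ((Φ + Ψ) t) x = gradient (Φ t) x + gradient (Ψ t) x := fun t x =>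
      gradient_add ((h1 t).1.differentiable one_ne_zero x) ((k1 t).1.differentiable one_ne_zero x)
    refine ⟨fun t => ⟨(h1 t).1.add (k1 t).1, (h1 t).2.add (k1 t).2⟩, h2.add k2, ?_, C + D,
      fun t x => ⟨?_, ?_⟩⟩
    · simp only [hg]
      exact h3.add k3
    · exact (abs_add_le _ _).trans (add_le_add (h4 t x).1 (k4 t x).1)
    · rw [hg]
      exact (norm_add_le _ _).trans (add_le_add (h4 t x).2 (k4 t x).2)
  zero_mem' := by
    have hg : ∀ t x, gradient ((0 : ℝ → Space d → ℝ) t) x = 0 := fun t x => by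
      rw [← norm_eq_zero, norm_gradient]
      simp
    refine ⟨fun t => ⟨contDiff_const, HasCompactSupport.zero⟩, measurable_const, ?_, 0,
      fun t x => ⟨by simp, (norm_le_zero_iff.2 (hg t x))⟩⟩
    simp only [hg]
    exact measurable_const
  smul_mem' := by
    rintro c Φ ⟨h1, h2, h3, C, h4⟩
    have hg : ∀ t x, gradient ((c • Φ) t) x = c • gradient (Φ t) x := fun t x =>
      gradient_const_mul ((h1 t).1.differentiable one_ne_zero x) c
    refine ⟨fun t => ⟨contDiff_const.mul (h1 t).1, HasCompactSupport.mul_left (h1 t).2⟩,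
      h2.const_mul c, ?_, |c| * C, fun t x => ⟨?_, ?_⟩⟩
    · simp only [hg]
      exact h3.const_smul c
    · change |c * Φ t x| ≤ _
      rw [abs_mul]
      exact mul_le_mul_of_nonneg_left (h4 t x).1 (abs_nonneg c)
    · rw [hg, norm_smul, Real.norm_eq_abs]
      exact mul_le_mul_of_nonneg_left (h4 t x).2 (abs_nonneg c)

/-- These products localize in time: they turn a space-time identity into one at almost every time.
-/
theorem indicator_mem_spaceTimeTests {S : Set ℝ} (hS : MeasurableSet S) {φ : Space d → ℝ}
    (hφ : IsTest φ) : (fun t x => S.indicator (fun _ => (1 : ℝ)) t * φ x) ∈ spaceTimeTests d ∧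
    ∀ t x, gradient (fun x => S.indicator (fun _ => (1 : ℝ)) t * φ x) x =
      S.indicator (fun _ => (1 : ℝ)) t • gradient φ x := by
  have hg : ∀ t x, gradient (fun x => S.indicator (fun _ => (1 : ℝ)) t * φ x) x =
      S.indicator (fun _ => (1 : ℝ)) t • gradient φ x := fun t x =>
    gradient_const_mul (hφ.1.differentiable one_ne_zero x) _
  have hind : Measurable fun t => S.indicator (fun _ => (1 : ℝ)) t :=
    measurable_const.indicator hS
  have hind1 : ∀ t, |S.indicator (fun _ => (1 : ℝ)) t| ≤ 1 := by
    intro t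
    by_cases ht : t ∈ S <;> simp [ht]
  have hgc : Continuous (gradient φ) :=
    (InnerProductSpace.toDual ℝ (Space d)).symm.continuous.comp hφ.continuous_fderiv
  obtain ⟨C, hC0, hC⟩ := hφ.bound
  obtain ⟨D, hD0, hD⟩ := hφ.bound_fderiv
  refine ⟨⟨fun t => ⟨contDiff_const.mul hφ.1, hφ.2.mul_left⟩,
    (hind.comp measurable_fst).mul (hφ.continuous.measurable.comp measurable_snd), ?_, max C D,
    fun t x => ⟨?_, ?_⟩⟩, hg⟩
  · simp only [hg]
    exact (hind.comp measurable_fst).smul (hgc.measurable.comp measurable_snd)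
  · rw [abs_mul]
    exact (mul_le_of_le_one_left (abs_nonneg _) (hind1 t)).trans ((hC x).trans (le_max_left _ _))
  · rw [hg, norm_smul, norm_gradient]
    exact (mul_le_of_le_one_left (norm_nonneg _) (hind1 t)).trans ((hD x).trans (le_max_right _ _))

/-- A Poincaré inequality bounds the action of a centered function on test functions. -/
theorem neg_integral_mul_le_of_poincare {ρ g φ : Space d → ℝ} (hρ : IsDensity ρ)
    (hgm : Measurable g) (hg2 : Integrable fun x => g x ^ 2 * ρ x) (hg0 : ∫ x, g x * ρ x = 0)
    (hφ : IsTest φ) {κ c : ℝ} (hκ : 0 < κ)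
    (hP : ∫ x, (φ x - c) ^ 2 * ρ x ≤ κ * ∫ x, ‖fderiv ℝ φ x‖ ^ 2 * ρ x) :
    -∫ x, φ x * (g x * ρ x) ≤
      κ / 2 * (∫ x, g x ^ 2 * ρ x) + (∫ x, ‖gradient φ x‖ ^ 2 * ρ x) / 2 := by
  simp only [norm_gradient]
  have hg1 : Integrable fun x => g x * ρ x :=
    integrable_mul_of_sq hρ.nonneg hρ.integrable (hgm.mul hρ.measurable).aestronglyMeasurable hg2
  obtain ⟨C, hC0, hC⟩ := hφ.bound
  have hφg : Integrable fun x => φ x * (g x * ρ x) :=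
    hg1.bdd_mul hφ.continuous.aestronglyMeasurable (Eventually.of_forall hC)
  have hφ2 : Integrable fun x => (φ x - c) ^ 2 * ρ x := by
    refine hρ.integrable_bdd_mul (C := (C + |c|) ^ 2)
      ((hφ.continuous.sub continuous_const).pow 2).aestronglyMeasurable fun x => ?_
    rw [abs_pow]
    exact pow_le_pow_left₀ (abs_nonneg _) ((abs_sub _ _).trans (add_le_add (hC x) le_rfl)) 2
  have h1 : ∫ x, φ x * (g x * ρ x) = ∫ x, (φ x - c) * (g x * ρ x) := by
    simp only [sub_mul]
    rw [integral_sub hφg (hg1.const_mul c), integral_const_mul, hg0, mul_zero, sub_zero]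
  have h2 : -∫ x, φ x * (g x * ρ x) ≤
      ∫ x, (κ / 2 * (g x ^ 2 * ρ x) + 1 / (2 * κ) * ((φ x - c) ^ 2 * ρ x)) := by
    rw [h1, ← integral_neg]
    refine integral_mono ?_ ((hg2.const_mul _).add (hφ2.const_mul _)) fun x => ?_
    · simp only [sub_mul]
      exact (hφg.sub (hg1.const_mul c)).neg
    · dsimp only
      have h3 : 0 ≤ (κ * g x + (φ x - c)) ^ 2 / (2 * κ) := by positivity
      have h4 : (κ * g x + (φ x - c)) ^ 2 / (2 * κ) =
          κ / 2 * g x ^ 2 + 1 / (2 * κ) * (φ x - c) ^ 2 + (φ x - c) * g x := by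
        field_simp
        ring
      rw [h4] at h3
      nlinarith [mul_nonneg h3 (hρ.nonneg x)]
  rw [integral_add (hg2.const_mul _) (hφ2.const_mul _), integral_const_mul, integral_const_mul]
    at h2
  have h5 : 1 / (2 * κ) * (∫ x, (φ x - c) ^ 2 * ρ x) ≤
      1 / (2 * κ) * (κ * ∫ x, ‖fderiv ℝ φ x‖ ^ 2 * ρ x) := by gcongr
  have h6 : 1 / (2 * κ) * (κ * ∫ x, ‖fderiv ℝ φ x‖ ^ 2 * ρ x) =
      (∫ x, ‖fderiv ℝ φ x‖ ^ 2 * ρ x) / 2 := by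
    field_simp
  linarith

theorem integrable_uncurry_density {ν : Measure ℝ} [IsFiniteMeasure ν] {ρ : ℝ → Space d → ℝ}
    (hρm : Measurable (Function.uncurry ρ)) (hρ : ∀ t, IsDensity (ρ t)) :
    Integrable (Function.uncurry ρ) (ν.prod volume) := by
  rw [integrable_prod_iff hρm.aestronglyMeasurable]
  refine ⟨Eventually.of_forall fun t => (hρ t).integrable, ?_⟩
  have : (fun t => ∫ x, ‖Function.uncurry ρ (t, x)‖) = fun _ => (1 : ℝ) := by
    ext t
    rw [← (hρ t).integral_eq_one]
    exact integral_congr_ae (Eventually.of_forall fun x => Real.norm_of_nonneg ((hρ t).nonneg x))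
  rw [this]
  exact integrable_const _

/-- A uniform Poincaré inequality along a path of densities yields a jointly measurable solution
of the weak Poisson equations at almost every time. -/
theorem exists_control_of_poincare {ρ g : ℝ → Space d → ℝ} (hρm : Measurable (Function.uncurry ρ))
    (hρ : ∀ t, IsDensity (ρ t)) (hgm : Measurable (Function.uncurry g)) {T : ℝ}
    (hg2 : Integrable (fun p : ℝ × Space d => g p.1 p.2 ^ 2 * ρ p.1 p.2)
      ((volume.restrict (Ioc 0 T)).prod volume))
    (hg0 : ∀ t, ∫ x, g t x * ρ t x = 0) {κ : ℝ} (hκ : 0 < κ)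
    (hP : ∀ t ∈ Ioc 0 T, ∀ φ, IsTest φ → ∃ c, ∫ x, (φ x - c) ^ 2 * ρ t x ≤
      κ * ∫ x, ‖fderiv ℝ φ x‖ ^ 2 * ρ t x) :
    ∃ u : ℝ → Space d → Space d, Measurable (Function.uncurry u) ∧
      ∀ᵐ t ∂(volume.restrict (Ioc 0 T)), (Integrable fun x => ‖u t x‖ ^ 2 * ρ t x) ∧
        IsWeakDiv (ρ t) (u t) (g t) := by
  set P : Measure (ℝ × Space d) := (volume.restrict (Ioc 0 T)).prod volume with hPdef
  have hρ0 : ∀ p, 0 ≤ Function.uncurry ρ p := fun p => (hρ p.1).nonneg p.2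
  have hρi : Integrable (Function.uncurry ρ) P := integrable_uncurry_density hρm hρ
  have hgρ : Integrable (fun p : ℝ × Space d => g p.1 p.2 * ρ p.1 p.2) P :=
    integrable_mul_of_sq (ρ := Function.uncurry ρ) (f := Function.uncurry g) hρ0 hρi
      (hgm.mul hρm).aestronglyMeasurable hg2
  set μ := densMeasure P (Function.uncurry ρ) with hμ
  have hfin : IsFiniteMeasure μ := isFiniteMeasure_densMeasure hρ0 hρi
  have hmem : ∀ Φ : spaceTimeTests d,
      MemLp (fun p : ℝ × Space d => gradient (Φ.1 p.1) p.2) 2 μ := fun Φ => by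
    obtain ⟨-, -, h3, C, h4⟩ := Φ.2
    exact MemLp.of_bound h3.aestronglyMeasurable C (Eventually.of_forall fun p => (h4 p.1 p.2).2)
  have hgadd : ∀ (Φ Ψ : spaceTimeTests d) t x,
      gradient ((Φ + Ψ).1 t) x = gradient (Φ.1 t) x + gradient (Ψ.1 t) x := fun Φ Ψ t x =>
    gradient_add ((Φ.2.1 t).1.differentiable one_ne_zero x)
      ((Ψ.2.1 t).1.differentiable one_ne_zero x)
  have hgsmul : ∀ (c : ℝ) (Φ : spaceTimeTests d) t x,
      gradient ((c • Φ).1 t) x = c • gradient (Φ.1 t) x := fun c Φ t x =>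
    gradient_const_mul ((Φ.2.1 t).1.differentiable one_ne_zero x) c
  let A : spaceTimeTests d →ₗ[ℝ] Lp (Space d) 2 μ :=
    { toFun := fun Φ => (hmem Φ).toLp _
      map_add' := fun Φ Ψ => by
        rw [← MemLp.toLp_add]
        exact MemLp.toLp_congr _ _ (Eventually.of_forall fun p => hgadd Φ Ψ p.1 p.2)
      map_smul' := fun c Φ => by
        rw [RingHom.id_apply, ← MemLp.toLp_const_smul]
        exact MemLp.toLp_congr _ _ (Eventually.of_forall fun p => hgsmul c Φ p.1 p.2) }
  have hΦi : ∀ Φ : spaceTimeTests d,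
      Integrable (fun p : ℝ × Space d => Φ.1 p.1 p.2 * (g p.1 p.2 * ρ p.1 p.2)) P := fun Φ => by
    obtain ⟨-, h2, -, C, h4⟩ := Φ.2
    exact hgρ.bdd_mul (c := C) h2.aestronglyMeasurable
      (Eventually.of_forall fun p => (h4 p.1 p.2).1)
  let ℓ : spaceTimeTests d →ₗ[ℝ] ℝ :=
    { toFun := fun Φ => -∫ p, Φ.1 p.1 p.2 * (g p.1 p.2 * ρ p.1 p.2) ∂P
      map_add' := fun Φ Ψ => by
        rw [← neg_add, ← integral_add (hΦi Φ) (hΦi Ψ)]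
        congr 2
        ext p
        exact add_mul _ _ _
      map_smul' := fun c Φ => by
        rw [RingHom.id_apply, smul_eq_mul, mul_neg, ← integral_const_mul]
        congr 2
        ext p
        exact mul_assoc _ _ _ }
  have hcoe : ∀ Φ : spaceTimeTests d,
      A Φ =ᵐ[μ] fun p : ℝ × Space d => gradient (Φ.1 p.1) p.2 := fun Φ => (hmem Φ).coeFn_toLp
  have hnorm : ∀ v : Lp (Space d) 2 μ, ‖v‖ ^ 2 = ∫ p, ‖v p‖ ^ 2 ∂μ := fun v => by
    rw [← real_inner_self_eq_norm_sq, L2.inner_def]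
    simp only [real_inner_self_eq_norm_sq]
  have hgradi : ∀ Φ : spaceTimeTests d, Integrable (fun p : ℝ × Space d =>
      ‖gradient (Φ.1 p.1) p.2‖ ^ 2 * ρ p.1 p.2) P := fun Φ =>
    (integrable_densMeasure hρm hρ0).1 (hmem Φ).integrable_norm_pow'
  have hAΦ : ∀ Φ : spaceTimeTests d, ‖A Φ‖ ^ 2 =
      ∫ p : ℝ × Space d, ‖gradient (Φ.1 p.1) p.2‖ ^ 2 * ρ p.1 p.2 ∂P := fun Φ => by
    rw [hnorm]
    refine Eq.trans ?_ (integral_densMeasure hρm hρ0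
      fun p : ℝ × Space d => ‖gradient (Φ.1 p.1) p.2‖ ^ 2)
    refine integral_congr_ae ?_
    filter_upwards [hcoe Φ] with p hp
    rw [hp]
  have hbound : ∀ Φ, ℓ Φ ≤ κ / 2 * (∫ p : ℝ × Space d, g p.1 p.2 ^ 2 * ρ p.1 p.2 ∂P) +
      ‖A Φ‖ ^ 2 / 2 := fun Φ => by
    rw [hAΦ]
    change -∫ p : ℝ × Space d, Φ.1 p.1 p.2 * (g p.1 p.2 * ρ p.1 p.2) ∂P ≤ _
    rw [integral_prod _ (hΦi Φ), integral_prod _ hg2, integral_prod _ (hgradi Φ), ← integral_neg,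
      ← integral_const_mul, ← integral_div,
      ← integral_add (hg2.integral_prod_left.const_mul _) ((hgradi Φ).integral_prod_left.div_const 2)]
    refine integral_mono_ae (hΦi Φ).integral_prod_left.neg
      ((hg2.integral_prod_left.const_mul _).add ((hgradi Φ).integral_prod_left.div_const 2)) ?_
    filter_upwards [ae_restrict_mem measurableSet_Ioc, hg2.prod_right_ae] with t ht hgt
    obtain ⟨c, hc⟩ := hP t ht _ (Φ.2.1 t)
    exact neg_integral_mul_le_of_poincare (hρ t) hgm.of_uncurry_left hgt (hg0 t) (Φ.2.1 t) hκ hc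
  -- Solving time by time would require a measurable selection. A single representation in `L²` of
  -- the space-time measure `ρ dx dt` avoids it, since the Poincaré constant does not depend on time
  -- and the bound can be integrated.
  obtain ⟨v, -, hv⟩ := riesz_of_quadratic_bound A ℓ _ hbound
  have hvm : Measurable (v : ℝ × Space d → Space d) := (Lp.stronglyMeasurable v).measurable
  have hv2 : Integrable (fun p : ℝ × Space d => ‖v p‖ ^ 2 * ρ p.1 p.2) P :=
    (integrable_densMeasure hρm hρ0).1 (Lp.memLp v).integrable_norm_pow'
  have hv2t : ∀ᵐ t ∂(volume.restrict (Ioc 0 T)), Integrable fun x => ‖v (t, x)‖ ^ 2 * ρ t x :=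
    hv2.prod_right_ae
  have hgt : ∀ᵐ t ∂(volume.restrict (Ioc 0 T)), Integrable fun x => g t x * ρ t x :=
    hgρ.prod_right_ae
  have hvi : Integrable (fun p : ℝ × Space d => ‖v p‖ * ρ p.1 p.2) P :=
    integrable_mul_of_sq (ρ := Function.uncurry ρ) (f := fun p => ‖v p‖) hρ0 hρi
      (hvm.norm.mul hρm).aestronglyMeasurable hv2
  obtain ⟨Θ, hΘ, hdense⟩ := exists_dense_tests d
  have hweak : ∀ n, ∀ᵐ t ∂(volume.restrict (Ioc 0 T)),
      (∫ x, fderiv ℝ (Θ n) x (v (t, x)) * ρ t x) + ∫ x, Θ n x * (g t x * ρ t x) = 0 := fun n => by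
    obtain ⟨C, hC0, hC⟩ := (hΘ n).bound
    obtain ⟨D, hD0, hD⟩ := (hΘ n).bound_fderiv
    have hi1 : Integrable (fun p : ℝ × Space d => Θ n p.2 * (g p.1 p.2 * ρ p.1 p.2)) P :=
      hgρ.bdd_mul (c := C) ((hΘ n).continuous.comp continuous_snd).aestronglyMeasurable
        (Eventually.of_forall fun p => hC p.2)
    have hi2 : Integrable (fun p : ℝ × Space d => fderiv ℝ (Θ n) p.2 (v p) * ρ p.1 p.2) P := by
      refine (hvi.const_mul D).mono'
        ((measurable_fderiv_apply (hΘ n).1 measurable_snd hvm).mul hρm).aestronglyMeasurable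
        (Eventually.of_forall fun p => ?_)
      rw [norm_mul, Real.norm_of_nonneg ((hρ p.1).nonneg p.2), ← mul_assoc]
      refine mul_le_mul_of_nonneg_right ?_ ((hρ p.1).nonneg p.2)
      exact (ContinuousLinearMap.le_opNorm _ _).trans (by gcongr; exact hD p.2)
    -- Testing against the indicator of `S` times `Θ n` shows that the defect integrates to zero
    -- over every `S`. The exceptional null set depends on `n`, so a countable dense family is used
    -- and all tests are recovered afterwards.
    refine (hi2.integral_prod_left.add hi1.integral_prod_left).ae_eq_zero_of_forall_setIntegral_eq_zero
      fun S hS _ => ?_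
    obtain ⟨hΦ, hgr⟩ := indicator_mem_spaceTimeTests hS (hΘ n)
    set Φ : spaceTimeTests d := ⟨_, hΦ⟩ with hΦdef
    have h1 := hv Φ
    have h2 : inner ℝ v (A Φ) = ∫ t in Ioc 0 T, S.indicator (fun t =>
        ∫ x, fderiv ℝ (Θ n) x (v (t, x)) * ρ t x) t := by
      rw [L2.inner_def]
      have h3 : (fun p => inner ℝ (v p) (A Φ p)) =ᵐ[μ] fun p : ℝ × Space d =>
          S.indicator (fun _ => (1 : ℝ)) p.1 * fderiv ℝ (Θ n) p.2 (v p) := by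
        filter_upwards [hcoe Φ] with p hp
        rw [hp, real_inner_comm]
        have : gradient (Φ.1 p.1) p.2 = _ := hgr p.1 p.2
        rw [this, real_inner_smul_left, inner_gradient_left]
      rw [integral_congr_ae h3, integral_densMeasure hρm hρ0]
      have h4 : Integrable (fun p : ℝ × Space d => S.indicator (fun _ => (1 : ℝ)) p.1 *
          fderiv ℝ (Θ n) p.2 (v p) * Function.uncurry ρ p) P := by
        simp only [mul_assoc]
        refine hi2.bdd_mul (c := 1) (((measurable_const.indicator hS).comp
          measurable_fst).aestronglyMeasurable) (Eventually.of_forall fun p => ?_)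
        by_cases hp : p.1 ∈ S <;> simp [hp]
      rw [integral_prod _ h4]
      congr 1
      ext t
      by_cases ht : t ∈ S <;> simp [ht]
    have h5 : ℓ Φ = -∫ t in Ioc 0 T, S.indicator (fun t =>
        ∫ x, Θ n x * (g t x * ρ t x)) t := by
      change -∫ p : ℝ × Space d, Φ.1 p.1 p.2 * (g p.1 p.2 * ρ p.1 p.2) ∂P = _
      rw [integral_prod _ (hΦi Φ)]
      congr 2
      ext t
      by_cases ht : t ∈ S <;> simp [ht, hΦdef]
    rw [h2, h5, integral_indicator hS, integral_indicator hS, eq_neg_iff_add_eq_zero] at h1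
    refine Eq.trans ?_ h1
    exact integral_add hi2.integral_prod_left.integrableOn hi1.integral_prod_left.integrableOn
  refine ⟨fun t x => v (t, x), hvm, ?_⟩
  filter_upwards [hv2t, hgt, ae_all_iff.2 hweak] with t h1 h2 h3
  have hvt : Measurable fun x => v (t, x) := hvm.comp measurable_prodMk_left
  refine ⟨h1, (hρ t).locallyIntegrable_flux hvt h1, h2.locallyIntegrable, fun φ hφ => ?_⟩
  obtain ⟨k, hk⟩ := dual_bound_of_dense hΘ hdense hφ
  obtain ⟨hk1, hk2⟩ := hk (hρ t) hvt h1
  refine tendsto_nhds_unique (hk2 h2).1 (hk1.neg.congr fun j => ?_)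
  linarith [h3 (k j)]

end MeanFieldControl

/-! ### The Gibbs path and its replicator equation -/

namespace MeanFieldControl

variable {d : ℕ} {ρ₀ h : Space d → ℝ} {β m s : ℝ}

/-- The Gibbs weight `ρ₀ exp (-s (h - m))`. -/
noncomputable def gibbs (ρ₀ h : Space d → ℝ) (m s : ℝ) (x : Space d) : ℝ :=
  ρ₀ x * Real.exp (-(s * (h x - m)))

theorem gibbs_nonneg (hρ : IsDensity ρ₀) (s : ℝ) (x : Space d) : 0 ≤ gibbs ρ₀ h m s x :=
  mul_nonneg (hρ.nonneg x) (Real.exp_pos _).le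

theorem gibbs_antitone (hρ : IsDensity ρ₀) (hm : ∀ x, m ≤ h x) (x : Space d) :
    Antitone fun s => gibbs ρ₀ h m s x := fun s s' hs => by
  have h1 := hρ.nonneg x
  have h2 := sub_nonneg.2 (hm x)
  dsimp only [gibbs]
  gcongr

theorem gibbs_zero (ρ₀ h : Space d → ℝ) (m : ℝ) : gibbs ρ₀ h m 0 = ρ₀ := by
  ext x
  simp [gibbs]

theorem gibbs_le (hρ : IsDensity ρ₀) (hm : ∀ x, m ≤ h x) (hs : 0 ≤ s) (x : Space d) :
    gibbs ρ₀ h m s x ≤ ρ₀ x := by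
  simpa only [gibbs_zero] using gibbs_antitone hρ hm x hs

theorem measurable_gibbs (hρ : IsDensity ρ₀) (hh : Measurable h) :
    Measurable (Function.uncurry (gibbs ρ₀ h m)) :=
  (hρ.measurable.comp measurable_snd).mul
    ((measurable_fst.mul ((hh.comp measurable_snd).sub_const m)).neg.exp)

theorem norm_mul_gibbs_le (hρ : IsDensity ρ₀) (hm : ∀ x, m ≤ h x) (hs : 0 ≤ s) (f : Space d → ℝ)
    (x : Space d) : ‖f x * gibbs ρ₀ h m s x‖ ≤ ‖f x * ρ₀ x‖ := by
  rw [norm_mul, norm_mul, Real.norm_of_nonneg (gibbs_nonneg hρ s x),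
    Real.norm_of_nonneg (hρ.nonneg x)]
  gcongr
  exact gibbs_le hρ hm hs x

theorem integrable_mul_gibbs (hρ : IsDensity ρ₀) (hh : Measurable h) (hm : ∀ x, m ≤ h x)
    (hs : 0 ≤ s) {f : Space d → ℝ} (hf : Measurable f) (hfi : Integrable fun x => f x * ρ₀ x) :
    Integrable fun x => f x * gibbs ρ₀ h m s x :=
  hfi.mono (hf.mul (measurable_gibbs hρ hh).of_uncurry_left).aestronglyMeasurable
    (Eventually.of_forall fun x => norm_mul_gibbs_le hρ hm hs f x)

theorem integrable_gibbs (hρ : IsDensity ρ₀) (hh : Measurable h) (hm : ∀ x, m ≤ h x)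
    (hs : 0 ≤ s) : Integrable (gibbs ρ₀ h m s) := by
  simpa using integrable_mul_gibbs hρ hh hm hs (f := fun _ => 1) measurable_const
    (by simpa using hρ.integrable)

theorem integral_gibbs_pos (hρ : IsDensity ρ₀) (hh : Measurable h) (hm : ∀ x, m ≤ h x)
    (hpos : ∀ x, 0 < ρ₀ x) (hs : 0 ≤ s) : 0 < ∫ x, gibbs ρ₀ h m s x := by
  rw [integral_pos_iff_support_of_nonneg (gibbs_nonneg hρ s) (integrable_gibbs hρ hh hm hs)]
  have : Function.support (gibbs ρ₀ h m s) = univ :=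
    eq_univ_of_forall fun x => (mul_pos (hpos x) (Real.exp_pos _)).ne'
  rw [this]
  exact NeZero.pos _

theorem continuousOn_integral_gibbs (hρ : IsDensity ρ₀) (hh : Measurable h) (hm : ∀ x, m ≤ h x)
    {f : Space d → ℝ} (hf : Measurable f) (hfi : Integrable fun x => f x * ρ₀ x) :
    ContinuousOn (fun s => ∫ x, f x * gibbs ρ₀ h m s x) (Ici 0) := by
  refine continuousOn_of_dominated (bound := fun x => ‖f x * ρ₀ x‖) (fun s hs =>
    (integrable_mul_gibbs hρ hh hm hs hf hfi).aestronglyMeasurable) (fun s hs =>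
    Eventually.of_forall fun x => norm_mul_gibbs_le hρ hm hs f x) hfi.norm
    (Eventually.of_forall fun x => Continuous.continuousOn ?_)
  unfold gibbs
  fun_prop

/-- Differentiation under the integral: for nonnegative parameters the exponential is at most one,
so `|f (h - m)| ρ₀` dominates. A two-sided neighbourhood of this kind exists only for `s > 0`; at
zero the continuity lemma above takes over. -/
theorem hasDerivAt_integral_gibbs (hρ : IsDensity ρ₀) (hh : Measurable h) (hm : ∀ x, m ≤ h x)
    {f : Space d → ℝ} (hf : Measurable f) (hfi : Integrable fun x => f x * ρ₀ x)
    (hfhi : Integrable fun x => f x * (h x - m) * ρ₀ x) (hs : 0 < s) :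
    HasDerivAt (fun s => ∫ x, f x * gibbs ρ₀ h m s x)
      (-∫ x, f x * (h x - m) * gibbs ρ₀ h m s x) s := by
  have hfh : Measurable fun x => f x * (h x - m) := hf.mul (hh.sub_const m)
  have key := hasDerivAt_integral_of_dominated_loc_of_deriv_le (μ := volume) (Ioi_mem_nhds hs)
    (F := fun s x => f x * gibbs ρ₀ h m s x) (bound := fun x => ‖f x * (h x - m) * ρ₀ x‖)
    (F' := fun s x => -(f x * (h x - m) * gibbs ρ₀ h m s x))
    (Filter.eventually_of_mem (Ioi_mem_nhds hs) fun r hr =>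
      (integrable_mul_gibbs hρ hh hm (le_of_lt hr) hf hfi).aestronglyMeasurable)
    (integrable_mul_gibbs hρ hh hm hs.le hf hfi)
    (integrable_mul_gibbs hρ hh hm hs.le hfh hfhi).aestronglyMeasurable.neg
    (Eventually.of_forall fun x r hr => by
      rw [norm_neg]
      exact norm_mul_gibbs_le hρ hm (le_of_lt hr) (fun x => f x * (h x - m)) x)
    hfhi.norm
    (Eventually.of_forall fun x r _ => by
      have h1 : HasDerivAt (fun r => -(r * (h x - m))) (-(1 * (h x - m))) r :=
        ((hasDerivAt_id r).mul_const _).neg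
      refine ((h1.exp.const_mul (ρ₀ x)).const_mul (f x)).congr_deriv ?_
      dsimp only [gibbs]
      ring)
  rw [← integral_neg]
  exact key.2

/-- The normalized Gibbs path, frozen at negative times. -/
noncomputable def gibbsPath (ρ₀ h : Space d → ℝ) (m β t : ℝ) (x : Space d) : ℝ :=
  (∫ y, gibbs ρ₀ h m (β * max t 0) y)⁻¹ * gibbs ρ₀ h m (β * max t 0) x

theorem gibbsPath_of_nonneg {t : ℝ} (ht : 0 ≤ t) (x : Space d) : gibbsPath ρ₀ h m β t x =
    (∫ y, gibbs ρ₀ h m (β * t) y)⁻¹ * gibbs ρ₀ h m (β * t) x := by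
  rw [gibbsPath, max_eq_left ht]

theorem integral_mul_gibbsPath {t : ℝ} (ht : 0 ≤ t) (f : Space d → ℝ) :
    ∫ x, f x * gibbsPath ρ₀ h m β t x =
      (∫ y, gibbs ρ₀ h m (β * t) y)⁻¹ * ∫ x, f x * gibbs ρ₀ h m (β * t) x := by
  rw [← integral_const_mul]
  simp only [gibbsPath_of_nonneg ht, mul_left_comm]

/-- The unnormalized weight never exceeds `ρ₀`, and the normalizer decreases in time, so it is
smallest at `T`. This majorant is uniform in time. -/
theorem gibbsPath_le (hρ : IsDensity ρ₀) (hh : Measurable h) (hm : ∀ x, m ≤ h x)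
    (hpos : ∀ x, 0 < ρ₀ x) (hβ : 0 < β) {t T : ℝ} (hT : 0 ≤ T) (htT : t ≤ T) (x : Space d) :
    gibbsPath ρ₀ h m β t x ≤ (∫ y, gibbs ρ₀ h m (β * T) y)⁻¹ * ρ₀ x := by
  have hs : 0 ≤ β * max t 0 := mul_nonneg hβ.le (le_max_right _ _)
  have hsT : β * max t 0 ≤ β * T := by
    gcongr
    exact max_le htT hT
  have hT' : 0 ≤ β * T := mul_nonneg hβ.le hT
  have h1 := integral_gibbs_pos hρ hh hm hpos hT'
  have h2 : ∫ y, gibbs ρ₀ h m (β * T) y ≤ ∫ y, gibbs ρ₀ h m (β * max t 0) y :=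
    integral_mono (integrable_gibbs hρ hh hm hT') (integrable_gibbs hρ hh hm hs) fun x =>
      gibbs_antitone hρ hm x hsT
  have h3 := gibbs_le hρ hm hs x
  have h4 := gibbs_nonneg (h := h) (m := m) hρ (β * max t 0) x
  unfold gibbsPath
  gcongr

theorem isDensity_gibbsPath (hρ : IsDensity ρ₀) (hh : Measurable h) (hm : ∀ x, m ≤ h x)
    (hpos : ∀ x, 0 < ρ₀ x) (hβ : 0 < β) (t : ℝ) : IsDensity (gibbsPath ρ₀ h m β t) := by
  have hs : 0 ≤ β * max t 0 := mul_nonneg hβ.le (le_max_right _ _)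
  have h1 := integral_gibbs_pos hρ hh hm hpos hs
  refine ⟨(measurable_gibbs hρ hh).of_uncurry_left.const_mul _, fun x =>
    mul_nonneg (inv_nonneg.2 h1.le) (gibbs_nonneg hρ _ x),
    (integrable_gibbs hρ hh hm hs).const_mul _, ?_, ?_⟩
  · unfold gibbsPath
    rw [integral_const_mul, inv_mul_cancel₀ h1.ne']
  · unfold gibbsPath
    simp only [mul_left_comm (‖_‖ ^ 2)]
    exact (integrable_mul_gibbs hρ hh hm hs (f := fun x => ‖x‖ ^ 2) (by fun_prop)
      hρ.second_moment).const_mul _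

theorem gibbsPath_zero (hρ : IsDensity ρ₀) : gibbsPath ρ₀ h m β 0 = ρ₀ := by
  ext x
  simp [gibbsPath, gibbs_zero, hρ.integral_eq_one]

theorem measurable_gibbsPath (hρ : IsDensity ρ₀) (hh : Measurable h) :
    Measurable (Function.uncurry (gibbsPath ρ₀ h m β)) := by
  have h1 : Measurable fun t : ℝ => β * max t 0 := by fun_prop
  have h2 : Measurable fun p : ℝ × Space d => gibbs ρ₀ h m (β * max p.1 0) p.2 :=
    (measurable_gibbs hρ hh).comp ((h1.comp measurable_fst).prodMk measurable_snd)
  have h3 : Measurable fun t : ℝ => ∫ x, gibbs ρ₀ h m (β * max t 0) x :=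
    h2.stronglyMeasurable.integral_prod_right.measurable
  exact (h3.comp measurable_fst).inv.mul h2

/-- The replicator equation satisfied by the Gibbs path. -/
theorem hasDerivAt_integral_gibbsPath (hρ : IsDensity ρ₀) (hh : Measurable h) (hm : ∀ x, m ≤ h x)
    (hpos : ∀ x, 0 < ρ₀ x) (hi : Integrable fun x => h x * ρ₀ x) (hβ : 0 < β)
    {φ : Space d → ℝ} (hφ : IsTest φ) {t : ℝ} (ht : 0 < t) :
    HasDerivAt (fun t => ∫ x, φ x * gibbsPath ρ₀ h m β t x)
      (-∫ x, φ x * (β * (h x - mean (gibbsPath ρ₀ h m β t) h) * gibbsPath ρ₀ h m β t x)) t := by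
  have hs : 0 < β * t := mul_pos hβ ht
  have hd := isDensity_gibbsPath hρ hh hm hpos hβ t
  obtain ⟨C, hC0, hC⟩ := hφ.bound
  have hyi := hρ.integrable_sub_mul hi m
  have hφi : Integrable fun x => φ x * ρ₀ x :=
    hρ.integrable_bdd_mul hφ.continuous.aestronglyMeasurable hC
  have hφyi : Integrable fun x => φ x * (h x - m) * ρ₀ x := by
    simp only [mul_assoc]
    exact hyi.bdd_mul hφ.continuous.aestronglyMeasurable (Eventually.of_forall hC)
  have hmul : HasDerivAt (fun t : ℝ => β * t) β t := by
    simpa using (hasDerivAt_id t).const_mul β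
  have hN := (hasDerivAt_integral_gibbs hρ hh hm hφ.continuous.measurable hφi hφyi hs).comp t hmul
  have hZ := (hasDerivAt_integral_gibbs hρ hh hm (f := fun _ => 1) measurable_const
    (by simpa using hρ.integrable) (by simpa using hyi) hs).comp t hmul
  simp only [one_mul] at hZ
  have hZpos := integral_gibbs_pos hρ hh hm hpos hs.le
  -- Quotient rule: differentiating the numerator produces `-β (h - m)` and differentiating the
  -- normalizer restores the mean, which together give `-β (h - ĥ)`.
  have hq := (hZ.inv hZpos.ne').mul hN
  have hdi : Integrable fun x => h x * gibbsPath ρ₀ h m β t x := by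
    have := (integrable_mul_gibbs hρ hh hm hs.le hh hi).const_mul (∫ y, gibbs ρ₀ h m (β * t) y)⁻¹
    simpa only [gibbsPath_of_nonneg ht.le, mul_left_comm] using this
  have hdyi := hd.integrable_sub_mul hdi m
  have hdφi : Integrable fun x => φ x * gibbsPath ρ₀ h m β t x :=
    hd.integrable_bdd_mul hφ.continuous.aestronglyMeasurable hC
  have hdφyi : Integrable fun x => φ x * ((h x - m) * gibbsPath ρ₀ h m β t x) :=
    hdyi.bdd_mul hφ.continuous.aestronglyMeasurable (Eventually.of_forall hC)
  have hmean := hd.integral_sub_mul hdi m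
  have hval : ∫ x, φ x * (β * (h x - mean (gibbsPath ρ₀ h m β t) h) * gibbsPath ρ₀ h m β t x) =
      β * ((∫ x, φ x * (h x - m) * gibbsPath ρ₀ h m β t x) -
        (∫ x, (h x - m) * gibbsPath ρ₀ h m β t x) * ∫ x, φ x * gibbsPath ρ₀ h m β t x) := by
    rw [hmean, ← integral_const_mul, ← integral_sub (by simpa only [mul_assoc] using hdφyi)
      (hdφi.const_mul _), ← integral_const_mul]
    refine integral_congr_ae (Eventually.of_forall fun x => ?_)
    dsimp only
    ring
  rw [hval, integral_mul_gibbsPath ht.le, integral_mul_gibbsPath ht.le, integral_mul_gibbsPath ht.le]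
  refine (hq.congr_deriv ?_).congr_of_eventuallyEq ?_
  · simp only [Function.comp_def, Pi.inv_apply]
    field_simp
    ring
  · filter_upwards [Ioi_mem_nhds ht] with r hr
    rw [integral_mul_gibbsPath (le_of_lt hr)]
    rfl

theorem continuousOn_integral_gibbsPath (hρ : IsDensity ρ₀) (hh : Measurable h)
    (hm : ∀ x, m ≤ h x) (hpos : ∀ x, 0 < ρ₀ x) (hβ : 0 < β) {φ : Space d → ℝ} (hφ : IsTest φ) :
    ContinuousOn (fun t => ∫ x, φ x * gibbsPath ρ₀ h m β t x) (Ici 0) := by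
  obtain ⟨C, hC0, hC⟩ := hφ.bound
  have hmaps : MapsTo (fun t : ℝ => β * t) (Ici 0) (Ici 0) := fun t ht => mul_nonneg hβ.le ht
  have hmul : ContinuousOn (fun t : ℝ => β * t) (Ici 0) := by fun_prop
  have hN := (continuousOn_integral_gibbs hρ hh hm hφ.continuous.measurable
    (hρ.integrable_bdd_mul hφ.continuous.aestronglyMeasurable hC)).comp hmul hmaps
  have hZ := (continuousOn_integral_gibbs hρ hh hm (f := fun _ => 1) measurable_const
    (by simpa using hρ.integrable)).comp hmul hmaps
  simp only [one_mul] at hZ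
  refine ((hZ.inv₀ fun t ht => (integral_gibbs_pos hρ hh hm hpos (hmaps ht)).ne').mul hN).congr
    fun t ht => ?_
  exact integral_mul_gibbsPath ht φ

end MeanFieldControl

/-! ### Existence of a control driving the Gibbs path -/

namespace MeanFieldControl

variable {d : ℕ} {ρ₀ h : Space d → ℝ} {β m : ℝ}

/-- Up to time `T` the densities are at most a constant times `ρ₀`, which also bounds the means;
square integrability of `h` under the prior then suffices. -/
theorem integrable_sq_gibbsPath (hρ : IsDensity ρ₀) (hh : Measurable h) (hm : ∀ x, m ≤ h x)
    (hpos : ∀ x, 0 < ρ₀ x) (hi : Integrable fun x => h x * ρ₀ x)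
    (hi2 : Integrable fun x => h x ^ 2 * ρ₀ x) (hβ : 0 < β) {T : ℝ} (hT : 0 ≤ T) :
    Integrable (fun p : ℝ × Space d =>
      (β * (h p.2 - mean (gibbsPath ρ₀ h m β p.1) h)) ^ 2 * gibbsPath ρ₀ h m β p.1 p.2)
      ((volume.restrict (Ioc 0 T)).prod volume) := by
  set k := (∫ y, gibbs ρ₀ h m (β * T) y)⁻¹ with hk
  have hk0 : 0 < k := inv_pos.2 (integral_gibbs_pos hρ hh hm hpos (mul_nonneg hβ.le hT))
  have hle : ∀ t ≤ T, ∀ x, gibbsPath ρ₀ h m β t x ≤ k * ρ₀ x := fun t ht =>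
    gibbsPath_le hρ hh hm hpos hβ hT ht
  have hd := isDensity_gibbsPath hρ hh hm hpos hβ
  have hρm := measurable_gibbsPath (m := m) (β := β) hρ hh
  have hyi := hρ.integrable_sub_mul hi m
  set C := k * ∫ x, (h x - m) * ρ₀ x with hC
  have hmean : ∀ t ≤ T, 0 ≤ mean (gibbsPath ρ₀ h m β t) h - m ∧
      mean (gibbsPath ρ₀ h m β t) h - m ≤ C := fun t ht => by
    have hdi : Integrable fun x => h x * gibbsPath ρ₀ h m β t x := by
      refine (hi.const_mul k).mono (hh.mul (hd t).measurable).aestronglyMeasurable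
        (Eventually.of_forall fun x => ?_)
      rw [mul_left_comm, norm_mul, norm_mul, Real.norm_of_nonneg ((hd t).nonneg x),
        Real.norm_of_nonneg (mul_nonneg hk0.le (hρ.nonneg x))]
      gcongr
      exact hle t ht x
    refine ⟨sub_nonneg.2 ((hd t).le_mean hdi hm), ?_⟩
    rw [← (hd t).integral_sub_mul hdi m, hC, ← integral_const_mul]
    refine integral_mono ((hd t).integrable_sub_mul hdi m) (hyi.const_mul k) fun x => ?_
    dsimp only
    rw [mul_left_comm]
    exact mul_le_mul_of_nonneg_left (hle t ht x) (sub_nonneg.2 (hm x))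
  have hmm : Measurable fun t => mean (gibbsPath ρ₀ h m β t) h :=
    (((hh.comp measurable_snd).mul hρm).stronglyMeasurable.integral_prod_right).measurable
  have hbi : Integrable fun x => 2 * β ^ 2 * ((h x - m) ^ 2 + C ^ 2) * (k * ρ₀ x) := by
    have := (((hi2.sub (hi.const_mul (2 * m))).add
      (hρ.integrable.const_mul (m ^ 2 + C ^ 2))).const_mul (2 * β ^ 2 * k))
    refine this.congr (Eventually.of_forall fun x => ?_)
    simp only [Pi.add_apply, Pi.sub_apply]
    ring
  refine (hbi.comp_snd (volume.restrict (Ioc 0 T))).mono'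
    ((((hh.comp measurable_snd).sub (hmm.comp measurable_fst)).const_mul β).pow_const 2 |>.mul
      hρm).aestronglyMeasurable ?_
  filter_upwards [Measure.quasiMeasurePreserving_fst.ae
    (ae_restrict_mem (μ := volume) (measurableSet_Ioc (a := (0 : ℝ)) (b := T)))] with p hp
  obtain ⟨h1, h2⟩ := hmean p.1 hp.2
  rw [Real.norm_of_nonneg (mul_nonneg (sq_nonneg _) ((hd p.1).nonneg p.2))]
  refine mul_le_mul ?_ (hle p.1 hp.2 p.2) ((hd p.1).nonneg p.2) (by positivity)
  have h3 : (mean (gibbsPath ρ₀ h m β p.1) h - m) ^ 2 ≤ C ^ 2 := pow_le_pow_left₀ h1 h2 2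
  have h4 : (h p.2 - mean (gibbsPath ρ₀ h m β p.1) h) ^ 2 ≤ 2 * ((h p.2 - m) ^ 2 + C ^ 2) := by
    nlinarith [sq_nonneg ((h p.2 - m) + (mean (gibbsPath ρ₀ h m β p.1) h - m))]
  rw [mul_pow]
  nlinarith [mul_le_mul_of_nonneg_left h4 (sq_nonneg β)]

/-- The Gibbs path satisfies a Poincaré inequality, uniformly on bounded time intervals. -/
theorem exists_poincare_gibbsPath (hprior : PriorAssumption ρ₀) (hobj : ObjectiveAssumption ρ₀ h)
    (hm : ∀ x, m ≤ h x) (hpos : ∀ x, 0 < ρ₀ x) (hβ : 0 < β) {T : ℝ} (hT : 0 ≤ T) :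
    ∃ κ, 0 < κ ∧ ∀ t ∈ Ioc 0 T, ∀ φ, IsTest φ → ∃ c, ∫ x, (φ x - c) ^ 2 * gibbsPath ρ₀ h m β t x ≤
      κ * ∫ x, ‖fderiv ℝ φ x‖ ^ 2 * gibbsPath ρ₀ h m β t x := by
  obtain ⟨V, hV, hVc, -, hVlim⟩ := hprior.potential
  obtain ⟨c, hc⟩ := hobj.radial
  have hhc : ContDiff ℝ 1 h := hobj.contDiff.of_le one_le_two
  replace hVc : ContDiff ℝ 1 V := hVc.of_le one_le_two
  have hρ := hprior.density
  have hh := hhc.continuous.measurable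
  -- The term `β T |c|` compensates the worst radial slope of `h` for every `t ≤ T`, leaving slope
  -- at least `2 (d + 1)`. The factor two pays for `invJapanese x * ‖x‖ ≥ 1/2`, valid because `R ≥
  -- 1`.
  obtain ⟨R₀, -, hR₀⟩ := hasBasis_cobounded_norm.eventually_iff.1
    (hc.and (hVlim.eventually_ge_atTop (2 * (d + 1) + β * T * |c|)))
  set R := max R₀ 1 with hR
  have hR1 : 1 ≤ R := le_max_right _ _
  obtain ⟨K, hK⟩ := (isCompact_closedBall (0 : Space d) R).exists_bound_of_continuousOn
    (f := fun x => ‖fderiv ℝ V x‖ + β * T * ‖fderiv ℝ h x‖)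
    ((hVc.continuous_fderiv one_ne_zero).norm.add
      ((hhc.continuous_fderiv one_ne_zero).norm.const_mul _)).continuousOn
  obtain ⟨M, hM⟩ := (isCompact_closedBall (0 : Space d) R).exists_bound_of_continuousOn
    (f := fun x => |V x| + β * T * |h x - m|)
    (hVc.continuous.abs.add
      ((hhc.continuous.sub continuous_const).abs.const_mul _)).continuousOn
  obtain ⟨κ, hκ, hP⟩ := exists_poincare_const (d := d) (R := R) (K := max K 0) (a := -M) (b := M)
    (by linarith) (le_max_right _ _)
  refine ⟨κ, hκ, fun t ht φ hφ => ?_⟩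
  have hs0 : 0 ≤ β * t := mul_nonneg hβ.le ht.1.le
  have hsT : β * t ≤ β * T := mul_le_mul_of_nonneg_left ht.2 hβ.le
  have hU : ∀ x, Real.exp (-(V x + β * t * (h x - m))) = gibbs ρ₀ h m (β * t) x := fun x => by
    rw [gibbs, hV, ← Real.exp_add]
    ring_nf
  have hD : ∀ x v, fderiv ℝ (fun x => V x + β * t * (h x - m)) x v =
      fderiv ℝ V x v + β * t * fderiv ℝ h x v := fun x v => congrArg (· v)
    ((hVc.differentiable one_ne_zero x).hasFDerivAt.add
      (((hhc.differentiable one_ne_zero x).hasFDerivAt.sub_const m).const_mul (β * t))).fderiv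
  have hball : ∀ x : Space d, ‖x‖ < R → x ∈ Metric.closedBall (0 : Space d) R := fun x hx =>
    mem_closedBall_zero_iff.2 hx.le
  obtain ⟨a, ha⟩ := hP (fun x => V x + β * t * (h x - m))
    (hVc.add (contDiff_const.mul (hhc.sub contDiff_const)))
    (by simpa only [hU] using integrable_gibbs hρ hh hm hs0)
    (fun x hx => by
      have hx1 : 1 ≤ ‖x‖ := hR1.trans hx
      obtain ⟨h1, h2⟩ := hR₀ (show x ∈ {x | R₀ ≤ ‖x‖} from (le_max_left _ _).trans hx)
      have h3 : fderiv ℝ (fun x => V x + β * t * (h x - m)) x x =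
          ‖x‖ * fderiv ℝ (fun x => V x + β * t * (h x - m)) x (‖x‖⁻¹ • x) := by
        rw [map_smul, smul_eq_mul, mul_inv_cancel_left₀ (by linarith)]
      have h4 : 2 * ((d : ℝ) + 1) ≤
          fderiv ℝ (fun x => V x + β * t * (h x - m)) x (‖x‖⁻¹ • x) := by
        rw [hD]
        nlinarith [mul_le_mul_of_nonneg_left h1 hs0, neg_abs_le c, abs_nonneg c,
          mul_le_mul_of_nonneg_right hsT (abs_nonneg c),
          mul_le_mul_of_nonneg_left (neg_abs_le c) hs0]
      rw [h3, ← mul_assoc]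
      have h5 := half_le_invJapanese_mul_norm hx1
      have h6 : (0 : ℝ) ≤ d := Nat.cast_nonneg d
      nlinarith)
    (fun x hx => by
      have h1 := hK x (hball x hx)
      rw [Real.norm_eq_abs] at h1
      have h2 : |invJapanese x * fderiv ℝ (fun x => V x + β * t * (h x - m)) x x| ≤
          ‖fderiv ℝ V x‖ + β * T * ‖fderiv ℝ h x‖ := by
        have h3 : |fderiv ℝ (fun x => V x + β * t * (h x - m)) x x| ≤
            (‖fderiv ℝ V x‖ + β * T * ‖fderiv ℝ h x‖) * ‖x‖ := by
          rw [hD]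
          refine (abs_add_le _ _).trans ?_
          rw [abs_mul, abs_of_nonneg hs0, add_mul, mul_assoc (β * T)]
          have h4 := (fderiv ℝ V x).le_opNorm x
          have h5 := (fderiv ℝ h x).le_opNorm x
          rw [Real.norm_eq_abs] at h4 h5
          gcongr
        rw [abs_mul, abs_of_pos (invJapanese_pos x)]
        calc _ ≤ invJapanese x * ((‖fderiv ℝ V x‖ + β * T * ‖fderiv ℝ h x‖) * ‖x‖) :=
              mul_le_mul_of_nonneg_left h3 (invJapanese_pos x).le
          _ = (‖fderiv ℝ V x‖ + β * T * ‖fderiv ℝ h x‖) * (invJapanese x * ‖x‖) := by ring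
          _ ≤ _ := mul_le_of_le_one_right (by positivity) (invJapanese_mul_norm_le_one x)
      linarith [neg_abs_le (invJapanese x * fderiv ℝ (fun x => V x + β * t * (h x - m)) x x),
        le_abs_self (‖fderiv ℝ V x‖ + β * T * ‖fderiv ℝ h x‖), le_max_left K 0])
    (fun x hx => by
      have h1 := hM x (hball x hx)
      rw [Real.norm_eq_abs] at h1
      refine abs_le.1 (le_trans ?_ ((le_abs_self _).trans h1))
      refine (abs_add_le _ _).trans ?_
      rw [abs_mul, abs_of_nonneg hs0]
      gcongr) φ hφ
  refine ⟨a, ?_⟩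
  simp only [hU] at ha
  have hZ := integral_gibbs_pos hρ hh hm hpos hs0
  -- Both sides are homogeneous in the weight, so the normalizer cancels and does not affect the
  -- constant.
  rw [integral_mul_gibbsPath ht.1.le, integral_mul_gibbsPath ht.1.le, mul_left_comm]
  exact mul_le_mul_of_nonneg_left ha (inv_nonneg.2 hZ.le)

/-- Some control drives the prior along the Gibbs path and obeys the control law. -/
theorem exists_solvesControlLaw (hprior : PriorAssumption ρ₀) (hobj : ObjectiveAssumption ρ₀ h)
    (hm : ∀ x, m ≤ h x) (hβ : 0 < β) :
    ∃ ρ u, IsControlledPath ρ₀ ρ u ∧ SolvesControlLaw β h ρ u := by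
  have hρ := hprior.density
  have hpos : ∀ x, 0 < ρ₀ x := fun x => by
    obtain ⟨V, hV, -⟩ := hprior.potential
    rw [hV]
    exact Real.exp_pos _
  have hh := hobj.contDiff.continuous.measurable
  have hi : Integrable fun x => h x * ρ₀ x :=
    integrable_mul_of_sq hρ.nonneg hρ.integrable (hh.mul hρ.measurable).aestronglyMeasurable
      hobj.sq_integrable
  have hd := isDensity_gibbsPath hρ hh hm hpos hβ
  have hρm := measurable_gibbsPath (m := m) (β := β) hρ hh
  have hmm : Measurable fun t => mean (gibbsPath ρ₀ h m β t) h :=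
    (((hh.comp measurable_snd).mul hρm).stronglyMeasurable.integral_prod_right).measurable
  set g : ℝ → Space d → ℝ := fun t x => β * (h x - mean (gibbsPath ρ₀ h m β t) h) with hg
  have hgm : Measurable (Function.uncurry g) :=
    ((hh.comp measurable_snd).sub (hmm.comp measurable_fst)).const_mul β
  have hg0 : ∀ t, ∫ x, g t x * gibbsPath ρ₀ h m β t x = 0 := fun t => by
    have hdi : Integrable fun x => h x * gibbsPath ρ₀ h m β t x := by
      have := (integrable_mul_gibbs hρ hh hm (mul_nonneg hβ.le (le_max_right t 0)) hh hi).const_mul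
        (∫ y, gibbs ρ₀ h m (β * max t 0) y)⁻¹
      simpa only [gibbsPath, mul_left_comm] using this
    simp only [hg, mul_assoc]
    rw [integral_const_mul, (hd t).integral_sub_mul hdi, sub_self, mul_zero]
  have hg2 : ∀ T : ℝ, 0 ≤ T → Integrable (fun p : ℝ × Space d =>
      g p.1 p.2 ^ 2 * gibbsPath ρ₀ h m β p.1 p.2) ((volume.restrict (Ioc 0 T)).prod volume) :=
    fun T hT => integrable_sq_gibbsPath hρ hh hm hpos hi hobj.sq_integrable hβ hT
  have hex : ∀ n : ℕ, ∃ u : ℝ → Space d → Space d, Measurable (Function.uncurry u) ∧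
      ∀ᵐ t ∂(volume.restrict (Ioc 0 ((n : ℝ) + 1))),
        (Integrable fun x => ‖u t x‖ ^ 2 * gibbsPath ρ₀ h m β t x) ∧
          IsWeakDiv (gibbsPath ρ₀ h m β t) (u t) (g t) := fun n => by
    have hT : 0 ≤ (n : ℝ) + 1 := by positivity
    obtain ⟨κ, hκ, hP⟩ := exists_poincare_gibbsPath hprior hobj hm hpos hβ hT
    exact exists_control_of_poincare hρm hd hgm (hg2 _ hT) hg0 hκ hP
  choose U hUm hU using hex
  -- The Poincaré constant depends on the horizon, so the controls found on `(0, n + 1]` are glued: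
  -- at time `t` the one with `n = ⌊t⌋₊` is used, and `t ≤ ⌊t⌋₊ + 1`.
  set u : ℝ → Space d → Space d := fun t x => U ⌊t⌋₊ t x with hu
  have hum : Measurable (Function.uncurry u) := by
    have h1 : Measurable fun q : (ℝ × Space d) × ℕ => U q.2 q.1.1 q.1.2 :=
      measurable_from_prod_countable_left fun n => hUm n
    exact h1.comp (measurable_id.prodMk (Nat.measurable_floor.comp measurable_fst))
  have hlaw : ∀ᵐ t ∂(volume.restrict (Ioi (0 : ℝ))),
      (Integrable fun x => ‖u t x‖ ^ 2 * gibbsPath ρ₀ h m β t x) ∧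
        IsWeakDiv (gibbsPath ρ₀ h m β t) (u t) (g t) := by
    have h1 := fun n => (ae_restrict_iff' measurableSet_Ioc).1 (hU n)
    filter_upwards [ae_restrict_of_ae (ae_all_iff.2 h1), ae_restrict_mem measurableSet_Ioi]
      with t ht ht0
    exact ht ⌊t⌋₊ ⟨ht0, (Nat.lt_floor_add_one t).le⟩
  refine ⟨gibbsPath ρ₀ h m β, u, ⟨hρm, hum, fun t _ => hd t, gibbsPath_zero hρ,
    hlaw.mono fun t ht => ht.1, fun φ hφ t ht => ?_⟩, hlaw.mono fun t ht => ht.2⟩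
  set P : Measure (ℝ × Space d) := (volume.restrict (Ioc 0 t)).prod volume with hPdef
  have hρi : Integrable (Function.uncurry (gibbsPath ρ₀ h m β)) P :=
    integrable_uncurry_density hρm hd
  have hgρ : Integrable (fun p : ℝ × Space d => g p.1 p.2 * gibbsPath ρ₀ h m β p.1 p.2) P :=
    integrable_mul_of_sq (ρ := Function.uncurry (gibbsPath ρ₀ h m β)) (f := Function.uncurry g)
      (fun p => (hd p.1).nonneg p.2) hρi (hgm.mul hρm).aestronglyMeasurable (hg2 t ht)
  obtain ⟨C, hC0, hC⟩ := hφ.bound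
  have hφg : Integrable (fun p : ℝ × Space d =>
      φ p.2 * (g p.1 p.2 * gibbsPath ρ₀ h m β p.1 p.2)) P :=
    hgρ.bdd_mul (c := C) (hφ.continuous.comp continuous_snd).aestronglyMeasurable
      (Eventually.of_forall fun p => hC p.2)
  have hint : IntervalIntegrable
      (fun s => -∫ x, φ x * (g s x * gibbsPath ρ₀ h m β s x)) volume 0 t :=
    (intervalIntegrable_iff_integrableOn_Ioc_of_le ht).2 hφg.integral_prod_left.neg
  have heq : ∀ᵐ s ∂(volume.restrict (Ioc 0 t)),
      -∫ x, φ x * (g s x * gibbsPath ρ₀ h m β s x) =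
        ∫ x, fderiv ℝ φ x (u s x) * gibbsPath ρ₀ h m β s x := by
    filter_upwards [ae_restrict_of_ae_restrict_of_subset Ioc_subset_Ioi_self hlaw] with s hs
    rw [hs.2.weak φ hφ, neg_neg]
  refine ⟨hint.congr_ae ?_, ?_⟩
  · rwa [uIoc_of_le ht]
  -- This form needs the derivative only inside the interval and continuity at its ends, which is
  -- all that is available at time zero.
  · have hftc := intervalIntegral.integral_eq_sub_of_hasDerivAt_of_le ht
      ((continuousOn_integral_gibbsPath hρ hh hm hpos hβ hφ).mono Icc_subset_Ici_self)
      (fun s hs => hasDerivAt_integral_gibbsPath hρ hh hm hpos hi hβ hφ hs.1) hint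
    rw [gibbsPath_zero hρ] at hftc
    have hcongr : ∫ s in (0 : ℝ)..t, -∫ x, φ x * (g s x * gibbsPath ρ₀ h m β s x) =
        ∫ s in (0 : ℝ)..t, ∫ x, fderiv ℝ φ x (u s x) * gibbsPath ρ₀ h m β s x :=
      intervalIntegral.integral_congr_ae_restrict (by rwa [uIoc_of_le ht])
    rw [← hcongr]
    exact eq_add_of_sub_eq' hftc.symm

end MeanFieldControl

/-! ### Verification: value, existence and characterization of optimal controls -/

theorem theorem3 {d : ℕ} (β : ℝ) (hβ : 0 < β)
    (ρ₀ h : MeanFieldControl.Space d → ℝ) (xbar : MeanFieldControl.Space d)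
    (hprior : MeanFieldControl.PriorAssumption ρ₀)
    (hobj : MeanFieldControl.ObjectiveAssumption ρ₀ h)
    (hmin : MeanFieldControl.MinimizerAssumption h xbar) :
    ((MeanFieldControl.valueFunction β h xbar ρ₀ : ENNReal) : EReal) =
        ((β * (∫ x, h x * ρ₀ x) - β * h xbar : ℝ) : EReal) ∧
      (∃ (ρ : ℝ → MeanFieldControl.Space d → ℝ)
          (u : ℝ → MeanFieldControl.Space d → MeanFieldControl.Space d),
        MeanFieldControl.IsOptimal β h xbar ρ₀ ρ u) ∧
      ∀ (ρ : ℝ → MeanFieldControl.Space d → ℝ)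
        (u : ℝ → MeanFieldControl.Space d → MeanFieldControl.Space d),
        MeanFieldControl.IsControlledPath ρ₀ ρ u →
          (MeanFieldControl.IsOptimal β h xbar ρ₀ ρ u ↔
            MeanFieldControl.SolvesControlLaw β h ρ u) := by
  open MeanFieldControl in
  have hc : ContDiff ℝ 1 h := hobj.contDiff.of_le one_le_two
  have hm : ∀ x, h xbar ≤ h x := fun x => by
    rcases eq_or_ne x xbar with rfl | hx
    · exact le_rfl
    · exact (hmin.unique_min x hx).le
  have hq := exists_quadratic_bound hobj.contDiff hobj.hessian_bounded
  have hpos : ∀ x, 0 < ρ₀ x := fun x => by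
    obtain ⟨V, hV, -⟩ := hprior.potential
    rw [hV]
    exact Real.exp_pos _
  -- The bounded Hessian gives `h` at most quadratic growth, so the finite second moments make every
  -- mean of `h` along a path genuine.
  have hi : ∀ {ρ u}, IsControlledPath ρ₀ ρ u → ∀ t, 0 ≤ t → Integrable fun x => h x * ρ t x :=
    fun hp t ht => (hp.density t ht).integrable_of_quadratic hc.continuous.measurable hq
  have h0 : h xbar ≤ mean ρ₀ h := hprior.density.le_mean
    (hprior.density.integrable_of_quadratic hc.continuous.measurable hq) hm
  have hlow : ∀ {ρ u}, IsAdmissible h xbar ρ₀ ρ u →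
      ENNReal.ofReal (β * (mean ρ₀ h - h xbar)) ≤ cost β h ρ u := fun ha =>
    (ha.path.le_cost hβ hc hm (hi ha.path) ha.terminal).1
  have hadm : ∀ {ρ u}, IsControlledPath ρ₀ ρ u → SolvesControlLaw β h ρ u →
      IsAdmissible h xbar ρ₀ ρ u := fun hp hl =>
    ⟨hp, hp.tendsto_mean_of_law hβ hc.continuous hpos hm (hi hp) hl⟩
  have hcost : ∀ {ρ u}, IsControlledPath ρ₀ ρ u → SolvesControlLaw β h ρ u →
      cost β h ρ u = ENNReal.ofReal (β * (mean ρ₀ h - h xbar)) := fun hp hl =>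
    (hp.cost_le_of_law hβ hc hm (hi hp) hl).antisymm (hlow (hadm hp hl))
  obtain ⟨ρ', u', hp', hl'⟩ := exists_solvesControlLaw hprior hobj hm hβ
  have hval : valueFunction β h xbar ρ₀ = ENNReal.ofReal (β * (mean ρ₀ h - h xbar)) := by
    refine le_antisymm ?_ (le_iInf fun ρ => le_iInf fun u => le_iInf fun ha => hlow ha)
    rw [← hcost hp' hl']
    exact iInf_le_of_le ρ' (iInf_le_of_le u' (iInf_le_of_le (hadm hp' hl') le_rfl))
  have hopt : ∀ {ρ u}, IsControlledPath ρ₀ ρ u → SolvesControlLaw β h ρ u →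
      IsOptimal β h xbar ρ₀ ρ u := fun hp hl => ⟨hadm hp hl, (hcost hp hl).trans hval.symm⟩
  refine ⟨?_, ⟨ρ', u', hopt hp' hl'⟩, fun ρ u hp => ⟨fun ho => ?_, hopt hp⟩⟩
  -- The mean of `h` is at least its minimum, so `ENNReal.ofReal` truncates nothing.
  · rw [hval, EReal.coe_ennreal_ofReal, max_eq_left (mul_nonneg hβ.le (sub_nonneg.2 h0)), mul_sub]
    rfl
  · exact (hp.le_cost hβ hc hm (hi hp) ho.1.terminal).2 (ho.2.trans hval) h0
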